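/- Let $\mathbb X$ and $\Theta$ be Polish spaces, or Borel subsets of Euclidean spaces, with their Borel $\sigma$-fields, let $\mu$ be a $\sigma$-finite measure on $\mathbb X$, and let $f(x\mid\theta)\ge 0$ be jointly measurable with $\int f(x\mid\theta)\,d\mu(x)=1$ for every $\theta\in\Theta$. For a probability measure $H$ on $\Theta$ write $f_H(x)=\int f(x\mid\theta)\,dH(\theta)$, $dF_H=f_H\,d\mu$, and $P_H(A\mid x)=\int_A f(x\mid\theta)\,dH(\theta)/f_H(x)$ (on the $F_H$-null set where $f_H(x)\in\{0,\infty\}$ put $P_H(\cdot\mid x)=H$). Let $G_0$ be a probability measure on $\Theta$, let $(\alpha_n)_{n\ge1}$ be numbers in $(0,1)$, and define recursively $$G_n(A)=(1-\alpha_n)\,G_{n-1}(A)+\alpha_n\,P_{G_{n-1}}(A\mid X_n),\qquad n\ge 1.$$ Let $((X_n,\theta_n))_{n\ge1}$ be random variables on a probability space with law $P$ such that, for every $n\ge0$, conditionally on $X_{1:n}=(X_1,\dots,X_n)$ the variable $\theta_{n+1}$ has law $G_n$, and conditionally on $(X_{1:n},\theta_{n+1})$ the variable $X_{n+1}$ has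 density $f(\cdot\mid\theta_{n+1})$ with respect to $\mu$. Assume that $\sum_n\alpha_n=\infty$ and $\sum_n\alpha_n^2<\infty$, and let $(r_n)_{n\ge1}$ be a monotone sequence of positive numbers with $r_n\sim\big(\sum_{j>n}\alpha_j^2\big)^{-1}$ as $n\to\infty$, such that $$\sqrt{r_n}\,\sup_{k\ge n}\alpha_k\to0\qquad\text{and}\qquad \sum_{k\ge1}r_k^2\,\alpha_{k+1}^4<\infty .$$ Then the random measures $G_n$ converge weakly, almost surely, to a random probability measure $G$ on $\Theta$. Moreover, for $k\ge1$ and $A_1,\dots,A_k\in\mathcal B(\Theta)$, let $C_n$ and $C$ be the random $k\times k$ matrices with entries $$(C_n)_{ij}=\int_{\mathbb X}P_{G_n}(A_i\mid x)P_{G_n}(A_j\mid x)\,dF_{G_n}(x)-G_n(A_i)G_n(A_j),$$ $$C_{ij}=\int_{\{f_G\ne0\}}P_{G}(A_i\mid x)P_{G}(A_j\mid x)\,dF_{G}(x)-G(A_i)G(A_j).$$ Then, for every $k\ge1$, all $A_1,\dots,A_k\in\mathcal B(\Theta)$ and almost every $\omega$ with $\det C(\omega)\ne0$, the (regular) conditional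 law given $X_{1:n}$, evaluated at $x_{1:n}=X_{1:n}(\omega)$, $$P\Big(\sqrt{r_n}\;C_n^{-1/2}\,\big(G(A_1)-G_n(A_1),\dots,G(A_k)-G_n(A_k)\big)^{T}\in\cdot\;\Big|\;x_{1:n}\Big)$$ converges weakly to the standard Gaussian law $N_k(0,I)$ as $n\to\infty$. Here $C_n^{-1/2}$ is the symmetric inverse square root of $C_n$; where the positive semidefinite matrix $C_n$ is singular, it is the matrix obtained by applying to the eigenvalues $t$ of $C_n$ the function $t\mapsto t^{-1/2}$ for $t>0$, $0\mapsto0$. -/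

import Mathlib

open MeasureTheory ProbabilityTheory Filter Topology Asymptotics
open scoped NNReal ENNReal Matrix

namespace NewtonMixture

noncomputable section

section Mixture

variable {𝕏 Θ : Type*} [MeasurableSpace 𝕏] [MeasurableSpace Θ]

/-- The mixture density `f_H(x) = ∫ f(x | θ) dH(θ)`. -/
def mixtureDensity (f : 𝕏 → Θ → ℝ≥0) (H : ProbabilityMeasure Θ) (x : 𝕏) : ℝ≥0∞ :=
  ∫⁻ θ, (f x θ : ℝ≥0∞) ∂(H : Measure Θ)

/-- The mixture law `F_H`, which has density `f_H` with respect to `μ`. -/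
def mixtureLaw (μ : Measure 𝕏) (f : 𝕏 → Θ → ℝ≥0) (H : ProbabilityMeasure Θ) : Measure 𝕏 :=
  μ.withDensity (mixtureDensity f H)

/-- The law `P_H(· | x)`, given by `P_H(A | x) = ∫_A f(x | θ) dH(θ) / ∫ f(x | θ) dH(θ)`. On the
`F_H`-null set of the points `x` where the denominator is `0` or `∞` it is set equal to `H`. -/
def posterior (f : 𝕏 → Θ → ℝ≥0) (H : ProbabilityMeasure Θ) (x : 𝕏) : ProbabilityMeasure Θ :=
  open Classical in
  if h : mixtureDensity f H x ≠ 0 ∧ mixtureDensity f H x ≠ ∞ then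
    ⟨(mixtureDensity f H x)⁻¹ • (H : Measure Θ).withDensity (fun θ => (f x θ : ℝ≥0∞)), ⟨by
      rw [Measure.smul_apply, withDensity_apply _ MeasurableSet.univ, Measure.restrict_univ,
        smul_eq_mul]
      exact ENNReal.inv_mul_cancel h.1 h.2⟩⟩
  else H

/-- The mixture `(1 - a) H + a K` of two probability measures, for a weight `a` in `(0, 1)`. -/
def convexComb (a : Set.Ioo (0 : ℝ) 1) (H K : ProbabilityMeasure Θ) : ProbabilityMeasure Θ :=
  ⟨ENNReal.ofReal (1 - a) • (H : Measure Θ) + ENNReal.ofReal a • (K : Measure Θ), ⟨by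
    have h1 : (0 : ℝ) ≤ 1 - a := by linarith [a.2.2]
    simp [← ENNReal.ofReal_add h1 a.2.1.le]⟩⟩

/-- Newton's recursive rule: `newtonRule f G₀ α x n` is `G_n` computed from the observations
`x 1, …, x n` with the weights `α 1, …, α n`. The entries `x 0` and `α 0` are not used. -/
def newtonRule (f : 𝕏 → Θ → ℝ≥0) (G₀ : ProbabilityMeasure Θ) (α : ℕ → Set.Ioo (0 : ℝ) 1)
    (x : ℕ → 𝕏) : ℕ → ProbabilityMeasure Θ
  | 0 => G₀
  | n + 1 =>
    convexComb (α (n + 1)) (newtonRule f G₀ α x n) (posterior f (newtonRule f G₀ α x n) (x (n + 1)))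

/-- The limit mixing distribution `G`: the weak limit of the sequence `(G_n)`, where it exists. -/
def limitMixing [TopologicalSpace Θ] [OpensMeasurableSpace Θ] (f : 𝕏 → Θ → ℝ≥0)
    (G₀ : ProbabilityMeasure Θ) (α : ℕ → Set.Ioo (0 : ℝ) 1) (x : ℕ → 𝕏) : ProbabilityMeasure Θ :=
  open Classical in
  if h : ∃ H : ProbabilityMeasure Θ, Tendsto (newtonRule f G₀ α x) atTop (𝓝 H) then h.choose else G₀

/-- The plug-in covariance matrix, with entries
`∫ P_H(A_i | x) P_H(A_j | x) dF_H(x) - H(A_i) H(A_j)`; the matrix `C_n` is the case `H = G_n`. -/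
def plugInCov (μ : Measure 𝕏) (f : 𝕏 → Θ → ℝ≥0) {k : ℕ} (A : Fin k → Set Θ)
    (H : ProbabilityMeasure Θ) : Matrix (Fin k) (Fin k) ℝ :=
  Matrix.of fun i j =>
    (∫ x, (posterior f H x (A i) : ℝ) * (posterior f H x (A j) : ℝ) ∂(mixtureLaw μ f H))
      - (H (A i) : ℝ) * (H (A j) : ℝ)

/-- The limit covariance matrix, with entries
`∫_{f_H ≠ 0} P_H(A_i | x) P_H(A_j | x) dF_H(x) - H(A_i) H(A_j)`; the matrix `C` is the case
`H = G`. -/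
def limitCov (μ : Measure 𝕏) (f : 𝕏 → Θ → ℝ≥0) {k : ℕ} (A : Fin k → Set Θ)
    (H : ProbabilityMeasure Θ) : Matrix (Fin k) (Fin k) ℝ :=
  Matrix.of fun i j =>
    (∫ x in {x | mixtureDensity f H x ≠ 0},
        (posterior f H x (A i) : ℝ) * (posterior f H x (A j) : ℝ) ∂(mixtureLaw μ f H))
      - (H (A i) : ℝ) * (H (A j) : ℝ)

end Mixture

/-- The inverse square root `M^{-1/2}` of a symmetric positive definite real matrix, by the
functional calculus. (For a singular positive semidefinite `M`, the zero eigenvalues are kept.) -/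
def invSqrt {k : ℕ} (M : Matrix (Fin k) (Fin k) ℝ) : Matrix (Fin k) (Fin k) ℝ :=
  cfc (fun t : ℝ => (√t)⁻¹) M

section Model

variable {Ω 𝕏 Θ : Type*} [MeasurableSpace Ω] [MeasurableSpace 𝕏] [MeasurableSpace Θ]

/-- The vector `X_{1:n} = (X_1, …, X_n)` of the first `n` observations. -/
def obs (X : ℕ → Ω → 𝕏) (n : ℕ) (ω : Ω) : Fin n → 𝕏 := fun i => X (i + 1) ω

/-- Newton's model: for every `n ≥ 0`, `θ_{n+1} | X_{1:n} ∼ G_n`, and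
`X_{n+1} | X_{1:n}, θ_{n+1}` has density `f(· | θ_{n+1})` with respect to `μ`. -/
structure IsNewtonModel (P : Measure Ω) (μ : Measure 𝕏) (f : 𝕏 → Θ → ℝ≥0)
    (G₀ : ProbabilityMeasure Θ) (α : ℕ → Set.Ioo (0 : ℝ) 1)
    (X : ℕ → Ω → 𝕏) (θ : ℕ → Ω → Θ) : Prop where
  measurable_X : ∀ n, Measurable (X n)
  measurable_θ : ∀ n, Measurable (θ n)
  cond_θ : ∀ (n : ℕ) (A : Set Θ), MeasurableSet A →
    P⟦θ (n + 1) ⁻¹' A | MeasurableSpace.comap (obs X n) inferInstance⟧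
      =ᵐ[P] fun ω => (newtonRule f G₀ α (fun i => X i ω) n A : ℝ)
  cond_X : ∀ (n : ℕ) (B : Set 𝕏), MeasurableSet B →
    P⟦X (n + 1) ⁻¹' B |
        MeasurableSpace.comap (fun ω => (obs X n ω, θ (n + 1) ω)) inferInstance⟧
      =ᵐ[P] fun ω => (∫⁻ x in B, (f x (θ (n + 1) ω) : ℝ≥0∞) ∂μ).toReal

/-- The conditional law `P(Y ∈ · | X_{1:n} = x_{1:n})` at `x_{1:n} = X_{1:n}(ω)`, for a random
vector `Y` (a regular version). -/
def condLaw (P : Measure Ω) [IsFiniteMeasure P] (X : ℕ → Ω → 𝕏) {k : ℕ}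
    (Y : Ω → EuclideanSpace ℝ (Fin k)) (n : ℕ) (ω : Ω) :
    ProbabilityMeasure (EuclideanSpace ℝ (Fin k)) :=
  ⟨condDistrib Y (obs X n) P (obs X n ω), inferInstance⟩

/-- The standard Gaussian law `N_k(0, I)`. -/
def stdNormal (k : ℕ) : ProbabilityMeasure (EuclideanSpace ℝ (Fin k)) :=
  ⟨stdGaussian (EuclideanSpace ℝ (Fin k)), inferInstance⟩

/-- The random vector `√r_n C_n^{-1/2} (G(A_1) - G_n(A_1), …, G(A_k) - G_n(A_k))`. -/
def studentized [TopologicalSpace Θ] [OpensMeasurableSpace Θ] (μ : Measure 𝕏)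
    (f : 𝕏 → Θ → ℝ≥0) (G₀ : ProbabilityMeasure Θ) (α : ℕ → Set.Ioo (0 : ℝ) 1) (r : ℕ → ℝ)
    (X : ℕ → Ω → 𝕏) {k : ℕ} (A : Fin k → Set Θ) (n : ℕ) (ω : Ω) : EuclideanSpace ℝ (Fin k) :=
  WithLp.toLp 2 (√(r n) •
    (invSqrt (plugInCov μ f A (newtonRule f G₀ α (fun i => X i ω) n)) *ᵥ
      fun i => (limitMixing f G₀ α (fun j => X j ω) (A i) : ℝ)
        - (newtonRule f G₀ α (fun j => X j ω) n (A i) : ℝ)))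

end Model

end

end NewtonMixture

/-! Everything rests on one Bayes identity: if `X` has law `F_H`, the random measure `P_H(· | X)`
has mean `H` (`lintegral_posterior_mixtureLaw`). Integrating `θ_{n+1}` out shows that `X_{n+1}`
given `X_{1:n}` has law `F_{G_n}` (`map_obs_X`). Hence `∫ h dG_n` is a nonnegative martingale for
every measurable `h ≥ 0` with finite `G₀`-integral, and it converges almost surely.

Limit measure. The exceptional null set depends on `h`, so the limits of `G_n(A)` have to be glued
into one random measure. Their means stay equal to `G₀(A)`; therefore the limit masses of sets
decreasing to `∅` tend to `0` almost surely. This gives countable additivity, and proper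
distribution functions after embedding `Θ` in `ℝ` (`exists_limit_kernel`). For unbounded `h` the
limit is identified by Fatou's lemma and a comparison of means (`ae_tendsto_lintegral`); weak
convergence needs only the finite unions from a countable base (`ae_tendsto_weakly`).

Covariances. With `h = 1_A f(x | ·)` and Fubini's theorem, almost surely the numerators and
denominators of the posteriors converge for `μ`-almost every `x`. A Scheffé argument then gives `C_n
→ C` (`IsLimitKernel.ae_tendsto_plugInCov`).

Gaussian limit. In a fixed direction `u`, `M_n = ∑ u_i G_n(A_i)` has increments `α_{n+1} d_n` with
`|d_n| ≤ ∑ |u_i|` and conditional variance `α_{n+1}² u·C_n u`. Let `R_n = ∑_{j>n} α_j²`. A Lindeberg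
exchange, one increment at a time, compares the conditional characteristic function of `M_∞ - M_n`
with `exp(-R_n u·C_n u / 2)`. The error is `R_n` times a sum of Taylor terms, small with `sup_{k≥n}
α_k`, and of a multiple of the conditional expectation given `X_{1:n}` of the oscillation of `C_m`
over `m ≥ n` (`ScalarMartingale.norm_condExp_cexp_sub_le`). This expectation tends to `0` almost
surely, by Lévy's upward theorem and monotonicity (`ae_tendsto_condExp_of_antitone`).

The bound holds off one null set for all `n` and `u` together, so the data-dependent direction `u =
√r_n C_n^{-1/2} t` may be inserted. If `det C ≠ 0`, the vectors `C_n^{-1/2} t` stay bounded; since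
`r_n R_n → 1` and `√r_n sup_{k≥n} α_k → 0`, the limit is `exp(-|t|²/2)`, and Lévy's continuity
theorem concludes. -/

namespace NewtonMixture

/-! ### Measurability of mixtures, posteriors and Newton's rule -/

section Kernels

variable {𝕏 Θ : Type*} [MeasurableSpace Θ]

lemma posterior_toMeasure {f : 𝕏 → Θ → ℝ≥0} {H : ProbabilityMeasure Θ} {x : 𝕏}
    (h : mixtureDensity f H x ≠ 0 ∧ mixtureDensity f H x ≠ ∞) :
    (posterior f H x : Measure Θ) = (mixtureDensity f H x)⁻¹ •
      (H : Measure Θ).withDensity (fun θ => (f x θ : ℝ≥0∞)) :=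
  congrArg Subtype.val (dif_pos h)

lemma posterior_eq_self {f : 𝕏 → Θ → ℝ≥0} {H : ProbabilityMeasure Θ} {x : 𝕏}
    (h : ¬ (mixtureDensity f H x ≠ 0 ∧ mixtureDensity f H x ≠ ∞)) : posterior f H x = H :=
  dif_neg h

lemma posterior_apply (f : 𝕏 → Θ → ℝ≥0) (H : ProbabilityMeasure Θ) (x : 𝕏) {A : Set Θ}
    (hA : MeasurableSet A) :
    (posterior f H x : Measure Θ) A =
      open Classical in
      if mixtureDensity f H x ≠ 0 ∧ mixtureDensity f H x ≠ ∞ then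
        (mixtureDensity f H x)⁻¹ * ∫⁻ θ in A, (f x θ : ℝ≥0∞) ∂(H : Measure Θ)
      else (H : Measure Θ) A := by
  split_ifs with h
  · rw [posterior_toMeasure h, Measure.smul_apply, withDensity_apply _ hA, smul_eq_mul]
  · rw [posterior_eq_self h]

lemma convexComb_toMeasure (a : Set.Ioo (0 : ℝ) 1) (H K : ProbabilityMeasure Θ) :
    (convexComb a H K : Measure Θ) =
      ENNReal.ofReal (1 - a) • (H : Measure Θ) + ENNReal.ofReal a • (K : Measure Θ) := rfl

lemma convexComb_real (a : Set.Ioo (0 : ℝ) 1) (H K : ProbabilityMeasure Θ) (A : Set Θ) :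
    (convexComb a H K A : ℝ) = (1 - a) * (H A : ℝ) + a * (K A : ℝ) := by
  have h (L : ProbabilityMeasure Θ) : (L A : ℝ) = ((L : Measure Θ) A).toReal := rfl
  have h1 : (0 : ℝ) ≤ 1 - a := by linarith [a.2.2]
  rw [h, h, h, convexComb_toMeasure, Measure.add_apply, Measure.smul_apply, Measure.smul_apply,
    smul_eq_mul, smul_eq_mul, ENNReal.toReal_add (by finiteness) (by finiteness),
    ENNReal.toReal_mul, ENNReal.toReal_mul, ENNReal.toReal_ofReal h1, ENNReal.toReal_ofReal a.2.1.le]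

variable [MeasurableSpace 𝕏] {f : 𝕏 → Θ → ℝ≥0} (hf : Measurable (Function.uncurry f))
include hf

lemma measurable_coe_density : Measurable fun q : 𝕏 × Θ => (f q.1 q.2 : ℝ≥0∞) :=
  measurable_coe_nnreal_ennreal.comp hf

/-- Joint measurability in the parameter and the observation is needed because the mixing law will
itself be random. The set `A` is moved into the integrand so that the kernel depends on the
parameter alone. -/
lemma measurable_mixtureDensity_kernel {β : Type*} [MeasurableSpace β]
    {H : β → ProbabilityMeasure Θ} (hH : Measurable fun b => (H b : Measure Θ))
    {A : Set Θ} (hA : MeasurableSet A) :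
    Measurable fun p : β × 𝕏 => ∫⁻ θ in A, (f p.2 θ : ℝ≥0∞) ∂(H p.1 : Measure Θ) := by
  let κ : Kernel β Θ := ⟨fun b => (H b : Measure Θ), hH⟩
  have : IsMarkovKernel κ := ⟨fun b => inferInstanceAs (IsProbabilityMeasure (H b : Measure Θ))⟩
  have hfA : Measurable (Function.uncurry fun (p : β × 𝕏) (θ : Θ) =>
      A.indicator (fun θ => (f p.2 θ : ℝ≥0∞)) θ) := by
    have : (Function.uncurry fun (p : β × 𝕏) (θ : Θ) => A.indicator (fun θ => (f p.2 θ : ℝ≥0∞)) θ)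
        = (Prod.snd ⁻¹' A).indicator
          fun q : (β × 𝕏) × Θ => (f q.1.2 q.2 : ℝ≥0∞) := by
      ext q; by_cases hq : q.2 ∈ A <;> simp [Function.uncurry, hq]
    rw [this]
    exact ((measurable_coe_density hf).comp
      ((measurable_snd.comp measurable_fst).prodMk measurable_snd)).indicator (measurable_snd hA)
  simpa [κ, lintegral_indicator hA] using
    hfA.lintegral_kernel_prod_right (κ := κ.comap Prod.fst measurable_fst)

lemma measurable_mixtureDensity (H : ProbabilityMeasure Θ) :
    Measurable (mixtureDensity f H) := by
  have h := measurable_mixtureDensity_kernel hf (β := Unit) (H := fun _ => H) measurable_const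
    MeasurableSet.univ
  simpa [Function.comp_def, ← mixtureDensity.eq_1] using h.comp (measurable_prodMk_left (x := ()))

lemma measurable_posterior {β : Type*} [MeasurableSpace β] {H : β → ProbabilityMeasure Θ}
    (hH : Measurable fun b => (H b : Measure Θ)) :
    Measurable fun p : β × 𝕏 => (posterior f (H p.1) p.2 : Measure Θ) := by
  classical
  refine Measure.measurable_of_measurable_coe _ fun A hA => ?_
  simp_rw [posterior_apply f _ _ hA]
  have h1 : Measurable fun p : β × 𝕏 => mixtureDensity f (H p.1) p.2 := by
    simpa [← mixtureDensity.eq_1] using measurable_mixtureDensity_kernel hf hH MeasurableSet.univ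
  refine Measurable.ite ?_ (h1.inv.mul (measurable_mixtureDensity_kernel hf hH hA)) ?_
  · exact (h1 (measurableSet_singleton 0).compl).inter (h1 (measurableSet_singleton ∞).compl)
  · exact (Measure.measurable_coe hA).comp (hH.comp measurable_fst)

lemma measurable_newtonRule (G₀ : ProbabilityMeasure Θ) (α : ℕ → Set.Ioo (0 : ℝ) 1) (n : ℕ) :
    Measurable fun x : ℕ → 𝕏 => (newtonRule f G₀ α x n : Measure Θ) := by
  induction n with
  | zero => simp only [newtonRule]; exact measurable_const
  | succ n ih =>
    simp only [newtonRule, convexComb_toMeasure]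
    refine Measure.measurable_of_measurable_coe _ fun A hA => ?_
    simp only [Measure.coe_add, Measure.coe_smul, Pi.add_apply, Pi.smul_apply, smul_eq_mul]
    have h1 : Measurable fun x : ℕ → 𝕏 => (newtonRule f G₀ α x n : Measure Θ) A :=
      (Measure.measurable_coe hA).comp ih
    have h2 : Measurable fun x : ℕ → 𝕏 =>
        (posterior f (newtonRule f G₀ α x n) (x (n + 1)) : Measure Θ) A :=
      (Measure.measurable_coe hA).comp
        ((measurable_posterior hf ih).comp (measurable_id.prodMk (measurable_pi_apply (n + 1))))
    exact (h1.const_mul _).add (h2.const_mul _)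

omit hf [MeasurableSpace 𝕏] in
lemma newtonRule_congr (G₀ : ProbabilityMeasure Θ) (α : ℕ → Set.Ioo (0 : ℝ) 1) {x y : ℕ → 𝕏}
    (n : ℕ) (h : ∀ i, i < n → x (i + 1) = y (i + 1)) :
    newtonRule f G₀ α x n = newtonRule f G₀ α y n := by
  induction n with
  | zero => rfl
  | succ n ih =>
    simp only [newtonRule]
    rw [ih fun i hi => h i (by omega), h n (by omega)]

end Kernels

section History

variable {𝕏 Θ : Type*} [MeasurableSpace 𝕏] [MeasurableSpace Θ] [Nonempty 𝕏]

/-- A sequence with prescribed entries at the indices `1, …, n`. -/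
noncomputable def extendHist {n : ℕ} (y : Fin n → 𝕏) (i : ℕ) : 𝕏 :=
  -- Truncated subtraction sends the indices 0 and 1 to the same entry; this is harmless because the
  -- rule never reads index 0.
  if h : i - 1 < n then y ⟨i - 1, h⟩ else Classical.arbitrary 𝕏

lemma measurable_extendHist (n : ℕ) : Measurable (extendHist : (Fin n → 𝕏) → ℕ → 𝕏) := by
  refine measurable_pi_lambda _ fun i => ?_
  unfold extendHist
  split_ifs
  · exact measurable_pi_apply _
  · exact measurable_const

/-- Newton's rule as a function of the vector of the first `n` observations. -/
noncomputable def histRule (f : 𝕏 → Θ → ℝ≥0) (G₀ : ProbabilityMeasure Θ)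
    (α : ℕ → Set.Ioo (0 : ℝ) 1) (n : ℕ) (y : Fin n → 𝕏) : ProbabilityMeasure Θ :=
  newtonRule f G₀ α (extendHist y) n

omit [MeasurableSpace 𝕏] in
lemma histRule_obs {Ω : Type*} (f : 𝕏 → Θ → ℝ≥0) (G₀ : ProbabilityMeasure Θ)
    (α : ℕ → Set.Ioo (0 : ℝ) 1) (X : ℕ → Ω → 𝕏) (n : ℕ) (ω : Ω) :
    histRule f G₀ α n (obs X n ω) = newtonRule f G₀ α (fun i => X i ω) n :=
  newtonRule_congr G₀ α n fun i hi => by simp [extendHist, obs, hi]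

variable {f : 𝕏 → Θ → ℝ≥0} (hf : Measurable (Function.uncurry f))
include hf

lemma measurable_histRule (G₀ : ProbabilityMeasure Θ) (α : ℕ → Set.Ioo (0 : ℝ) 1) (n : ℕ) :
    Measurable fun y : Fin n → 𝕏 => (histRule f G₀ α n y : Measure Θ) :=
  (measurable_newtonRule hf G₀ α n).comp (measurable_extendHist n)

end History

/-! ### Averages of posteriors under the mixture law -/

section Mixture

variable {𝕏 Θ : Type*} [MeasurableSpace 𝕏] [MeasurableSpace Θ]
variable {μ : Measure 𝕏} [SigmaFinite μ]
variable {f : 𝕏 → Θ → ℝ≥0} (hf : Measurable (Function.uncurry f))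
include hf

lemma mixtureLaw_apply (H : ProbabilityMeasure Θ) {B : Set 𝕏} (hB : MeasurableSet B) :
    mixtureLaw μ f H B = ∫⁻ θ, ∫⁻ x in B, (f x θ : ℝ≥0∞) ∂μ ∂(H : Measure Θ) := by
  rw [mixtureLaw, withDensity_apply _ hB]
  unfold mixtureDensity
  rw [lintegral_lintegral_swap]
  exact (measurable_coe_density hf).aemeasurable

lemma isProbabilityMeasure_mixtureLaw (hf1 : ∀ t : Θ, ∫⁻ x, (f x t : ℝ≥0∞) ∂μ = 1)
    (H : ProbabilityMeasure Θ) : IsProbabilityMeasure (mixtureLaw μ f H) :=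
  ⟨by rw [mixtureLaw_apply hf H MeasurableSet.univ]; simp [hf1]⟩

lemma lintegral_mixtureDensity (hf1 : ∀ t : Θ, ∫⁻ x, (f x t : ℝ≥0∞) ∂μ = 1)
    (H : ProbabilityMeasure Θ) : ∫⁻ x, mixtureDensity f H x ∂μ = 1 := by
  have := isProbabilityMeasure_mixtureLaw hf hf1 H
  simpa [mixtureLaw] using measure_univ (μ := mixtureLaw μ f H)

lemma measurable_mixtureLaw {β : Type*} [MeasurableSpace β]
    {H : β → ProbabilityMeasure Θ} (hH : Measurable fun b => (H b : Measure Θ)) :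
    Measurable fun b => mixtureLaw μ f (H b) := by
  refine Measure.measurable_of_measurable_coe _ fun B hB => ?_
  simp_rw [mixtureLaw_apply hf _ hB]
  have : Measurable fun θ => ∫⁻ x in B, (f x θ : ℝ≥0∞) ∂μ :=
    (measurable_coe_density hf).lintegral_prod_left'
  exact (Measure.measurable_lintegral this).comp hH

/-- The posterior integrates to the prior under the mixture law. -/
lemma lintegral_posterior_mixtureLaw (hf1 : ∀ t : Θ, ∫⁻ x, (f x t : ℝ≥0∞) ∂μ = 1)
    (H : ProbabilityMeasure Θ) {h : Θ → ℝ≥0∞} (hh : Measurable h) :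
    ∫⁻ x, ∫⁻ θ, h θ ∂(posterior f H x : Measure Θ) ∂(mixtureLaw μ f H)
      = ∫⁻ θ, h θ ∂(H : Measure Θ) := by
  have hpost : Measurable fun x => (posterior f H x : Measure Θ) :=
    (measurable_posterior hf (β := Unit) (H := fun _ => H) measurable_const).comp
      (measurable_prodMk_left (x := ()))
  have hfm := measurable_coe_density hf
  have hfx (x : 𝕏) : Measurable fun θ => (f x θ : ℝ≥0∞) := hfm.comp measurable_prodMk_left
  have hft (t : Θ) : Measurable fun x => (f x t : ℝ≥0∞) := hfm.comp measurable_prodMk_right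
  have hfin : ∀ᵐ x ∂μ, mixtureDensity f H x < ∞ :=
    ae_lt_top (measurable_mixtureDensity hf H) (by simp [lintegral_mixtureDensity hf hf1 H])
  have hpint : Measurable fun x => ∫⁻ θ, h θ ∂(posterior f H x : Measure Θ) :=
    (Measure.measurable_lintegral hh).comp hpost
  rw [mixtureLaw, lintegral_withDensity_eq_lintegral_mul _ (measurable_mixtureDensity hf H) hpint]
  calc _ = ∫⁻ x, ∫⁻ θ, f x θ * h θ ∂(H : Measure Θ) ∂μ := by
        refine lintegral_congr_ae ?_
        filter_upwards [hfin] with x hx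
        simp only [Pi.mul_apply]
        -- Where `f_H(x) = 0` the posterior is a mere convention, but it has weight zero on the
        -- left, and `f(x | ·)` vanishes `H`-almost everywhere on the right.
        by_cases h0 : mixtureDensity f H x = 0
        · have h0' : ∀ᵐ θ ∂(H : Measure Θ), (f x θ : ℝ≥0∞) = 0 :=
            (lintegral_eq_zero_iff (hfx x)).1 h0
          rw [h0, zero_mul, lintegral_congr_ae (g := 0), lintegral_zero_fun]
          filter_upwards [h0'] with θ hθ
          simp [hθ]
        · rw [posterior_toMeasure ⟨h0, hx.ne⟩, lintegral_smul_measure,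
            lintegral_withDensity_eq_lintegral_mul _ (hfx x) hh,
            smul_eq_mul, ← mul_assoc, ENNReal.mul_inv_cancel h0 hx.ne, one_mul]
          rfl
    _ = ∫⁻ θ, ∫⁻ x, f x θ * h θ ∂μ ∂(H : Measure Θ) :=
        lintegral_lintegral_swap (hfm.mul (hh.comp measurable_snd)).aemeasurable
    _ = _ := by
        refine lintegral_congr fun θ => ?_
        rw [lintegral_mul_const _ (hft θ), hf1, one_mul]

end Mixture

end NewtonMixture

namespace NewtonMixture

/-! ### The predictive law of the next observation -/

section CondLaw

variable {Ω S T : Type*} {m mΩ : MeasurableSpace Ω} [MeasurableSpace S] [MeasurableSpace T]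
  {P : Measure Ω} [IsProbabilityMeasure P]

/-- Translates the real-valued conditional probabilities of the model into `ℝ≥0∞`-valued integrals
over events of the past, the form in which joint laws are recognised as kernel compositions. -/
lemma measure_inter_eq_setLIntegral_of_condExp (hm : m ≤ mΩ)
    {E : Set Ω} (hE : MeasurableSet E) {g : Ω → ℝ≥0∞} (hg : Measurable g) (hg1 : ∀ ω, g ω ≤ 1)
    (h : P⟦E | m⟧ =ᵐ[P] fun ω => (g ω).toReal) {s : Set Ω} (hs : MeasurableSet[m] s) :
    P (s ∩ E) = ∫⁻ ω in s, g ω ∂P := by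
  have hfin : ∫⁻ ω in s, g ω ∂P ≠ ∞ :=
    ((lintegral_mono hg1).trans_lt (by simp)).ne
  rw [← ENNReal.toReal_eq_toReal_iff' (by finiteness) hfin,
    ← integral_toReal hg.aemeasurable (ae_of_all _ fun ω => (hg1 ω).trans_lt ENNReal.one_lt_top),
    ← integral_congr_ae (ae_restrict_of_ae h),
    setIntegral_condExp hm ((integrable_const 1).indicator hE) hs, integral_indicator hE,
    Measure.restrict_restrict hE]
  simp [Set.inter_comm, Measure.real]

lemma map_prodMk_eq_compProd {Y : Ω → S} (hY : Measurable Y) {ξ : Ω → T} (hξ : Measurable ξ)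
    (η : Kernel S T) [IsMarkovKernel η]
    (h : ∀ s B, MeasurableSet s → MeasurableSet B →
      P (Y ⁻¹' s ∩ ξ ⁻¹' B) = ∫⁻ ω in Y ⁻¹' s, η (Y ω) B ∂P) :
    P.map (fun ω => (Y ω, ξ ω)) = P.map Y ⊗ₘ η := by
  have : IsProbabilityMeasure (P.map Y) := Measure.isProbabilityMeasure_map hY.aemeasurable
  have : IsProbabilityMeasure (P.map fun ω => (Y ω, ξ ω)) :=
    Measure.isProbabilityMeasure_map (hY.prodMk hξ).aemeasurable
  refine Measure.ext_prod fun {s} {B} hs hB => ?_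
  rw [Measure.map_apply (hY.prodMk hξ) (hs.prod hB), Measure.compProd_apply_prod hs hB,
    setLIntegral_map hs (Kernel.measurable_coe _ hB) hY, ← h s B hs hB]
  rfl

end CondLaw

section OneStep

variable {Ω 𝕏 Θ : Type*} [MeasurableSpace Ω] [MeasurableSpace 𝕏] [MeasurableSpace Θ]
  {P : Measure Ω} [IsProbabilityMeasure P] {μ : Measure 𝕏} [SigmaFinite μ]
  {f : 𝕏 → Θ → ℝ≥0} (hf : Measurable (Function.uncurry f))
  (hf1 : ∀ t : Θ, ∫⁻ x, (f x t : ℝ≥0∞) ∂μ = 1)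
  {G₀ : ProbabilityMeasure Θ} {α : ℕ → Set.Ioo (0 : ℝ) 1} {X : ℕ → Ω → 𝕏} {θ : ℕ → Ω → Θ}
  (hmodel : IsNewtonModel P μ f G₀ α X θ)

include hmodel in
omit [IsProbabilityMeasure P] [SigmaFinite μ] in
lemma IsNewtonModel.measurable_obs (n : ℕ) : Measurable (obs X n) :=
  measurable_pi_lambda _ fun _ => hmodel.measurable_X _

variable [Nonempty 𝕏]

/-- Newton's rule as a kernel from the first `n` observations. -/
noncomputable def histKernel (G₀ : ProbabilityMeasure Θ) (α : ℕ → Set.Ioo (0 : ℝ) 1) (n : ℕ) :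
    Kernel (Fin n → 𝕏) Θ :=
  ⟨fun y => (histRule f G₀ α n y : Measure Θ), measurable_histRule hf G₀ α n⟩

instance (n : ℕ) : IsMarkovKernel (histKernel hf G₀ α n) :=
  ⟨fun y => inferInstanceAs (IsProbabilityMeasure (histRule f G₀ α n y : Measure Θ))⟩

lemma histKernel_apply (n : ℕ) (y : Fin n → 𝕏) :
    histKernel hf G₀ α n y = (histRule f G₀ α n y : Measure Θ) := rfl

/-- The predictive law of the next observation, as a kernel from the first `n` observations. -/
noncomputable def predKernel (μ : Measure 𝕏) [SigmaFinite μ] (G₀ : ProbabilityMeasure Θ)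
    (α : ℕ → Set.Ioo (0 : ℝ) 1) (n : ℕ) : Kernel (Fin n → 𝕏) 𝕏 :=
  ⟨fun y => mixtureLaw μ f (histRule f G₀ α n y),
    measurable_mixtureLaw hf (measurable_histRule hf G₀ α n)⟩

lemma predKernel_apply (n : ℕ) (y : Fin n → 𝕏) :
    predKernel hf μ G₀ α n y = mixtureLaw μ f (histRule f G₀ α n y) := rfl

include hf1 in
lemma isMarkovKernel_predKernel (n : ℕ) : IsMarkovKernel (predKernel hf μ G₀ α n) :=
  ⟨fun _ => isProbabilityMeasure_mixtureLaw hf hf1 _⟩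

include hmodel in
omit [SigmaFinite μ] in
lemma map_obs_θ (n : ℕ) :
    P.map (fun ω => (obs X n ω, θ (n + 1) ω)) = P.map (obs X n) ⊗ₘ histKernel hf G₀ α n := by
  have hobs := hmodel.measurable_obs n
  refine map_prodMk_eq_compProd hobs (hmodel.measurable_θ _) _ fun s A hs hA => ?_
  refine measure_inter_eq_setLIntegral_of_condExp hobs.comap_le (hmodel.measurable_θ _ hA)
    ((Kernel.measurable_coe _ hA).comp hobs) (fun ω => prob_le_one) ?_ ⟨s, hs, rfl⟩
  refine (hmodel.cond_θ n A hA).trans (ae_of_all _ fun ω => ?_)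
  simp only [histKernel_apply, histRule_obs, Function.comp_apply]
  rfl

-- Given the past, `θ_{n+1}` has law `G_n` and then `X_{n+1}` has density `f(· | θ_{n+1})`;
-- averaging over `θ_{n+1}` produces the mixture `F_{G_n}`.
include hmodel hf1 in
lemma map_obs_X (n : ℕ) :
    P.map (fun ω => (obs X n ω, X (n + 1) ω)) = P.map (obs X n) ⊗ₘ predKernel hf μ G₀ α n := by
  have hobs := hmodel.measurable_obs n
  have hθ := hmodel.measurable_θ (n + 1)
  have := isMarkovKernel_predKernel hf hf1 (G₀ := G₀) (α := α) n
  refine map_prodMk_eq_compProd hobs (hmodel.measurable_X _) _ fun s B hs hB => ?_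
  have hψ : Measurable fun t => ∫⁻ x in B, (f x t : ℝ≥0∞) ∂μ :=
    (measurable_coe_density hf).lintegral_prod_left'
  have hpair : Measurable fun ω => (obs X n ω, θ (n + 1) ω) := hobs.prodMk hθ
  rw [measure_inter_eq_setLIntegral_of_condExp hpair.comap_le (hmodel.measurable_X _ hB)
    (hψ.comp hθ) (fun ω => (setLIntegral_le_lintegral _ _).trans (hf1 _).le) (hmodel.cond_X n B hB)
    -- Conditioning is on the pair of past and parameter; an event of the past alone is a cylinder
    -- in it.
    ⟨s ×ˢ Set.univ, hs.prod MeasurableSet.univ, by ext; simp⟩]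
  have h1 : Measurable fun q : (Fin n → 𝕏) × Θ =>
      s.indicator 1 q.1 * ∫⁻ x in B, (f x q.2 : ℝ≥0∞) ∂μ :=
    ((measurable_one.indicator hs).comp measurable_fst).mul (hψ.comp measurable_snd)
  calc _ = ∫⁻ ω, s.indicator 1 (obs X n ω) * ∫⁻ x in B, (f x (θ (n + 1) ω) : ℝ≥0∞) ∂μ ∂P := by
        rw [← lintegral_indicator (hobs hs)]
        refine lintegral_congr fun ω => ?_
        by_cases h : obs X n ω ∈ s <;> simp [h]
    _ = ∫⁻ q, s.indicator 1 q.1 * ∫⁻ x in B, (f x q.2 : ℝ≥0∞) ∂μ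
          ∂(P.map fun ω => (obs X n ω, θ (n + 1) ω)) := (lintegral_map h1 hpair).symm
    _ = ∫⁻ y, s.indicator 1 y * predKernel hf μ G₀ α n y B ∂(P.map (obs X n)) := by
        rw [map_obs_θ hf hmodel n, Measure.lintegral_compProd h1]
        refine lintegral_congr fun y => ?_
        dsimp only
        rw [lintegral_const_mul _ hψ, predKernel_apply, mixtureLaw_apply hf _ hB,
          histKernel_apply]
    _ = ∫⁻ ω, s.indicator 1 (obs X n ω) * predKernel hf μ G₀ α n (obs X n ω) B ∂P :=
        lintegral_map ((measurable_one.indicator hs).mul (Kernel.measurable_coe _ hB)) hobs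
    _ = _ := by
        rw [← lintegral_indicator (hobs hs)]
        refine lintegral_congr fun ω => ?_
        by_cases h : obs X n ω ∈ s <;> simp [h]

include hf hmodel hf1 in
/-- The law of the next observation given the first `n` ones is the mixture with mixing law `G_n`. -/
lemma condExp_obs_next [StandardBorelSpace 𝕏] {E : Type*} [NormedAddCommGroup E] [NormedSpace ℝ E]
    [CompleteSpace E] (n : ℕ) {F : (Fin n → 𝕏) × 𝕏 → E} (hF : StronglyMeasurable F)
    (hint : Integrable (fun ω => F (obs X n ω, X (n + 1) ω)) P) :
    P[fun ω => F (obs X n ω, X (n + 1) ω) | MeasurableSpace.comap (obs X n) inferInstance] =ᵐ[P]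
      fun ω => ∫ x, F (obs X n ω, x) ∂(mixtureLaw μ f (newtonRule f G₀ α (fun i => X i ω) n)) := by
  have hobs := hmodel.measurable_obs n
  have := isMarkovKernel_predKernel hf hf1 (G₀ := G₀) (α := α) n
  refine (condExp_prod_ae_eq_integral_condDistrib hobs (hmodel.measurable_X _).aemeasurable hF
    hint).trans ?_
  filter_upwards [ae_of_ae_map hobs.aemeasurable (condDistrib_ae_eq_of_measure_eq_compProd
    (obs X n) (hmodel.measurable_X (n + 1)).aemeasurable (map_obs_X hf hf1 hmodel n))] with ω hω
  rw [hω, predKernel_apply, histRule_obs]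

include hf hmodel hf1 in
/-- For `h ≥ 0` the process `∫ h dG_n` is a martingale. -/
lemma setLIntegral_newtonRule_succ (n : ℕ) {h : Θ → ℝ≥0∞} (hh : Measurable h) {s : Set Ω}
    (hs : MeasurableSet[MeasurableSpace.comap (obs X n) inferInstance] s) :
    ∫⁻ ω in s, ∫⁻ t, h t ∂(newtonRule f G₀ α (fun i => X i ω) (n + 1) : Measure Θ) ∂P =
      ∫⁻ ω in s, ∫⁻ t, h t ∂(newtonRule f G₀ α (fun i => X i ω) n : Measure Θ) ∂P := by
  obtain ⟨s, hs, rfl⟩ := hs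
  have hobs := hmodel.measurable_obs n
  have hX := hmodel.measurable_X (n + 1)
  have := isMarkovKernel_predKernel hf hf1 (G₀ := G₀) (α := α) n
  have hrule := measurable_histRule hf G₀ α n
  have hA : Measurable fun y : Fin n → 𝕏 => ∫⁻ t, h t ∂(histRule f G₀ α n y : Measure Θ) :=
    (Measure.measurable_lintegral hh).comp hrule
  have hB : Measurable fun q : (Fin n → 𝕏) × 𝕏 =>
      ∫⁻ t, h t ∂(posterior f (histRule f G₀ α n q.1) q.2 : Measure Θ) :=
    (Measure.measurable_lintegral hh).comp (measurable_posterior hf hrule)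
  have hF : Measurable fun q : (Fin n → 𝕏) × 𝕏 => s.indicator 1 q.1 *
      (ENNReal.ofReal (1 - α (n + 1)) * ∫⁻ t, h t ∂(histRule f G₀ α n q.1 : Measure Θ) +
        ENNReal.ofReal (α (n + 1)) *
          ∫⁻ t, h t ∂(posterior f (histRule f G₀ α n q.1) q.2 : Measure Θ)) :=
    ((measurable_one.indicator hs).comp measurable_fst).mul
      (((hA.comp measurable_fst).const_mul _).add (hB.const_mul _))
  have hα : ENNReal.ofReal (1 - α (n + 1)) + ENNReal.ofReal (α (n + 1)) = 1 := by
    rw [← ENNReal.ofReal_add (by linarith [(α (n + 1)).2.2]) (α (n + 1)).2.1.le]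
    simp
  calc _ = ∫⁻ ω, s.indicator 1 (obs X n ω) *
      (ENNReal.ofReal (1 - α (n + 1)) * ∫⁻ t, h t ∂(histRule f G₀ α n (obs X n ω) : Measure Θ) +
        ENNReal.ofReal (α (n + 1)) * ∫⁻ t, h t
          ∂(posterior f (histRule f G₀ α n (obs X n ω)) (X (n + 1) ω) : Measure Θ)) ∂P := by
        rw [← lintegral_indicator (hobs hs)]
        refine lintegral_congr fun ω => ?_
        by_cases hω : obs X n ω ∈ s
        · simp only [Set.mem_preimage, hω, Set.indicator_of_mem, newtonRule, convexComb_toMeasure,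
            lintegral_add_measure, lintegral_smul_measure, smul_eq_mul, histRule_obs,
            Pi.one_apply, one_mul]
        · simp [hω]
    _ = ∫⁻ q, s.indicator 1 q.1 *
      (ENNReal.ofReal (1 - α (n + 1)) * ∫⁻ t, h t ∂(histRule f G₀ α n q.1 : Measure Θ) +
        ENNReal.ofReal (α (n + 1)) *
          ∫⁻ t, h t ∂(posterior f (histRule f G₀ α n q.1) q.2 : Measure Θ))
          ∂(P.map fun ω => (obs X n ω, X (n + 1) ω)) :=
        (lintegral_map hF (hobs.prodMk hX)).symm
    _ = ∫⁻ y, s.indicator 1 y * ∫⁻ t, h t ∂(histRule f G₀ α n y : Measure Θ) ∂P.map (obs X n) := by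
        rw [map_obs_X hf hf1 hmodel n, Measure.lintegral_compProd hF]
        refine lintegral_congr fun y => ?_
        dsimp only
        have hBy := hB.comp (measurable_prodMk_left (x := y))
        simp only [Function.comp_def] at hBy
        rw [lintegral_const_mul _ ((hBy.const_mul _).const_add _),
          lintegral_add_left measurable_const, lintegral_const_mul _ hBy, predKernel_apply,
          lintegral_posterior_mixtureLaw hf hf1 _ hh]
        have := isProbabilityMeasure_mixtureLaw hf hf1 (histRule f G₀ α n y)
        rw [lintegral_const, measure_univ, mul_one, ← add_mul, hα, one_mul]
    _ = _ := by
        rw [lintegral_map (by exact (measurable_one.indicator hs).mul hA) hobs,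
          ← lintegral_indicator (hobs hs)]
        refine lintegral_congr fun ω => ?_
        by_cases hω : obs X n ω ∈ s <;> simp [hω, histRule_obs]

end OneStep

end NewtonMixture

namespace NewtonMixture

/-! ### Gluing setwise limits into a random probability measure -/

section LimitKernel

variable {Ω Θ : Type*} [MeasurableSpace Ω] [MeasurableSpace Θ] {P : Measure Ω}
  {K : ℕ → Kernel Ω Θ} {ν : Measure Θ}

/-- The upper limit of the masses that a sequence of random measures gives to a set. -/
noncomputable def limsupMass (K : ℕ → Kernel Ω Θ) (A : Set Θ) (ω : Ω) : ℝ :=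
  limsup (fun n => (K n ω).real A) atTop

lemma measurable_kernel_real (κ : Kernel Ω Θ) {A : Set Θ} (hA : MeasurableSet A) :
    Measurable fun ω => (κ ω).real A :=
  (Kernel.measurable_coe κ hA).ennreal_toReal

lemma measurable_limsupMass {A : Set Θ} (hA : MeasurableSet A) :
    Measurable (limsupMass K A) :=
  Measurable.limsup fun n => measurable_kernel_real (K n) hA

/-- Setwise almost sure convergence of a sequence of random probability measures whose mean
does not change. -/
structure AEConvMass (P : Measure Ω) (K : ℕ → Kernel Ω Θ) (ν : Measure Θ) : Prop where
  markov : ∀ n, IsMarkovKernel (K n)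
  mean : ∀ n A, MeasurableSet A → ∫⁻ ω, K n ω A ∂P = ν A
  conv : ∀ A, MeasurableSet A → ∀ᵐ ω ∂P, ∃ c : ℝ, Tendsto (fun n => (K n ω).real A) atTop (𝓝 c)

namespace AEConvMass

variable (hK : AEConvMass P K ν)
include hK

lemma tendsto_limsupMass {A : Set Θ} (hA : MeasurableSet A) :
    ∀ᵐ ω ∂P, Tendsto (fun n => (K n ω).real A) atTop (𝓝 (limsupMass K A ω)) := by
  filter_upwards [hK.conv A hA] with ω ⟨c, hc⟩
  rwa [limsupMass, hc.limsup_eq]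

lemma limsupMass_nonneg {A : Set Θ} (hA : MeasurableSet A) : ∀ᵐ ω ∂P, 0 ≤ limsupMass K A ω := by
  filter_upwards [hK.tendsto_limsupMass hA] with ω h
  exact ge_of_tendsto' h fun n => measureReal_nonneg

lemma limsupMass_mono {A B : Set Θ} (hA : MeasurableSet A) (hB : MeasurableSet B) (h : A ⊆ B) :
    ∀ᵐ ω ∂P, limsupMass K A ω ≤ limsupMass K B ω := by
  filter_upwards [hK.tendsto_limsupMass hA, hK.tendsto_limsupMass hB] with ω h1 h2
  have := hK.markov
  exact le_of_tendsto_of_tendsto' h1 h2 fun n => measureReal_mono h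

lemma limsupMass_union {A B : Set Θ} (hA : MeasurableSet A) (hB : MeasurableSet B)
    (h : Disjoint A B) :
    ∀ᵐ ω ∂P, limsupMass K (A ∪ B) ω = limsupMass K A ω + limsupMass K B ω := by
  filter_upwards [hK.tendsto_limsupMass hA, hK.tendsto_limsupMass hB,
    hK.tendsto_limsupMass (hA.union hB)] with ω h1 h2 h3
  have := hK.markov
  refine tendsto_nhds_unique h3 ((h1.add h2).congr fun n => ?_)
  rw [measureReal_union h hB]

lemma limsupMass_univ : ∀ᵐ ω ∂P, limsupMass K Set.univ ω = 1 := by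
  filter_upwards [hK.tendsto_limsupMass MeasurableSet.univ] with ω h1
  have := hK.markov
  exact tendsto_nhds_unique h1 (by simp)

variable [IsProbabilityMeasure P]

/-- By bounded convergence the limit masses inherit the constant mean. Thus the countable additivity
of `ν` controls them, although the convergence is only setwise. -/
lemma integral_limsupMass {A : Set Θ} (hA : MeasurableSet A) :
    ∫ ω, limsupMass K A ω ∂P = ν.real A := by
  have := hK.markov
  refine tendsto_nhds_unique (tendsto_integral_of_dominated_convergence (fun _ => 1)
    (fun n => (measurable_kernel_real (K n) hA).aestronglyMeasurable) (integrable_const 1)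
    (fun n => ae_of_all _ fun ω => ?_) (hK.tendsto_limsupMass hA)) ?_
  · rw [Real.norm_of_nonneg measureReal_nonneg]; exact measureReal_le_one
  · refine tendsto_const_nhds.congr fun n => ?_
    simp only [measureReal_def]
    rw [integral_toReal (Kernel.measurable_coe _ hA).aemeasurable
      (ae_of_all _ fun ω => measure_lt_top _ _), hK.mean n A hA]

variable [IsProbabilityMeasure ν]

/-- The limit masses decrease almost surely to a nonnegative variable whose integral is `lim ν(B j)
= 0`, so that variable vanishes. All continuity properties of the limit are reduced to this one. -/
lemma tendsto_limsupMass_of_antitone {B : ℕ → Set Θ} (hB : ∀ j, MeasurableSet (B j))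
    (hanti : Antitone B) (hempty : ⋂ j, B j = ∅) :
    ∀ᵐ ω ∂P, Tendsto (fun j => limsupMass K (B j) ω) atTop (𝓝 0) := by
  have hmono : ∀ᵐ ω ∂P, Antitone fun j => limsupMass K (B j) ω := by
    filter_upwards [ae_all_iff.2 fun j => hK.limsupMass_mono (hB (j + 1)) (hB j)
      (hanti j.le_succ)] with ω h
    exact antitone_nat_of_succ_le h
  have hnn : ∀ᵐ ω ∂P, ∀ j, 0 ≤ limsupMass K (B j) ω :=
    ae_all_iff.2 fun j => hK.limsupMass_nonneg (hB j)
  have hlim : ∀ᵐ ω ∂P, Tendsto (fun j => limsupMass K (B j) ω) atTop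
      (𝓝 (⨅ j, limsupMass K (B j) ω)) := by
    filter_upwards [hmono, hnn] with ω h1 h2
    exact tendsto_atTop_ciInf h1 ⟨0, by rintro _ ⟨j, rfl⟩; exact h2 j⟩
  have hle : ∀ᵐ ω ∂P, limsupMass K Set.univ ω = 1 := hK.limsupMass_univ
  have hbd : ∀ᵐ ω ∂P, ∀ j, limsupMass K (B j) ω ≤ limsupMass K Set.univ ω :=
    ae_all_iff.2 fun j => hK.limsupMass_mono (hB j) MeasurableSet.univ (Set.subset_univ _)
  have hmeas : Measurable fun ω => ⨅ j, limsupMass K (B j) ω :=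
    Measurable.iInf fun j => measurable_limsupMass (hB j)
  have hinn : ∀ᵐ ω ∂P, 0 ≤ ⨅ j, limsupMass K (B j) ω := by
    filter_upwards [hnn] with ω h using le_ciInf h
  have hib : ∀ᵐ ω ∂P, ∀ j, ‖limsupMass K (B j) ω‖ ≤ 1 := by
    filter_upwards [hnn, hle, hbd] with ω h1 h2 h3 j
    rw [Real.norm_of_nonneg (h1 j), ← h2]; exact h3 j
  have hint : Integrable (fun ω => ⨅ j, limsupMass K (B j) ω) P := by
    refine (integrable_const (1 : ℝ)).mono' hmeas.aestronglyMeasurable ?_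
    filter_upwards [hib, hlim] with ω h1 h2
    exact le_of_tendsto' h2.norm h1
  have hzero : ∫ ω, ⨅ j, limsupMass K (B j) ω ∂P = 0 := by
    refine tendsto_nhds_unique (tendsto_integral_of_dominated_convergence (fun _ => 1)
      (fun j => (measurable_limsupMass (hB j)).aestronglyMeasurable) (integrable_const 1)
      (ae_all_iff.1 hib) hlim) ?_
    simp_rw [fun j => hK.integral_limsupMass (hB j), measureReal_def]
    have := tendsto_measure_iInter_atTop (μ := ν) (fun j => (hB j).nullMeasurableSet) hanti
      ⟨0, measure_ne_top _ _⟩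
    rw [hempty, measure_empty] at this
    simpa [Function.comp_def] using (ENNReal.tendsto_toReal ENNReal.zero_ne_top).comp this
  filter_upwards [hlim, (integral_eq_zero_iff_of_nonneg_ae hinn hint).1 hzero] with ω h1 h2
  rwa [h2] at h1

/-- The distribution functions of the limit masses are almost surely proper. -/
lemma isRatStieltjesPoint_limsupMass {e : Θ → ℝ} (he : Measurable e) :
    ∀ᵐ ω ∂P, IsRatStieltjesPoint
      (fun ω (q : ℚ) => limsupMass K (e ⁻¹' Set.Iic (q : ℝ)) ω) ω := by
  have hm (q : ℝ) : MeasurableSet (e ⁻¹' Set.Iic q) := he measurableSet_Iic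
  have hmono : ∀ᵐ ω ∂P, Monotone fun q : ℚ => limsupMass K (e ⁻¹' Set.Iic (q : ℝ)) ω := by
    have : ∀ᵐ ω ∂P, ∀ q r : ℚ, q ≤ r →
        limsupMass K (e ⁻¹' Set.Iic (q : ℝ)) ω ≤ limsupMass K (e ⁻¹' Set.Iic (r : ℝ)) ω := by
      refine ae_all_iff.2 fun q => ae_all_iff.2 fun r => ?_
      by_cases hqr : q ≤ r
      · filter_upwards [hK.limsupMass_mono (hm q) (hm r)
          (Set.preimage_mono (Set.Iic_subset_Iic.2 (by exact_mod_cast hqr)))] with ω h _ using h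
      · exact ae_of_all _ fun ω h => absurd h hqr
    filter_upwards [this] with ω h q r hqr using h q r hqr
  have hnn : ∀ᵐ ω ∂P, ∀ q : ℚ, 0 ≤ limsupMass K (e ⁻¹' Set.Iic (q : ℝ)) ω :=
    ae_all_iff.2 fun q => hK.limsupMass_nonneg (hm q)
  have htop : ∀ᵐ ω ∂P, Tendsto (fun j : ℕ => limsupMass K (e ⁻¹' Set.Ioi (j : ℝ)) ω)
      atTop (𝓝 0) := by
    refine hK.tendsto_limsupMass_of_antitone (fun j => he measurableSet_Ioi)
      (fun i j hij => Set.preimage_mono (Set.Ioi_subset_Ioi (by exact_mod_cast hij))) ?_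
    ext t
    obtain ⟨j, hj⟩ := exists_nat_ge (e t)
    simpa using ⟨j, hj⟩
  have hsplit : ∀ᵐ ω ∂P, ∀ j : ℕ, 1 = limsupMass K (e ⁻¹' Set.Iic (j : ℝ)) ω +
      limsupMass K (e ⁻¹' Set.Ioi (j : ℝ)) ω := by
    refine ae_all_iff.2 fun j => ?_
    filter_upwards [hK.limsupMass_univ, hK.limsupMass_union (hm j)
      (he (measurableSet_Ioi (a := (j : ℝ))))
      (Disjoint.preimage _ (Set.disjoint_left.2 fun x (h1 : x ≤ j) (h2 : j < x) => not_lt.2 h1 h2))] with ω h1 h2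
    rw [← h2, ← Set.preimage_union, Set.Iic_union_Ioi, Set.preimage_univ, h1]
  have hbot : ∀ᵐ ω ∂P, Tendsto (fun j : ℕ => limsupMass K (e ⁻¹' Set.Iic (-(j : ℝ))) ω)
      atTop (𝓝 0) := by
    refine hK.tendsto_limsupMass_of_antitone (fun j => hm _)
      (fun i j hij => Set.preimage_mono (Set.Iic_subset_Iic.2 (by simpa using hij))) ?_
    ext t
    obtain ⟨j, hj⟩ := exists_nat_gt (-e t)
    simpa using ⟨j, by linarith⟩
  have hright : ∀ᵐ ω ∂P, ∀ t : ℚ, Tendsto (fun j : ℕ => limsupMass K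
      (e ⁻¹' Set.Ioc (t : ℝ) ((t + 1 / ((j : ℚ) + 1) : ℚ) : ℝ)) ω) atTop (𝓝 0) := by
    refine ae_all_iff.2 fun t => hK.tendsto_limsupMass_of_antitone
      (fun j => he measurableSet_Ioc) (fun i j hij => Set.preimage_mono
        (Set.Ioc_subset_Ioc_right ?_)) ?_
    · have : (1 : ℚ) / ((j : ℚ) + 1) ≤ 1 / ((i : ℚ) + 1) :=
        one_div_le_one_div_of_le (by positivity) (by simpa using hij)
      exact_mod_cast add_le_add_right this t
    · ext s
      simp only [Set.mem_iInter, Set.mem_preimage, Set.mem_Ioc, Set.mem_empty_iff_false, iff_false,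
        not_forall, not_and, not_le]
      by_cases hs : (t : ℝ) < e s
      · obtain ⟨j, hj⟩ := exists_nat_one_div_lt (sub_pos.2 hs)
        exact ⟨j, fun _ => by push_cast; linarith⟩
      · exact ⟨0, fun h => absurd h hs⟩
  have hright' : ∀ᵐ ω ∂P, ∀ t : ℚ, ∀ j : ℕ,
      limsupMass K (e ⁻¹' Set.Iic ((t + 1 / ((j : ℚ) + 1) : ℚ) : ℝ)) ω =
      limsupMass K (e ⁻¹' Set.Iic (t : ℝ)) ω +
      limsupMass K (e ⁻¹' Set.Ioc (t : ℝ) ((t + 1 / ((j : ℚ) + 1) : ℚ) : ℝ)) ω := by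
    refine ae_all_iff.2 fun t => ae_all_iff.2 fun j => ?_
    have hle : (t : ℝ) ≤ ((t + 1 / ((j : ℚ) + 1) : ℚ) : ℝ) := by
      exact_mod_cast le_add_of_nonneg_right (by positivity : (0 : ℚ) ≤ 1 / ((j : ℚ) + 1))
    filter_upwards [hK.limsupMass_union (hm t)
      (he (measurableSet_Ioc (a := (t : ℝ)) (b := ((t + 1 / ((j : ℚ) + 1) : ℚ) : ℝ))))
      (Disjoint.preimage _ (Set.disjoint_left.2 fun x h1 h2 => not_lt.2 h1 h2.1))] with ω h2
    rw [← h2, ← Set.preimage_union, Set.Iic_union_Ioc_eq_Iic hle]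
  filter_upwards [hmono, hnn, htop, hsplit, hbot, hright, hright'] with ω h1 h2 h3 h4 h5 h6 h7
  -- Besides monotonicity: limit 1 at `+∞`, limit 0 at `-∞`, and right continuity along the
  -- rationals. Monotonicity reduces each of them to a sequence, where the masses of `(j, ∞)`, `(-∞,
  -- -j]` and `(t, t + 1/(j+1)]` tend to 0.
  refine ⟨h1, ?_, ?_, fun t => ?_⟩
  · rw [tendsto_iff_tendsto_subseq_of_monotone h1 (tendsto_natCast_atTop_atTop (R := ℚ))]
    have : Tendsto (fun j : ℕ => 1 - limsupMass K (e ⁻¹' Set.Ioi (j : ℝ)) ω) atTop (𝓝 (1 - 0)) :=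
      h3.const_sub 1
    rw [sub_zero] at this
    refine this.congr fun j => ?_
    simp only [Function.comp_apply, Rat.cast_natCast]
    linarith [h4 j]
  · have hanti : Antitone fun q : ℚ => limsupMass K (e ⁻¹' Set.Iic ((-q : ℚ) : ℝ)) ω :=
      fun a b hab => h1 (neg_le_neg hab)
    have : Tendsto (fun q : ℚ => limsupMass K (e ⁻¹' Set.Iic ((-q : ℚ) : ℝ)) ω) atTop (𝓝 0) := by
      rw [tendsto_iff_tendsto_subseq_of_antitone hanti (tendsto_natCast_atTop_atTop (R := ℚ))]
      simpa [Function.comp_def] using h5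
    simpa [Function.comp_def] using this.comp tendsto_neg_atBot_atTop
  · have hbdd : BddBelow (Set.range fun r : Set.Ioi t =>
        limsupMass K (e ⁻¹' Set.Iic ((r : ℚ) : ℝ)) ω) := ⟨0, by rintro _ ⟨r, rfl⟩; exact h2 r⟩
    refine le_antisymm ?_ (le_ciInf fun r => h1 (le_of_lt r.2))
    have hlim : Tendsto (fun j : ℕ => limsupMass K
        (e ⁻¹' Set.Iic ((t + 1 / ((j : ℚ) + 1) : ℚ) : ℝ)) ω) atTop
        (𝓝 (limsupMass K (e ⁻¹' Set.Iic (t : ℝ)) ω + 0)) :=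
      ((h6 t).const_add _).congr fun j => (h7 t j).symm
    rw [add_zero] at hlim
    exact ge_of_tendsto' hlim fun j => ciInf_le hbdd
      ⟨t + 1 / ((j : ℚ) + 1), by
        simpa using lt_add_of_pos_right t (by positivity : (0 : ℚ) < 1 / ((j : ℚ) + 1))⟩

omit hK [IsProbabilityMeasure P] [IsProbabilityMeasure ν] in
lemma measurable_ratCDF {e : Θ → ℝ} (he : Measurable e) :
    Measurable fun ω (q : ℚ) => limsupMass K (e ⁻¹' Set.Iic (q : ℝ)) ω :=
  measurable_pi_lambda _ fun _ => measurable_limsupMass (he measurableSet_Iic)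

/-- A limit of countably additive masses of constant mean is countably additive. -/
lemma tendsto_sum_limsupMass {B : ℕ → Set Θ} (hB : ∀ j, MeasurableSet (B j))
    (hd : Pairwise (Function.onFun Disjoint B)) :
    ∀ᵐ ω ∂P, Tendsto (fun N => ∑ j ∈ Finset.range N, limsupMass K (B j) ω) atTop
      (𝓝 (limsupMass K (⋃ j, B j) ω)) := by
  have hT (N : ℕ) : MeasurableSet (⋃ j, B (j + N)) := MeasurableSet.iUnion fun j => hB _
  have htail : ∀ᵐ ω ∂P, Tendsto (fun N => limsupMass K (⋃ j, B (j + N)) ω) atTop (𝓝 0) := by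
    refine hK.tendsto_limsupMass_of_antitone hT ?_ ?_
    · intro M N h
      refine Set.iUnion_subset fun j => ?_
      convert Set.subset_iUnion (fun i => B (i + M)) (j + (N - M)) using 2
      omega
    · refine Set.eq_empty_iff_forall_notMem.2 fun t ht => ?_
      rw [Set.mem_iInter] at ht
      obtain ⟨i, hi⟩ := Set.mem_iUnion.1 (ht 0)
      obtain ⟨j, hj⟩ := Set.mem_iUnion.1 (ht (i + 1))
      exact Set.disjoint_left.1 (hd (by omega : i + 0 ≠ j + (i + 1))) hi hj
  have hstep : ∀ᵐ ω ∂P, ∀ N, limsupMass K (⋃ j, B (j + N)) ω =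
      limsupMass K (B N) ω + limsupMass K (⋃ j, B (j + (N + 1))) ω := by
    refine ae_all_iff.2 fun N => ?_
    filter_upwards [hK.limsupMass_union (hB N) (hT (N + 1)) (Set.disjoint_iUnion_right.2 fun j =>
      hd (by omega : N ≠ j + (N + 1)))] with ω h
    rw [← h]
    congr 1
    ext t
    simp only [Set.mem_iUnion, Set.mem_union]
    constructor
    · rintro ⟨j, hj⟩
      rcases j with _ | j
      · left; simpa using hj
      · right; exact ⟨j, by rwa [show j + (N + 1) = j + 1 + N by omega]⟩
    · rintro (h | ⟨j, hj⟩)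
      · exact ⟨0, by simpa using h⟩
      · exact ⟨j + 1, by rwa [show j + 1 + N = j + (N + 1) by omega]⟩
  filter_upwards [htail, hstep] with ω h1 h2
  have hsum (N : ℕ) : ∑ j ∈ Finset.range N, limsupMass K (B j) ω =
      limsupMass K (⋃ j, B j) ω - limsupMass K (⋃ j, B (j + N)) ω := by
    induction N with
    | zero => simp
    | succ N ih => rw [Finset.sum_range_succ, ih, h2 N]; ring
  simp_rw [hsum]
  simpa using h1.const_sub (limsupMass K (⋃ j, B j) ω)

/-- Random probability measures of constant mean that converge setwise almost surely have a random
probability measure as their limit. -/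
theorem exists_limit_kernel [StandardBorelSpace Θ] :
    ∃ κ : Kernel Ω Θ, IsMarkovKernel κ ∧ ∀ A, MeasurableSet A →
      ∀ᵐ ω ∂P, Tendsto (fun n => (K n ω).real A) atTop (𝓝 ((κ ω).real A)) := by
  have hΘ : Nonempty Θ := nonempty_of_isProbabilityMeasure ν
  let e := embeddingReal Θ
  have he : MeasurableEmbedding e := measurableEmbedding_embeddingReal Θ
  -- `g` is a measurable left inverse of `e` defined on all of `ℝ`; it carries the measure built on
  -- the line back to `Θ`.
  obtain ⟨g, hg, hge⟩ := he.exists_measurable_extend measurable_id fun _ => hΘ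
  let κ' : Kernel Ω ℝ := ⟨fun ω => (stieltjesOfMeasurableRat _
    (measurable_ratCDF (K := K) he.measurable) ω).measure,
    measurable_measure_stieltjesOfMeasurableRat _⟩
  have hκ' : IsMarkovKernel κ' :=
    ⟨fun ω => instIsProbabilityMeasure_stieltjesOfMeasurableRat _ _⟩
  -- The exceptional set may depend on `B`. Each step of the π-λ induction involves at most
  -- countably many sets, so almost sure statements survive it.
  have hset : ∀ B, MeasurableSet B → ∀ᵐ ω ∂P, (κ' ω).real B = limsupMass K (e ⁻¹' B) ω := by
    intro B hB
    induction B, hB using MeasurableSpace.induction_on_inter Real.borel_eq_generateFrom_Iic_rat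
      Real.isPiSystem_Iic_rat with
    | empty =>
      filter_upwards [hK.tendsto_limsupMass MeasurableSet.empty] with ω h
      simpa using tendsto_nhds_unique (by simp) h
    | basic t ht =>
      simp only [Set.iUnion_singleton_eq_range, Set.mem_range] at ht
      obtain ⟨q, rfl⟩ := ht
      filter_upwards [hK.isRatStieltjesPoint_limsupMass he.measurable,
        hK.limsupMass_nonneg (he.measurable (measurableSet_Iic (a := (q : ℝ))))] with ω h h0
      change ((stieltjesOfMeasurableRat _ _ ω).measure (Set.Iic (q : ℝ))).toReal = _
      rw [measure_stieltjesOfMeasurableRat_Iic, stieltjesOfMeasurableRat_eq,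
        toRatCDF_of_isRatStieltjesPoint h, ENNReal.toReal_ofReal h0]
    | compl t ht ih =>
      filter_upwards [ih, hK.limsupMass_univ, hK.limsupMass_union (he.measurable ht)
        (he.measurable ht.compl) (disjoint_compl_right.preimage e)] with ω h1 h2 h3
      rw [← Set.preimage_union, Set.union_compl_self, Set.preimage_univ, h2] at h3
      rw [probReal_compl_eq_one_sub ht, h1]
      linarith
    | iUnion B hd hm ih =>
      filter_upwards [ae_all_iff.2 ih, hK.tendsto_sum_limsupMass (fun j => he.measurable (hm j))
        fun i j hij => (hd hij).preimage e] with ω h1 h2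
      have hm' := measure_iUnion (μ := κ' ω) hd hm
      have h3 := (ENNReal.hasSum_toReal (hm' ▸ measure_ne_top _ _)).tendsto_sum_nat
      rw [← ENNReal.tsum_toReal_eq fun _ => measure_ne_top _ _, ← hm'] at h3
      rw [Set.preimage_iUnion]
      exact tendsto_nhds_unique h3 (h2.congr fun N => Finset.sum_congr rfl fun j _ => (h1 j).symm)
  refine ⟨κ'.map g, Kernel.IsMarkovKernel.map _ hg, fun A hA => ?_⟩
  filter_upwards [hset _ (hg hA), hK.tendsto_limsupMass hA] with ω h1 h2
  rw [← Set.preimage_comp, hge, Set.preimage_id] at h1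
  rwa [Kernel.map_apply _ hg, map_measureReal_apply hg hA, h1]

end AEConvMass

end LimitKernel

end NewtonMixture

namespace NewtonMixture

/-! ### Convergence of integrals, and weak convergence -/

section LimitKernelIntegral

variable {Ω Θ : Type*} [MeasurableSpace Ω] [MeasurableSpace Θ] {P : Measure Ω}
  {K : ℕ → Kernel Ω Θ} {ν : Measure Θ}

lemma lintegral_lintegral_kernel_of_mean {κ : Kernel Ω Θ}
    (h : ∀ A, MeasurableSet A → ∫⁻ ω, κ ω A ∂P = ν A) {g : Θ → ℝ≥0∞} (hg : Measurable g) :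
    ∫⁻ ω, ∫⁻ t, g t ∂(κ ω) ∂P = ∫⁻ t, g t ∂ν := by
  have : P.bind κ = ν := by
    ext A hA
    rw [Measure.bind_apply hA κ.aemeasurable, h A hA]
  rw [← this, Measure.lintegral_bind κ.aemeasurable hg.aemeasurable]

namespace AEConvMass

variable (hK : AEConvMass P K ν)
  {κ : Kernel Ω Θ} [IsMarkovKernel κ]
  (hκ : ∀ A, MeasurableSet A →
    ∀ᵐ ω ∂P, Tendsto (fun n => (K n ω).real A) atTop (𝓝 ((κ ω).real A)))
include hK hκ

lemma ae_tendsto_measure {A : Set Θ} (hA : MeasurableSet A) :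
    ∀ᵐ ω ∂P, Tendsto (fun n => K n ω A) atTop (𝓝 (κ ω A)) := by
  have := hK.markov
  filter_upwards [hκ A hA] with ω h
  exact (ENNReal.tendsto_toReal_iff (fun _ => measure_ne_top _ _) (measure_ne_top _ _)).1 h

lemma mean_limit [IsProbabilityMeasure P] {A : Set Θ} (hA : MeasurableSet A) : ∫⁻ ω, κ ω A ∂P = ν A := by
  have := hK.markov
  refine tendsto_nhds_unique (tendsto_lintegral_of_dominated_convergence (fun _ => 1)
    (fun n => Kernel.measurable_coe (K n) hA) (fun n => ae_of_all _ fun ω => prob_le_one)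
    (by simp) (hK.ae_tendsto_measure hκ hA)) ?_
  simp_rw [fun n => hK.mean n A hA]
  exact tendsto_const_nhds

/-- Convergence of the integrals of an unbounded function, from convergence to some limit. -/
theorem ae_tendsto_lintegral [IsProbabilityMeasure P] {h : Θ → ℝ≥0∞} (hh : Measurable h) (hfin : ∫⁻ t, h t ∂ν ≠ ∞)
    (hconv : ∀ᵐ ω ∂P, ∃ c, Tendsto (fun n => ∫⁻ t, h t ∂(K n ω)) atTop (𝓝 c)) :
    ∀ᵐ ω ∂P, Tendsto (fun n => ∫⁻ t, h t ∂(K n ω)) atTop (𝓝 (∫⁻ t, h t ∂(κ ω))) := by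
  have hKm (n : ℕ) : Measurable fun ω => ∫⁻ t, h t ∂(K n ω) := hh.lintegral_kernel
  have hsimple : ∀ᵐ ω ∂P, ∀ j, Tendsto (fun n => (SimpleFunc.eapprox h j).lintegral (K n ω)) atTop
      (𝓝 ((SimpleFunc.eapprox h j).lintegral (κ ω))) := by
    refine ae_all_iff.2 fun j => ?_
    have : ∀ᵐ ω ∂P, ∀ c ∈ (SimpleFunc.eapprox h j).range,
        Tendsto (fun n => K n ω (SimpleFunc.eapprox h j ⁻¹' {c})) atTop
          (𝓝 (κ ω (SimpleFunc.eapprox h j ⁻¹' {c}))) :=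
      (ae_ball_iff (Finset.countable_toSet _)).2 fun c _ =>
        hK.ae_tendsto_measure hκ (SimpleFunc.measurableSet_fiber _ c)
    filter_upwards [this] with ω hω
    refine tendsto_finsetSum _ fun c hc => ENNReal.Tendsto.const_mul (hω c hc) (Or.inr ?_)
    obtain ⟨t, rfl⟩ := SimpleFunc.mem_range.1 hc
    exact (SimpleFunc.eapprox_lt_top h j t).ne
  have hle : ∀ᵐ ω ∂P, ∫⁻ t, h t ∂(κ ω) ≤ liminf (fun n => ∫⁻ t, h t ∂(K n ω)) atTop := by
    filter_upwards [hsimple, hconv] with ω h1 ⟨c, hc⟩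
    rw [hc.liminf_eq, lintegral_eq_iSup_eapprox_lintegral hh]
    refine iSup_le fun j => le_of_tendsto_of_tendsto' (h1 j) hc fun n => ?_
    rw [lintegral_eq_iSup_eapprox_lintegral hh]
    exact le_iSup (fun j => (SimpleFunc.eapprox h j).lintegral (K n ω)) j
  have hmean : ∫⁻ ω, ∫⁻ t, h t ∂(κ ω) ∂P = ∫⁻ t, h t ∂ν :=
    lintegral_lintegral_kernel_of_mean (fun A hA => hK.mean_limit hκ hA) hh
  have hfatou : ∫⁻ ω, liminf (fun n => ∫⁻ t, h t ∂(K n ω)) atTop ∂P ≤ ∫⁻ ω, ∫⁻ t, h t ∂(κ ω) ∂P := by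
    refine (lintegral_liminf_le hKm).trans ?_
    simp_rw [fun n => lintegral_lintegral_kernel_of_mean (hK.mean n) hh]
    simp [hmean]
  -- Pathwise `∫ h dκ` lies below the limit, and by Fatou's lemma the mean of the limit is at most
  -- `∫ h dν`, which is the finite mean of `∫ h dκ`. Hence the two agree almost surely.
  have heq := ae_eq_of_ae_le_of_lintegral_le hle (by rwa [hmean])
    (Measurable.liminf hKm).aemeasurable hfatou
  filter_upwards [heq, hconv] with ω h1 ⟨c, hc⟩
  rwa [h1, hc.liminf_eq]

/-- Almost sure weak convergence to the limiting random measure. -/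
theorem ae_tendsto_weakly [TopologicalSpace Θ] [TopologicalSpace.MetrizableSpace Θ]
    [SecondCountableTopology Θ] [BorelSpace Θ] :
    ∀ᵐ ω ∂P, ∀ (G : ℕ → ProbabilityMeasure Θ) (H : ProbabilityMeasure Θ),
      (∀ n, (G n : Measure Θ) = K n ω) → (H : Measure Θ) = κ ω → Tendsto G atTop (𝓝 H) := by
  let ℬ := TopologicalSpace.countableBasis Θ
  have hℬ := TopologicalSpace.isBasis_countableBasis Θ
  -- There are only countably many finite unions of basic sets, and every open set is an increasing
  -- union of such; so one null set suffices for the lower bounds of the portmanteau theorem.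
  have hcount : {s : Set (Set Θ) | s.Finite ∧ s ⊆ ℬ}.Countable :=
    Set.countable_ofPred_finite_subset (TopologicalSpace.countable_countableBasis Θ)
  have hopen {s : Set (Set Θ)} (hs : s ⊆ ℬ) : IsOpen (⋃₀ s) :=
    isOpen_sUnion fun t ht => hℬ.isOpen (hs ht)
  have hall : ∀ᵐ ω ∂P, ∀ s ∈ {s : Set (Set Θ) | s.Finite ∧ s ⊆ ℬ},
      Tendsto (fun n => K n ω (⋃₀ s)) atTop (𝓝 (κ ω (⋃₀ s))) :=
    (ae_ball_iff hcount).2 fun s hs => hK.ae_tendsto_measure hκ (hopen hs.2).measurableSet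
  filter_upwards [hall] with ω hω G H hG hH
  refine tendsto_of_forall_isOpen_le_liminf' fun U hU => ?_
  obtain ⟨S, hS, rfl⟩ := hℬ.open_eq_sUnion hU
  have hSc : S.Countable := (TopologicalSpace.countable_countableBasis Θ).mono hS
  rw [hH]
  simp_rw [hG]
  rcases S.eq_empty_or_nonempty with rfl | hne
  · simp
  obtain ⟨u, rfl⟩ := hSc.exists_eq_range hne
  rw [Set.sUnion_range, measure_iUnion_eq_iSup_accumulate]
  refine iSup_le fun N => ?_
  have hacc : Set.accumulate u N = ⋃₀ (u '' Set.Iic N) := by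
    rw [Set.sUnion_image]; rfl
  have hsub : u '' Set.Iic N ⊆ ℬ := (Set.image_subset_range _ _).trans hS
  rw [hacc, ← (hω _ ⟨(Set.finite_Iic N).image u, hsub⟩).liminf_eq]
  refine liminf_le_liminf (Eventually.of_forall fun n => measure_mono ?_)
  rw [← hacc]
  exact Set.accumulate_subset_iUnion _

end AEConvMass

end LimitKernelIntegral

end NewtonMixture

namespace NewtonMixture

/-! ### Newton's rule as a measure-valued martingale -/

section Convergence

variable {Ω 𝕏 Θ : Type*} [mΩ : MeasurableSpace Ω] [MeasurableSpace 𝕏] [MeasurableSpace Θ]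

/-- The filtration generated by the observations. -/
def obsFiltration {X : ℕ → Ω → 𝕏} (hX : ∀ n, Measurable (X n)) : Filtration ℕ mΩ where
  seq n := MeasurableSpace.comap (obs X n) inferInstance
  mono' n m hnm := by
    have h : obs X n = (fun y (i : Fin n) => y (Fin.castLE hnm i)) ∘ obs X m := rfl
    change MeasurableSpace.comap (obs X n) _ ≤ _
    rw [h, ← MeasurableSpace.comap_comp]
    exact MeasurableSpace.comap_mono (Measurable.comap_le (by fun_prop))
  le' n := (measurable_pi_lambda _ fun _ => hX _).comap_le

lemma measurable_obsFiltration {X : ℕ → Ω → 𝕏} (hX : ∀ n, Measurable (X n)) {E : Type*}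
    [MeasurableSpace E] {n : ℕ} {g : (Fin n → 𝕏) → E} (hg : Measurable g) :
    Measurable[obsFiltration hX n] fun ω => g (obs X n ω) :=
  hg.comp (comap_measurable (obs X n))

variable {P : Measure Ω} [IsProbabilityMeasure P] {μ : Measure 𝕏} [SigmaFinite μ]
  {f : 𝕏 → Θ → ℝ≥0} (hf : Measurable (Function.uncurry f))
  (hf1 : ∀ t : Θ, ∫⁻ x, (f x t : ℝ≥0∞) ∂μ = 1)
  {G₀ : ProbabilityMeasure Θ} {α : ℕ → Set.Ioo (0 : ℝ) 1} {X : ℕ → Ω → 𝕏} {θ : ℕ → Ω → Θ}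
  (hX : ∀ n, Measurable (X n))
  (hmodel : IsNewtonModel P μ f G₀ α X θ)

/-- Newton's rule as a kernel on the sample space. -/
noncomputable def ruleKernel (G₀ : ProbabilityMeasure Θ) (α : ℕ → Set.Ioo (0 : ℝ) 1) (n : ℕ) :
    Kernel Ω Θ :=
  ⟨fun ω => (newtonRule f G₀ α (fun i => X i ω) n : Measure Θ),
    (measurable_newtonRule hf G₀ α n).comp (measurable_pi_lambda _ hX)⟩

lemma ruleKernel_apply (n : ℕ) (ω : Ω) :
    ruleKernel hf hX G₀ α n ω = (newtonRule f G₀ α (fun i => X i ω) n : Measure Θ) := rfl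

instance (n : ℕ) : IsMarkovKernel (ruleKernel hf hX G₀ α n) :=
  ⟨fun ω => inferInstanceAs (IsProbabilityMeasure (newtonRule f G₀ α (fun i => X i ω) n : Measure Θ))⟩

variable [Nonempty 𝕏]

include hf in
lemma measurable_lintegral_newtonRule {h : Θ → ℝ≥0∞} (hh : Measurable h) (n : ℕ) :
    Measurable[obsFiltration hX n] fun ω =>
      ∫⁻ t, h t ∂(newtonRule f G₀ α (fun i => X i ω) n : Measure Θ) := by
  simp_rw [← histRule_obs]
  exact measurable_obsFiltration hX (g := fun y => ∫⁻ t, h t ∂(histRule f G₀ α n y : Measure Θ))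
    ((Measure.measurable_lintegral hh).comp (measurable_histRule hf G₀ α n))

include hf hf1 hmodel in
lemma lintegral_lintegral_newtonRule {h : Θ → ℝ≥0∞} (hh : Measurable h) (n : ℕ) :
    ∫⁻ ω, ∫⁻ t, h t ∂(newtonRule f G₀ α (fun i => X i ω) n : Measure Θ) ∂P =
      ∫⁻ t, h t ∂(G₀ : Measure Θ) := by
  induction n with
  | zero => simp [newtonRule]
  | succ n ih =>
    rw [← ih]
    simpa using setLIntegral_newtonRule_succ hf hf1 hmodel n hh MeasurableSet.univ

include hf hf1 hmodel in
lemma martingale_newtonRule {h : Θ → ℝ≥0∞} (hh : Measurable h)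
    (hfin : ∫⁻ t, h t ∂(G₀ : Measure Θ) ≠ ∞) :
    Martingale (fun n ω =>
      (∫⁻ t, h t ∂(newtonRule f G₀ α (fun i => X i ω) n : Measure Θ)).toReal)
      (obsFiltration hX) P := by
  have hm (n : ℕ) := measurable_lintegral_newtonRule hf (G₀ := G₀) (α := α) hX hh n
  have hm' (n : ℕ) := (hm n).mono ((obsFiltration hX).le n) le_rfl
  have hI (n : ℕ) := lintegral_lintegral_newtonRule hf hf1 hmodel hh n
  have hlt (n : ℕ) : ∀ᵐ ω ∂P,
      ∫⁻ t, h t ∂(newtonRule f G₀ α (fun i => X i ω) n : Measure Θ) < ∞ :=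
    ae_lt_top (hm' n) (by rwa [hI n])
  refine martingale_of_setIntegral_eq_succ (fun n => (hm n).ennreal_toReal.stronglyMeasurable)
    (fun n => integrable_toReal_of_lintegral_ne_top (hm' n).aemeasurable (by rwa [hI n]))
    fun n s hs => ?_
  rw [integral_toReal (hm' n).aemeasurable (ae_restrict_of_ae (hlt n)),
    integral_toReal (hm' (n + 1)).aemeasurable (ae_restrict_of_ae (hlt (n + 1))),
    setLIntegral_newtonRule_succ hf hf1 hmodel n hh hs]

include hf hf1 hmodel in
lemma ae_exists_tendsto_lintegral_newtonRule {h : Θ → ℝ≥0∞} (hh : Measurable h)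
    (hfin : ∫⁻ t, h t ∂(G₀ : Measure Θ) ≠ ∞) :
    ∀ᵐ ω ∂P, ∃ c : ℝ, Tendsto (fun n =>
      (∫⁻ t, h t ∂(newtonRule f G₀ α (fun i => X i ω) n : Measure Θ)).toReal) atTop (𝓝 c) := by
  have hX := hmodel.measurable_X
  have hm (n : ℕ) := (measurable_lintegral_newtonRule hf (G₀ := G₀) (α := α) hX hh n).mono
    ((obsFiltration hX).le n) le_rfl
  have hM := martingale_newtonRule hf hf1 hX hmodel hh hfin
  have := hM.submartingale.ae_tendsto_limitProcess
    (R := (∫⁻ t, h t ∂(G₀ : Measure Θ)).toNNReal) fun n => by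
      rw [eLpNorm_one_eq_lintegral_enorm, ENNReal.coe_toNNReal hfin,
        ← lintegral_lintegral_newtonRule hf hf1 hmodel hh n]
      refine lintegral_mono fun ω => ?_
      rw [Real.enorm_of_nonneg ENNReal.toReal_nonneg]
      exact ENNReal.ofReal_toReal_le
  filter_upwards [this] with ω h using ⟨_, h⟩

include hf1 hmodel in
lemma aeConvMass_ruleKernel : AEConvMass P (ruleKernel hf hX G₀ α) (G₀ : Measure Θ) where
  markov _ := inferInstance
  mean n A hA := by
    simpa [ruleKernel_apply, hA] using
      lintegral_lintegral_newtonRule hf hf1 hmodel (measurable_one.indicator hA) n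
  conv A hA := by
    have h := ae_exists_tendsto_lintegral_newtonRule hf hf1 hmodel (measurable_one.indicator hA)
      (by simp [hA])
    simp only [lintegral_indicator_one hA] at h
    exact h

include hf hf1 hmodel in
lemma ae_exists_tendsto_lintegral_newtonRule_ennreal {h : Θ → ℝ≥0∞} (hh : Measurable h)
    (hfin : ∫⁻ t, h t ∂(G₀ : Measure Θ) ≠ ∞) :
    ∀ᵐ ω ∂P, ∃ c, Tendsto (fun n =>
      ∫⁻ t, h t ∂(ruleKernel hf hX G₀ α n ω)) atTop (𝓝 c) := by
  have hlt : ∀ᵐ ω ∂P, ∀ n,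
      ∫⁻ t, h t ∂(newtonRule f G₀ α (fun i => X i ω) n : Measure Θ) < ∞ :=
    ae_all_iff.2 fun n => ae_lt_top ((measurable_lintegral_newtonRule hf hX hh n).mono
      ((obsFiltration hX).le n) le_rfl)
      (by rwa [lintegral_lintegral_newtonRule hf hf1 hmodel hh n])
  filter_upwards [hlt, ae_exists_tendsto_lintegral_newtonRule hf hf1 hmodel hh hfin]
    with ω h1 ⟨c, hc⟩
  refine ⟨ENNReal.ofReal c, (ENNReal.tendsto_ofReal hc).congr fun n => ?_⟩
  rw [ENNReal.ofReal_toReal (h1 n).ne]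
  rfl

/-- A version of the limiting random measure `G`, together with its convergence properties. -/
structure IsLimitKernel (P : Measure Ω) (f : 𝕏 → Θ → ℝ≥0) (G₀ : ProbabilityMeasure Θ)
    (α : ℕ → Set.Ioo (0 : ℝ) 1) (X : ℕ → Ω → 𝕏) (κ : Kernel Ω Θ) : Prop where
  markov : IsMarkovKernel κ
  tendsto_real : ∀ A, MeasurableSet A → ∀ᵐ ω ∂P, Tendsto
    (fun n => (newtonRule f G₀ α (fun i => X i ω) n A : ℝ)) atTop (𝓝 ((κ ω).real A))
  tendsto_lintegral : ∀ h : Θ → ℝ≥0∞, Measurable h → ∫⁻ t, h t ∂(G₀ : Measure Θ) ≠ ∞ →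
    ∀ᵐ ω ∂P, Tendsto (fun n => ∫⁻ t, h t ∂(newtonRule f G₀ α (fun i => X i ω) n : Measure Θ))
      atTop (𝓝 (∫⁻ t, h t ∂(κ ω)))

variable [StandardBorelSpace Θ]

-- The kernel `κ` is measurable by construction, while `limitMixing` is picked by choice among weak
-- limits. Uniqueness of weak limits identifies the two almost surely, so later arguments can use
-- `κ`.
include hf hf1 hmodel in
theorem exists_isLimitKernel [TopologicalSpace Θ] [TopologicalSpace.MetrizableSpace Θ]
    [SecondCountableTopology Θ] [BorelSpace Θ] :
    ∃ κ : Kernel Ω Θ, IsLimitKernel P f G₀ α X κ ∧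
      (∀ᵐ ω ∂P, Tendsto (fun n => newtonRule f G₀ α (fun i => X i ω) n) atTop
        (𝓝 (limitMixing f G₀ α (fun i => X i ω)))) ∧
      ∀ᵐ ω ∂P, (limitMixing f G₀ α (fun i => X i ω) : Measure Θ) = κ ω := by
  have hX := hmodel.measurable_X
  have hK := aeConvMass_ruleKernel hf hf1 hX hmodel
  obtain ⟨κ, hκ, hlim⟩ := hK.exists_limit_kernel
  refine ⟨κ, ⟨hκ, hlim, fun h hh hfin => hK.ae_tendsto_lintegral hlim hh hfin
    (ae_exists_tendsto_lintegral_newtonRule_ennreal hf hf1 hX hmodel hh hfin)⟩, ?_⟩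
  rw [← eventually_and]
  filter_upwards [hK.ae_tendsto_weakly hlim] with ω h
  have h1 : Tendsto (fun n => newtonRule f G₀ α (fun i => X i ω) n) atTop
      (𝓝 (⟨κ ω, inferInstance⟩ : ProbabilityMeasure Θ)) := h _ _ (fun n => rfl) rfl
  have h2 : ∃ H : ProbabilityMeasure Θ,
      Tendsto (newtonRule f G₀ α (fun i => X i ω)) atTop (𝓝 H) := ⟨_, h1⟩
  have h3 : limitMixing f G₀ α (fun i => X i ω) = h2.choose := dif_pos h2
  rw [h3]
  refine ⟨h2.choose_spec, ?_⟩
  rw [tendsto_nhds_unique h2.choose_spec h1]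
  rfl

end Convergence

end NewtonMixture

namespace NewtonMixture

/-! ### Convergence of the plug-in covariances -/

section CovarianceConvergence

/-- The core of Scheffé's argument: with the total fixed, a lower bound for the complementary part
is an upper bound for the part itself. -/
lemma tendsto_of_le_liminf_of_add_eq_one {a b : ℕ → ℝ≥0∞} {a' b' : ℝ≥0∞} (h : ∀ n, a n + b n = 1)
    (h' : a' + b' = 1) (ha : a' ≤ liminf a atTop) (hb : b' ≤ liminf b atTop) :
    Tendsto a atTop (𝓝 a') := by
  have hb_top (n : ℕ) : b n ≠ ∞ := fun hn => by simpa [hn] using h n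
  have hb'_top : b' ≠ ∞ := fun hn => by simp [hn] at h'
  have hbn : a = fun n => 1 - b n :=
    funext fun n => ENNReal.eq_sub_of_add_eq (hb_top n) (h n)
  refine tendsto_of_le_liminf_of_limsup_le ha ?_
  calc limsup a atTop = 1 - liminf b atTop := by
        rw [hbn, ENNReal.limsup_const_sub _ _ ENNReal.one_ne_top]
    _ ≤ 1 - b' := tsub_le_tsub_left hb 1
    _ = a' := (ENNReal.eq_sub_of_add_eq hb'_top h').symm

variable {𝕏 Θ : Type*} [MeasurableSpace 𝕏] [MeasurableSpace Θ] {μ : Measure 𝕏}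
  {f : 𝕏 → Θ → ℝ≥0} (hf : Measurable (Function.uncurry f))

include hf in
lemma measurable_posterior_apply (H : ProbabilityMeasure Θ) {A : Set Θ} (hA : MeasurableSet A) :
    Measurable fun x => (posterior f H x : Measure Θ) A :=
  (Measure.measurable_coe hA).comp
    ((measurable_posterior hf (β := Unit) (H := fun _ => H) measurable_const).comp
      (measurable_prodMk_left (x := ())))

-- The mixture law does not charge the set where its own density vanishes.
include hf in
lemma limitCov_eq_plugInCov {k : ℕ} (A : Fin k → Set Θ) (H : ProbabilityMeasure Θ) :
    limitCov μ f A H = plugInCov μ f A H := by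
  have hm := measurable_mixtureDensity hf H
  have h : (mixtureLaw μ f H).restrict {x | mixtureDensity f H x ≠ 0} = mixtureLaw μ f H := by
    refine Measure.restrict_eq_self_of_ae_mem ?_
    exact (ae_withDensity_iff hm).2 (ae_of_all _ fun x hx => hx)
  unfold limitCov plugInCov
  rw [h]

include hf in
lemma integral_posterior_mul_posterior (H : ProbabilityMeasure Θ) {A B : Set Θ}
    (hA : MeasurableSet A) (hB : MeasurableSet B) :
    ∫ x, (posterior f H x A : ℝ) * (posterior f H x B : ℝ) ∂(mixtureLaw μ f H) =
      (∫⁻ x, mixtureDensity f H x *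
        ((posterior f H x : Measure Θ) A * (posterior f H x : Measure Θ) B) ∂μ).toReal := by
  have hm : Measurable fun x => (posterior f H x : Measure Θ) A * (posterior f H x : Measure Θ) B :=
    (measurable_posterior_apply hf H hA).mul (measurable_posterior_apply hf H hB)
  calc _ = ∫ x, ((posterior f H x : Measure Θ) A * (posterior f H x : Measure Θ) B).toReal
        ∂(mixtureLaw μ f H) := by
        refine integral_congr_ae (ae_of_all _ fun x => ?_)
        simp only [ENNReal.toReal_mul]
        rfl
    _ = _ := by
        rw [integral_toReal hm.aemeasurable (ae_of_all _ fun x => by finiteness), mixtureLaw,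
          lintegral_withDensity_eq_lintegral_mul _ (measurable_mixtureDensity hf H) hm]
        rfl

variable [SigmaFinite μ] (hf1 : ∀ t : Θ, ∫⁻ x, (f x t : ℝ≥0∞) ∂μ = 1)

omit [MeasurableSpace 𝕏] in
lemma tendsto_posterior {H : ℕ → ProbabilityMeasure Θ} {G : ProbabilityMeasure Θ} {x : 𝕏}
    {A : Set Θ} (hA : MeasurableSet A)
    (hfin : ∀ n, mixtureDensity f (H n) x ≠ ∞) (h0 : mixtureDensity f G x ≠ 0)
    (hfin' : mixtureDensity f G x ≠ ∞)
    (hu : Tendsto (fun n => mixtureDensity f (H n) x) atTop (𝓝 (mixtureDensity f G x)))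
    (ht : Tendsto (fun n => ∫⁻ t in A, (f x t : ℝ≥0∞) ∂(H n : Measure Θ)) atTop
      (𝓝 (∫⁻ t in A, (f x t : ℝ≥0∞) ∂(G : Measure Θ)))) :
    Tendsto (fun n => (posterior f (H n) x : Measure Θ) A) atTop
      (𝓝 ((posterior f G x : Measure Θ) A)) := by
  have hNfin : ∫⁻ t in A, (f x t : ℝ≥0∞) ∂(G : Measure Θ) ≠ ∞ :=
    ((setLIntegral_le_lintegral _ _).trans_lt hfin'.lt_top).ne
  rw [posterior_apply f G x hA, if_pos ⟨h0, hfin'⟩]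
  refine (ENNReal.Tendsto.mul hu.inv (Or.inr hNfin) ht
    (Or.inr (ENNReal.inv_ne_top.2 h0))).congr' ?_
  filter_upwards [hu.eventually_ne h0] with n hn
  rw [posterior_apply f _ x hA, if_pos ⟨hn, hfin n⟩]

-- The densities `f_{H_n}` have no common majorant. With `g` the product of the two posterior
-- masses, Fatou's lemma is applied to `f_H g` and to `f_H (1 - g)`, whose integrals add up to 1.
include hf hf1 in
lemma tendsto_integral_posterior_mul_posterior {H : ℕ → ProbabilityMeasure Θ}
    {G : ProbabilityMeasure Θ} {A B : Set Θ} (hA : MeasurableSet A) (hB : MeasurableSet B)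
    (hu : ∀ᵐ x ∂μ, Tendsto (fun n => mixtureDensity f (H n) x) atTop (𝓝 (mixtureDensity f G x)))
    (htA : ∀ᵐ x ∂μ, Tendsto (fun n => ∫⁻ t in A, (f x t : ℝ≥0∞) ∂(H n : Measure Θ)) atTop
      (𝓝 (∫⁻ t in A, (f x t : ℝ≥0∞) ∂(G : Measure Θ))))
    (htB : ∀ᵐ x ∂μ, Tendsto (fun n => ∫⁻ t in B, (f x t : ℝ≥0∞) ∂(H n : Measure Θ)) atTop
      (𝓝 (∫⁻ t in B, (f x t : ℝ≥0∞) ∂(G : Measure Θ)))) :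
    Tendsto (fun n => ∫ x, (posterior f (H n) x A : ℝ) * (posterior f (H n) x B : ℝ)
        ∂(mixtureLaw μ f (H n))) atTop
      (𝓝 (∫ x, (posterior f G x A : ℝ) * (posterior f G x B : ℝ) ∂(mixtureLaw μ f G))) := by
  simp_rw [integral_posterior_mul_posterior hf _ hA hB]
  let g (L : ProbabilityMeasure Θ) (x : 𝕏) : ℝ≥0∞ :=
    (posterior f L x : Measure Θ) A * (posterior f L x : Measure Θ) B
  have hg1 (L : ProbabilityMeasure Θ) (x : 𝕏) : g L x ≤ 1 := mul_le_one' prob_le_one prob_le_one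
  have hgm (L : ProbabilityMeasure Θ) : Measurable (g L) :=
    (measurable_posterior_apply hf L hA).mul (measurable_posterior_apply hf L hB)
  have hdm (L : ProbabilityMeasure Θ) := measurable_mixtureDensity hf L
  have hum (L : ProbabilityMeasure Θ) : Measurable fun x => mixtureDensity f L x * g L x :=
    (hdm L).mul (hgm L)
  have hvm (L : ProbabilityMeasure Θ) : Measurable fun x => mixtureDensity f L x * (1 - g L x) :=
    (hdm L).mul ((hgm L).const_sub 1)
  have hfin (L : ProbabilityMeasure Θ) : ∀ᵐ x ∂μ, mixtureDensity f L x < ∞ :=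
    ae_lt_top (hdm L) (by simp [lintegral_mixtureDensity hf hf1 L])
  have hsum (L : ProbabilityMeasure Θ) : ∫⁻ x, mixtureDensity f L x * g L x ∂μ +
      ∫⁻ x, mixtureDensity f L x * (1 - g L x) ∂μ = 1 := by
    rw [← lintegral_add_left (hum L)]
    refine Eq.trans ?_ (lintegral_mixtureDensity hf hf1 L)
    refine lintegral_congr fun x => ?_
    rw [← mul_add, add_tsub_cancel_of_le (hg1 L x), mul_one]
  have hconv : ∀ᵐ x ∂μ,
      Tendsto (fun n => mixtureDensity f (H n) x * g (H n) x) atTop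
        (𝓝 (mixtureDensity f G x * g G x)) ∧
      Tendsto (fun n => mixtureDensity f (H n) x * (1 - g (H n) x)) atTop
        (𝓝 (mixtureDensity f G x * (1 - g G x))) := by
    filter_upwards [hu, htA, htB, hfin G, ae_all_iff.2 fun n => hfin (H n)] with x h1 h2 h3 h4 h5
    -- Where `f_G` vanishes the posteriors need not converge, but both integrands are at most
    -- `f_{H_n}(x)`, which tends to 0.
    by_cases h0 : mixtureDensity f G x = 0
    · rw [h0, zero_mul, zero_mul]
      rw [h0] at h1
      exact ⟨tendsto_of_tendsto_of_tendsto_of_le_of_le tendsto_const_nhds h1 (fun _ => zero_le)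
          fun n => mul_le_of_le_one_right' (hg1 _ _),
        tendsto_of_tendsto_of_tendsto_of_le_of_le tendsto_const_nhds h1 (fun _ => zero_le)
          fun n => mul_le_of_le_one_right' tsub_le_self⟩
    · have hgt : Tendsto (fun n => g (H n) x) atTop (𝓝 (g G x)) :=
        ENNReal.Tendsto.mul (tendsto_posterior hA (fun n => (h5 n).ne) h0 h4.ne h1 h2)
          (Or.inr (measure_ne_top _ _))
          (tendsto_posterior hB (fun n => (h5 n).ne) h0 h4.ne h1 h3)
          (Or.inr (measure_ne_top _ _))
      have hgtop : g G x ≠ ∞ := ((hg1 G x).trans_lt ENNReal.one_lt_top).ne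
      exact ⟨ENNReal.Tendsto.mul h1 (Or.inr hgtop) hgt (Or.inr h4.ne),
        ENNReal.Tendsto.mul h1 (Or.inr (by finiteness))
          (ENNReal.Tendsto.sub tendsto_const_nhds hgt (Or.inl ENNReal.one_ne_top)) (Or.inr h4.ne)⟩
  have hmain : Tendsto (fun n => ∫⁻ x, mixtureDensity f (H n) x * g (H n) x ∂μ) atTop
      (𝓝 (∫⁻ x, mixtureDensity f G x * g G x ∂μ)) := by
    refine tendsto_of_le_liminf_of_add_eq_one (fun n => hsum (H n)) (hsum G) ?_ ?_
    · refine le_trans (le_of_eq (lintegral_congr_ae ?_)) (lintegral_liminf_le fun n => hum (H n))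
      filter_upwards [hconv] with x hx using hx.1.liminf_eq.symm
    · refine le_trans (le_of_eq (lintegral_congr_ae ?_)) (lintegral_liminf_le fun n => hvm (H n))
      filter_upwards [hconv] with x hx using hx.2.liminf_eq.symm
  refine (ENNReal.tendsto_toReal ?_).comp hmain
  refine ((lintegral_mono fun x => mul_le_of_le_one_right' (hg1 G x)).trans_lt ?_).ne
  rw [lintegral_mixtureDensity hf hf1 G]
  exact ENNReal.one_lt_top

variable {Ω : Type*} [MeasurableSpace Ω] {P : Measure Ω} [IsProbabilityMeasure P]
  {G₀ : ProbabilityMeasure Θ} {α : ℕ → Set.Ioo (0 : ℝ) 1} {X : ℕ → Ω → 𝕏}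
  {κ : Kernel Ω Θ}

include hf hf1 in
/-- Almost surely, `∫_A f(x | θ) dG_n(θ)` converges for almost every `x`. -/
lemma IsLimitKernel.ae_ae_tendsto (hκ : IsLimitKernel P f G₀ α X κ) (hX : ∀ n, Measurable (X n))
    {A : Set Θ} (hA : MeasurableSet A) :
    ∀ᵐ ω ∂P, ∀ᵐ x ∂μ, Tendsto (fun n => ∫⁻ t in A, (f x t : ℝ≥0∞)
        ∂(newtonRule f G₀ α (fun i => X i ω) n : Measure Θ)) atTop
      (𝓝 (∫⁻ t in A, (f x t : ℝ≥0∞) ∂(κ ω))) := by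
  have := hκ.markov
  let H (ω : Ω) : ProbabilityMeasure Θ := ⟨κ ω, inferInstance⟩
  have hlim : Measurable fun p : Ω × 𝕏 => ∫⁻ t in A, (f p.2 t : ℝ≥0∞) ∂(κ p.1) :=
    measurable_mixtureDensity_kernel hf (H := H) κ.measurable hA
  -- For a fixed `x` with `f_{G₀}(x) < ∞` the convergence is almost sure in `ω`, by the martingale
  -- property for `1_A f(x | ·)`. Fubini's theorem exchanges the two quantifiers.
  rw [Measure.ae_ae_comm (measurableSet_tendsto_fun (fun n => measurable_mixtureDensity_kernel hf
    ((measurable_newtonRule hf G₀ α n).comp (measurable_pi_lambda _ hX)) hA) hlim)]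
  have hfin : ∀ᵐ x ∂μ, mixtureDensity f G₀ x < ∞ :=
    ae_lt_top (measurable_mixtureDensity hf G₀) (by simp [lintegral_mixtureDensity hf hf1 G₀])
  filter_upwards [hfin] with x hx
  have hmeas : Measurable (A.indicator fun t => (f x t : ℝ≥0∞)) :=
    ((measurable_coe_density hf).comp measurable_prodMk_left).indicator hA
  have h := hκ.tendsto_lintegral _ hmeas
    ((lintegral_mono (Set.indicator_le_self _ _)).trans_lt hx).ne
  simpa only [lintegral_indicator hA] using h

include hf hf1 in
theorem IsLimitKernel.ae_tendsto_plugInCov (hκ : IsLimitKernel P f G₀ α X κ)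
    (hX : ∀ n, Measurable (X n)) {k : ℕ} {A : Fin k → Set Θ} (hA : ∀ i, MeasurableSet (A i)) :
    ∀ᵐ ω ∂P, ∀ G : ProbabilityMeasure Θ, (G : Measure Θ) = κ ω → ∀ i j,
      Tendsto (fun n => plugInCov μ f A (newtonRule f G₀ α (fun i => X i ω) n) i j) atTop
        (𝓝 (plugInCov μ f A G i j)) := by
  have hu := hκ.ae_ae_tendsto hf hf1 hX MeasurableSet.univ
  have ht := ae_all_iff.2 fun i => hκ.ae_ae_tendsto hf hf1 hX (hA i)
  filter_upwards [hu, ht, ae_all_iff.2 fun i => hκ.tendsto_real (A i) (hA i)]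
    with ω h1 h2 h3 G hG i j
  rw [← hG] at h1 h2 h3
  simp only [Measure.restrict_univ] at h1
  exact (tendsto_integral_posterior_mul_posterior hf hf1 (hA i) (hA j) h1 (h2 i) (h2 j)).sub
    ((h3 i).mul (h3 j))

end CovarianceConvergence

end NewtonMixture

namespace NewtonMixture

/-! ### Gaussian approximation for the tail of a scalar martingale -/

section MartingaleCharFun

lemma norm_cexp_mul_I_sub_le (x : ℝ) :
    ‖Complex.exp (x * Complex.I) - (1 + x * Complex.I - (x ^ 2 / 2 : ℝ))‖
      ≤ |x| ^ 3 * Real.exp |x| := by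
  have h := Complex.norm_exp_sub_sum_le_norm_mul_exp (x * Complex.I) 3
  have hn : ‖(x : ℂ) * Complex.I‖ = |x| := by simp
  rw [hn] at h
  refine le_trans (le_of_eq ?_) h
  congr 1
  simp only [Finset.sum_range_succ, Finset.range_zero, Finset.sum_empty, Nat.factorial, mul_pow,
    Complex.I_sq]
  push_cast
  ring

lemma abs_exp_neg_sub_le {y : ℝ} : |Real.exp (-y) - (1 - y)| ≤ y ^ 2 * Real.exp |y| := by
  have h := Complex.norm_exp_sub_sum_le_norm_mul_exp ((-y : ℝ) : ℂ) 2
  have hn : ‖((-y : ℝ) : ℂ)‖ = |y| := by simp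
  rw [hn, sq_abs, ← Complex.ofReal_exp] at h
  refine le_trans (le_of_eq ?_) h
  rw [← Real.norm_eq_abs, ← Complex.norm_real]
  congr 1
  simp [Finset.sum_range_succ]
  ring

variable {Ω : Type*} {m mΩ : MeasurableSpace Ω} {P : Measure Ω} [IsProbabilityMeasure P]

/-- The positive part of `X` has integral at most `∫ g N`, which tends to 0. This passes to the
limit in conditional inequalities from convergence in mean alone. -/
lemma ae_nonpos_of_le_condExp {X : Ω → ℝ} {g : ℕ → Ω → ℝ} (hm : m ≤ mΩ)
    (hX : AEMeasurable X P) (hg0 : ∀ N ω, 0 ≤ g N ω)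
    (hXg : ∀ N, X ≤ᵐ[P] P[g N | m]) (hlim : Tendsto (fun N => ∫ ω, g N ω ∂P) atTop (𝓝 0)) :
    X ≤ᵐ[P] 0 := by
  have hle (N : ℕ) : ∫⁻ ω, ENNReal.ofReal (X ω) ∂P ≤ ENNReal.ofReal (∫ ω, g N ω ∂P) := by
    rw [← integral_condExp hm, ofReal_integral_eq_lintegral_ofReal integrable_condExp
      (condExp_nonneg (ae_of_all _ (hg0 N)))]
    refine lintegral_mono_ae ?_
    filter_upwards [hXg N] with ω h using ENNReal.ofReal_le_ofReal h
  have h0 : ∫⁻ ω, ENNReal.ofReal (X ω) ∂P = 0 := by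
    refine le_antisymm (ge_of_tendsto' (x := atTop) (f := fun N => ENNReal.ofReal (∫ ω, g N ω ∂P))
      ?_ hle) zero_le
    simpa using ENNReal.tendsto_ofReal hlim
  filter_upwards [(lintegral_eq_zero_iff' hX.ennreal_ofReal).1 h0] with ω h
  exact ENNReal.ofReal_eq_zero.1 h

/-- A conditionally centred variable stays centred when multiplied by a bounded variable known
at that time. -/
lemma condExp_smul_eq_zero_of_condExp_eq_zero {m' : MeasurableSpace Ω} (hmm' : m ≤ m')
    (hm' : m' ≤ mΩ) {D : Ω → ℝ} {Y : Ω → ℂ} (hD : Integrable D P) (hD0 : P[D | m'] =ᵐ[P] 0)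
    (hY : StronglyMeasurable[m'] Y) {c : ℝ} (hYc : ∀ ω, ‖Y ω‖ ≤ c) :
    P[fun ω => D ω • Y ω | m] =ᵐ[P] 0 := by
  have hDY : Integrable (fun ω => D ω • Y ω) P :=
    hD.smul_bdd c (hY.mono hm').aestronglyMeasurable (ae_of_all _ hYc)
  have h := condExp_bilin_of_stronglyMeasurable_left (μ := P) (m := m')
    (ContinuousLinearMap.lsmul ℝ ℝ : ℝ →L[ℝ] ℂ →L[ℝ] ℂ).flip hY hDY hD
  refine (condExp_condExp_of_le hmm' hm').symm.trans ?_
  refine (condExp_congr_ae (g := 0) ?_).trans (by simp)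
  filter_upwards [h, hD0] with ω h1 h2
  refine Eq.trans h1 ?_
  simp [h2]

/-- Data of a scalar martingale `M` with bounded increments `a (n + 1) * d n` and conditional
increment variances `a (n + 1) ^ 2 * q n`. -/
structure ScalarMartingale (P : Measure Ω) (ℱ : Filtration ℕ mΩ) (a : ℕ → ℝ) (L : ℝ)
    (M d q : ℕ → Ω → ℝ) (Minf : Ω → ℝ) : Prop where
  a_nonneg : ∀ n, 0 ≤ a n
  summable : Summable fun n => a n ^ 2
  meas : ∀ n, Measurable[ℱ n] (M n)
  meas_d : ∀ n, Measurable (d n)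
  meas_q : ∀ n, Measurable[ℱ n] (q n)
  step : ∀ n ω, M (n + 1) ω = M n ω + a (n + 1) * d n ω
  bound : ∀ n ω, |d n ω| ≤ L
  q_nonneg : ∀ n ω, 0 ≤ q n ω
  q_le : ∀ n ω, q n ω ≤ L ^ 2
  mean : ∀ n, P[d n | ℱ n] =ᵐ[P] 0
  var : ∀ n, P[fun ω => d n ω ^ 2 | ℱ n] =ᵐ[P] q n
  meas_lim : Measurable Minf
  lim : ∀ᵐ ω ∂P, Tendsto (fun n => M n ω) atTop (𝓝 (Minf ω))

namespace ScalarMartingale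

variable {ℱ : Filtration ℕ mΩ} {a : ℕ → ℝ} {L : ℝ} {M d q : ℕ → Ω → ℝ} {Minf : Ω → ℝ}
  (h : ScalarMartingale P ℱ a L M d q Minf)
include h

lemma L_nonneg : 0 ≤ L := by
  obtain ⟨ω⟩ := nonempty_of_isProbabilityMeasure P
  exact (abs_nonneg _).trans (h.bound 0 ω)

/-- One Lindeberg exchange. With `b = a (n + j + 1)`, expand `exp(i b d)` to second order and
`exp(-q_n b²/2)` to first order. The linear term is conditionally centred, and the quadratic terms
cancel up to `q_{n+j} - q_n`, which `W` bounds. The Taylor remainders, of orders `b³` and `b⁴`,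
supply the other terms by `b ≤ s`. -/
lemma norm_condExp_increment_le (n j : ℕ) {s : ℝ} (hs : a (n + j + 1) ≤ s) {W : Ω → ℝ}
    (hW : Integrable W P) (hqW : ∀ ω, |q (n + j) ω - q n ω| ≤ W ω) {Y : Ω → ℂ}
    (hY : StronglyMeasurable[ℱ (n + j)] Y) (hY1 : ∀ ω, ‖Y ω‖ ≤ 1) :
    ∀ᵐ ω ∂P, ‖P[fun ω => Y ω * (Complex.exp ((a (n + j + 1) * d (n + j) ω : ℝ) * Complex.I) -
        (Real.exp (-(q n ω * a (n + j + 1) ^ 2 / 2)) : ℝ)) | ℱ n] ω‖ ≤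
      a (n + j + 1) ^ 2 * (L ^ 3 * s * Real.exp (L * s) + L ^ 4 * s ^ 2 * Real.exp (L ^ 2 * s ^ 2)
        + P[W | ℱ n] ω / 2) := by
  set b := a (n + j + 1) with hb
  have hb0 : 0 ≤ b := h.a_nonneg _
  have hL := h.L_nonneg
  have hs0 : 0 ≤ s := hb0.trans hs
  set D := d (n + j) with hD
  set qn := q n with hqn
  set qm := q (n + j) with hqm
  have hDm : Measurable D := h.meas_d _
  have hqnm : Measurable qn := (h.meas_q n).mono (ℱ.le n) le_rfl
  have hqmm : Measurable qm := (h.meas_q (n + j)).mono (ℱ.le _) le_rfl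
  have hDb : ∀ ω, |D ω| ≤ L := h.bound (n + j)
  have hDint : Integrable D P := Integrable.of_bound hDm.aestronglyMeasurable L (ae_of_all _ hDb)
  have hD2int : Integrable (fun ω => D ω ^ 2) P := by
    refine Integrable.of_bound (by fun_prop) (L ^ 2) (ae_of_all _ fun ω => ?_)
    rw [Real.norm_eq_abs, abs_pow]
    exact pow_le_pow_left₀ (abs_nonneg _) (hDb ω) 2
  have hqmint : Integrable qm P := by
    refine Integrable.of_bound hqmm.aestronglyMeasurable (L ^ 2) (ae_of_all _ fun ω => ?_)
    rw [Real.norm_of_nonneg (h.q_nonneg _ ω)]; exact h.q_le _ ω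
  -- What remains after removing `i b D` and `(b²/2)(q_{n+j} - D²)`, both centred given the past at
  -- time `n + j`: two Taylor remainders, and the error of freezing the variance at time `n`.
  let rem : Ω → ℂ := fun ω =>
    (Complex.exp ((b * D ω : ℝ) * Complex.I) - (1 + (b * D ω : ℝ) * Complex.I
        - ((b * D ω) ^ 2 / 2 : ℝ)))
      - ((Real.exp (-(qn ω * b ^ 2 / 2)) - (1 - qn ω * b ^ 2 / 2) : ℝ) : ℂ)
      + ((b ^ 2 / 2 * (qn ω - qm ω) : ℝ) : ℂ)
  let c := b ^ 2 * (L ^ 3 * s * Real.exp (L * s) + L ^ 4 * s ^ 2 * Real.exp (L ^ 2 * s ^ 2))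
  have hrem : ∀ ω, ‖Y ω * rem ω‖ ≤ c + b ^ 2 / 2 * W ω := by
    intro ω
    rw [norm_mul]
    refine (mul_le_of_le_one_left (norm_nonneg _) (hY1 ω)).trans ?_
    have hbD : |b * D ω| ≤ b * L := by
      rw [abs_mul, abs_of_nonneg hb0]; exact mul_le_mul_of_nonneg_left (hDb ω) hb0
    have hbL : b * L ≤ L * s := by rw [mul_comm]; exact mul_le_mul_of_nonneg_left hs hL
    have h1 := norm_cexp_mul_I_sub_le (b * D ω)
    have h1' : |b * D ω| ^ 3 * Real.exp |b * D ω| ≤ b ^ 2 * (L ^ 3 * s * Real.exp (L * s)) := by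
      calc |b * D ω| ^ 3 * Real.exp |b * D ω| ≤ (b * L) ^ 3 * Real.exp (L * s) := by
            gcongr
            exact hbD.trans hbL
        _ = b ^ 2 * (L ^ 3 * b * Real.exp (L * s)) := by ring
        _ ≤ _ := by gcongr
    have hy0 : 0 ≤ qn ω * b ^ 2 / 2 := by have := h.q_nonneg n ω; positivity
    have hyle : qn ω * b ^ 2 / 2 ≤ L ^ 2 * b ^ 2 := by
      have := mul_le_mul_of_nonneg_right (h.q_le n ω) (sq_nonneg b)
      have h2 : 0 ≤ L ^ 2 * b ^ 2 := by positivity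
      linarith
    have h2 := abs_exp_neg_sub_le (y := qn ω * b ^ 2 / 2)
    have h2' : (qn ω * b ^ 2 / 2) ^ 2 * Real.exp |qn ω * b ^ 2 / 2| ≤
        b ^ 2 * (L ^ 4 * s ^ 2 * Real.exp (L ^ 2 * s ^ 2)) := by
      rw [abs_of_nonneg hy0]
      calc _ ≤ (L ^ 2 * b ^ 2) ^ 2 * Real.exp (L ^ 2 * s ^ 2) := by
            gcongr
            exact hyle.trans (by gcongr)
        _ = b ^ 2 * (L ^ 4 * b ^ 2 * Real.exp (L ^ 2 * s ^ 2)) := by ring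
        _ ≤ _ := by gcongr
    have h3 : |b ^ 2 / 2 * (qn ω - qm ω)| ≤ b ^ 2 / 2 * W ω := by
      rw [abs_mul, abs_of_nonneg (by positivity), abs_sub_comm]
      exact mul_le_mul_of_nonneg_left (hqW ω) (by positivity)
    refine (norm_add_le _ _).trans (add_le_add ((norm_sub_le _ _).trans ?_) ?_)
    · simp only [c, mul_add]
      refine add_le_add (h1.trans h1') ?_
      rw [Complex.norm_real, Real.norm_eq_abs]
      exact h2.trans h2'
    · rw [Complex.norm_real, Real.norm_eq_abs]
      exact h3
  have hYm : Measurable Y := (hY.mono (ℱ.le _)).measurable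
  have hYrem : Measurable fun ω => Y ω * rem ω := by fun_prop
  have hYremint : Integrable (fun ω => Y ω * rem ω) P :=
    ((integrable_const c).add (hW.const_mul (b ^ 2 / 2))).mono' hYrem.aestronglyMeasurable
      (ae_of_all _ hrem)
  have hle : ℱ n ≤ ℱ (n + j) := ℱ.mono (Nat.le_add_right n j)
  have hz1 := condExp_smul_eq_zero_of_condExp_eq_zero hle (ℱ.le _) (hDint.const_mul b)
    (D := fun ω => b * D ω) (by
      refine (condExp_smul b D (ℱ (n + j))).trans ?_
      filter_upwards [h.mean (n + j)] with ω hω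
      simp [hD, hω])
    (hY.mul_const Complex.I) (c := 1) (fun ω => by simpa using hY1 ω)
  have hz2 := condExp_smul_eq_zero_of_condExp_eq_zero hle (ℱ.le _)
    ((hqmint.sub hD2int).const_mul (b ^ 2 / 2)) (D := fun ω => b ^ 2 / 2 * (qm ω - D ω ^ 2)) (by
      refine (condExp_smul (b ^ 2 / 2) (fun ω => qm ω - D ω ^ 2) (ℱ (n + j))).trans ?_
      filter_upwards [condExp_sub hqmint hD2int (ℱ (n + j)), h.var (n + j)] with ω h1 h2
      have h3 : P[qm | ℱ (n + j)] = qm :=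
        condExp_of_stronglyMeasurable (ℱ.le _) (h.meas_q _).stronglyMeasurable hqmint
      rw [Pi.smul_apply, Pi.zero_apply, smul_eq_mul]
      refine mul_eq_zero_of_right _ (h1.trans ?_)
      rw [Pi.sub_apply, h3, h2, sub_self])
    hY (c := 1) hY1
  have hi1 : Integrable (fun ω => (b * D ω) • (Y ω * Complex.I)) P :=
    (hDint.const_mul b).smul_bdd 1 (by fun_prop) (ae_of_all _ fun ω => by simpa using hY1 ω)
  have hi2 : Integrable (fun ω => (b ^ 2 / 2 * (qm ω - D ω ^ 2)) • Y ω) P :=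
    ((hqmint.sub hD2int).const_mul (b ^ 2 / 2)).smul_bdd 1 (by fun_prop) (ae_of_all _ hY1)
  have hdecomp : (fun ω => Y ω * (Complex.exp ((b * D ω : ℝ) * Complex.I) -
        (Real.exp (-(qn ω * b ^ 2 / 2)) : ℝ))) =
      (fun ω => (b * D ω) • (Y ω * Complex.I)) +
        (fun ω => (b ^ 2 / 2 * (qm ω - D ω ^ 2)) • Y ω) + fun ω => Y ω * rem ω := by
    funext ω
    simp only [Pi.add_apply, Complex.real_smul, rem]
    push_cast
    ring
  have hB : P[fun ω => c + b ^ 2 / 2 * W ω | ℱ n] =ᵐ[P] fun ω => c + b ^ 2 / 2 * P[W | ℱ n] ω := by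
    refine (condExp_add (integrable_const c) (hW.const_mul (b ^ 2 / 2)) (ℱ n)).trans ?_
    filter_upwards [condExp_smul (b ^ 2 / 2) W (ℱ n) (μ := P)] with ω h1
    rw [Pi.add_apply, condExp_const (ℱ.le n)]
    exact congrArg (c + ·) h1
  rw [hdecomp]
  filter_upwards [hz1, hz2, condExp_add (hi1.add hi2) hYremint (ℱ n), condExp_add hi1 hi2 (ℱ n),
    norm_condExp_le (m := ℱ n) (μ := P) (fun ω => Y ω * rem ω), hB,
    condExp_mono (m := ℱ n) hYremint.norm
      ((integrable_const c).add (hW.const_mul (b ^ 2 / 2))) (ae_of_all _ hrem)]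
    with ω e1 e2 e3 e4 e5 e6 e7
  rw [e3, Pi.add_apply, e4, Pi.add_apply, e1, e2, Pi.zero_apply, zero_add, zero_add]
  refine (e5.trans e7).trans ?_
  refine (le_of_eq e6).trans (le_of_eq ?_)
  simp only [c]
  ring

/-- Gaussian approximation of the conditional characteristic function of the remaining part of a
martingale. -/
theorem norm_condExp_cexp_sub_le (n : ℕ) {s : ℝ} (hs : ∀ k, n < k → a k ≤ s) {W : Ω → ℝ}
    (hW : Integrable W P) (hqW : ∀ j ω, |q (n + j) ω - q n ω| ≤ W ω) :
    ∀ᵐ ω ∂P, ‖P[fun ω => Complex.exp ((Minf ω - M n ω : ℝ) * Complex.I) | ℱ n] ω -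
        (Real.exp (-(q n ω * (∑' i, a (n + 1 + i) ^ 2) / 2)) : ℝ)‖ ≤
      (∑' i, a (n + 1 + i) ^ 2) * (L ^ 3 * s * Real.exp (L * s) +
        L ^ 4 * s ^ 2 * Real.exp (L ^ 2 * s ^ 2) + P[W | ℱ n] ω / 2) := by
  have hL := h.L_nonneg
  have hs0 : 0 ≤ s := (h.a_nonneg _).trans (hs (n + 1) (by omega))
  let ρ (N : ℕ) : ℝ := ∑' i, a (n + N + 1 + i) ^ 2
  have hsumm (N : ℕ) : Summable fun i => a (n + N + 1 + i) ^ 2 := by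
    simpa [add_comm] using (summable_nat_add_iff (n + N + 1)).2 h.summable
  have hρ0 (N : ℕ) : 0 ≤ ρ N := tsum_nonneg fun i => sq_nonneg _
  have hρ (N : ℕ) : ρ N = a (n + N + 1) ^ 2 + ρ (N + 1) := by
    simp only [ρ]
    rw [(hsumm N).tsum_eq_zero_add, add_zero]
    congr 2
    funext i
    rw [show n + N + 1 + (i + 1) = n + (N + 1) + 1 + i by omega]
  have hρlim : Tendsto ρ atTop (𝓝 0) := by
    have := tendsto_sum_nat_add fun i => a (n + 1 + i) ^ 2
    refine this.congr fun N => tsum_congr fun i => ?_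
    rw [show n + 1 + (i + N) = n + N + 1 + i by omega]
  -- `T` interpolates between the Gaussian value `T 0`, known at time `n`, and the true exponential
  -- `Tinf`: each step exchanges one Gaussian factor for one martingale increment.
  let T (N : ℕ) (ω : Ω) : ℂ := Complex.exp ((M (n + N) ω - M n ω : ℝ) * Complex.I) *
    (Real.exp (-(q n ω * ρ N / 2)) : ℝ)
  let Tinf (ω : Ω) : ℂ := Complex.exp ((Minf ω - M n ω : ℝ) * Complex.I)
  have hMm (k : ℕ) : Measurable (M k) := (h.meas k).mono (ℱ.le k) le_rfl
  have hqm : Measurable (q n) := (h.meas_q n).mono (ℱ.le n) le_rfl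
  have hexp1 (N : ℕ) (ω : Ω) : ‖((Real.exp (-(q n ω * ρ N / 2)) : ℝ) : ℂ)‖ ≤ 1 := by
    rw [Complex.norm_real, Real.norm_of_nonneg (Real.exp_pos _).le, Real.exp_le_one_iff]
    have := mul_nonneg (h.q_nonneg n ω) (hρ0 N)
    linarith
  have hTb (N : ℕ) (ω : Ω) : ‖T N ω‖ ≤ 1 := by
    simp only [T, norm_mul, Complex.norm_exp_ofReal_mul_I, one_mul]
    exact hexp1 N ω
  have hTm (N : ℕ) : Measurable (T N) := by
    have := hMm (n + N); have := hMm n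
    fun_prop
  have hTint (N : ℕ) : Integrable (T N) P :=
    Integrable.of_bound (hTm N).aestronglyMeasurable 1 (ae_of_all _ (hTb N))
  have hTinfm : Measurable Tinf := by
    have := hMm n; have := h.meas_lim
    fun_prop
  have hTinfb (ω : Ω) : ‖Tinf ω‖ ≤ 1 := by simp only [Tinf, Complex.norm_exp_ofReal_mul_I, le_refl]
  have hTinfint : Integrable Tinf P :=
    Integrable.of_bound hTinfm.aestronglyMeasurable 1 (ae_of_all _ hTinfb)
  set γ := L ^ 3 * s * Real.exp (L * s) + L ^ 4 * s ^ 2 * Real.exp (L ^ 2 * s ^ 2)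
  have hγ : 0 ≤ γ := by positivity
  have hW0 : ∀ ω, 0 ≤ W ω := fun ω => (abs_nonneg _).trans (hqW 0 ω)
  have hincr (N : ℕ) : ∀ᵐ ω ∂P, ‖P[T (N + 1) | ℱ n] ω - P[T N | ℱ n] ω‖ ≤
      a (n + N + 1) ^ 2 * (γ + P[W | ℱ n] ω / 2) := by
    -- The common factor of `T N` and `T (N + 1)`; it is known at time `n + N` and has modulus at
    -- most 1.
    let Y (ω : Ω) : ℂ := Complex.exp ((M (n + N) ω - M n ω : ℝ) * Complex.I) *
      (Real.exp (-(q n ω * ρ (N + 1) / 2)) : ℝ)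
    have hY : StronglyMeasurable[ℱ (n + N)] Y := by
      have h1 := h.meas (n + N)
      have h2 : Measurable[ℱ (n + N)] (M n) :=
        (h.meas n).mono (ℱ.mono (Nat.le_add_right n N)) le_rfl
      have h3 : Measurable[ℱ (n + N)] (q n) :=
        (h.meas_q n).mono (ℱ.mono (Nat.le_add_right n N)) le_rfl
      exact Measurable.stronglyMeasurable (by fun_prop)
    have hY1 (ω : Ω) : ‖Y ω‖ ≤ 1 := by
      simp only [Y, norm_mul, Complex.norm_exp_ofReal_mul_I, one_mul]
      exact hexp1 _ ω
    have hTT : T (N + 1) - T N = fun ω => Y ω *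
        (Complex.exp ((a (n + N + 1) * d (n + N) ω : ℝ) * Complex.I) -
        (Real.exp (-(q n ω * a (n + N + 1) ^ 2 / 2)) : ℝ)) := by
      funext ω
      have e1 : M (n + (N + 1)) ω = M (n + N) ω + a (n + N + 1) * d (n + N) ω := h.step (n + N) ω
      have e2 : -(q n ω * ρ N / 2) =
          -(q n ω * ρ (N + 1) / 2) + -(q n ω * a (n + N + 1) ^ 2 / 2) := by rw [hρ N]; ring
      have e3 : ((M (n + (N + 1)) ω - M n ω : ℝ) : ℂ) * Complex.I =
          (M (n + N) ω - M n ω : ℝ) * Complex.I +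
            (a (n + N + 1) * d (n + N) ω : ℝ) * Complex.I := by
        rw [e1]; push_cast; ring
      simp only [Pi.sub_apply, T, Y]
      rw [e3, Complex.exp_add, e2, Real.exp_add]
      push_cast
      ring
    filter_upwards [h.norm_condExp_increment_le n N (hs _ (by omega)) hW (hqW N) hY hY1,
      condExp_sub (hTint (N + 1)) (hTint N) (ℱ n)] with ω h1 h2
    rw [← hTT, h2] at h1
    exact h1
  have hT0 : P[T 0 | ℱ n] = T 0 := by
    refine condExp_of_stronglyMeasurable (ℱ.le n) (Measurable.stronglyMeasurable ?_) (hTint 0)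
    have h1 := h.meas n
    have h3 := h.meas_q n
    simp only [T, add_zero, sub_self]
    fun_prop
  have hpartial (N : ℕ) : ∀ᵐ ω ∂P, ‖P[T N | ℱ n] ω - T 0 ω‖ ≤ ρ 0 * (γ + P[W | ℱ n] ω / 2) := by
    filter_upwards [ae_all_iff.2 hincr, condExp_nonneg (m := ℱ n) (ae_of_all P hW0)] with ω h1 h2
    have hnn : 0 ≤ γ + P[W | ℱ n] ω / 2 := by
      have : 0 ≤ P[W | ℱ n] ω := h2
      positivity
    -- The squared weights telescope as differences of the tail sums `ρ`, so the accumulated error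
    -- stays below `ρ 0` uniformly in `N`.
    have hind (N : ℕ) : ‖P[T N | ℱ n] ω - T 0 ω‖ ≤ (ρ 0 - ρ N) * (γ + P[W | ℱ n] ω / 2) := by
      induction N with
      | zero => simp [hT0]
      | succ N ih =>
        have e : P[T (N + 1) | ℱ n] ω - T 0 ω =
            (P[T (N + 1) | ℱ n] ω - P[T N | ℱ n] ω) + (P[T N | ℱ n] ω - T 0 ω) := by ring
        rw [e]
        refine (norm_add_le _ _).trans ((add_le_add (h1 N) ih).trans (le_of_eq ?_))
        rw [hρ N]
        ring
    refine (hind N).trans (mul_le_mul_of_nonneg_right ?_ hnn)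
    linarith [hρ0 N]
  -- Here `N → ∞` with `n` fixed: the defect is dominated by the conditional expectation of `‖Tinf -
  -- T N‖`, whose mean vanishes by dominated convergence.
  have hmain := ae_nonpos_of_le_condExp (P := P) (m := ℱ n)
    (X := fun ω => ‖P[Tinf | ℱ n] ω - T 0 ω‖ - ρ 0 * (γ + P[W | ℱ n] ω / 2))
    (g := fun N ω => ‖Tinf ω - T N ω‖) (ℱ.le n) ?_ (fun N ω => norm_nonneg _) (fun N => ?_) ?_
  · filter_upwards [hmain] with ω hω
    have h0 : T 0 ω = (Real.exp (-(q n ω * (∑' i, a (n + 1 + i) ^ 2) / 2)) : ℝ) := by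
      simp [T, ρ]
    rw [← h0]
    exact sub_nonpos.1 hω
  · have h1 : AEStronglyMeasurable (P[Tinf | ℱ n]) P := integrable_condExp.aestronglyMeasurable
    have h2 : AEStronglyMeasurable (P[W | ℱ n]) P := integrable_condExp.aestronglyMeasurable
    have h3 := (hTm 0).aestronglyMeasurable (μ := P)
    exact ((h1.sub h3).norm.aemeasurable).sub
      (((h2.aemeasurable.div_const 2).const_add γ).const_mul (ρ 0))
  · filter_upwards [hpartial N, condExp_sub hTinfint (hTint N) (ℱ n),
      norm_condExp_le (m := ℱ n) (μ := P) (Tinf - T N)] with ω h1 h2 h3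
    have e : P[Tinf | ℱ n] ω - T 0 ω = P[Tinf - T N | ℱ n] ω + (P[T N | ℱ n] ω - T 0 ω) := by
      rw [h2, Pi.sub_apply]; ring
    have h4 := norm_add_le (P[Tinf - T N | ℱ n] ω) (P[T N | ℱ n] ω - T 0 ω)
    rw [← e] at h4
    have h3' : ‖P[Tinf - T N | ℱ n] ω‖ ≤ P[fun ω => ‖Tinf ω - T N ω‖ | ℱ n] ω := h3
    linarith
  · have : ∫ _, (0 : ℝ) ∂P = 0 := by simp
    rw [← this]
    refine tendsto_integral_of_dominated_convergence (fun _ => 2)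
      (fun N => ((hTinfm.sub (hTm N)).norm).aestronglyMeasurable) (integrable_const 2)
      (fun N => ae_of_all _ fun ω => ?_) ?_
    · rw [norm_norm]
      exact (norm_sub_le _ _).trans (by linarith [hTinfb ω, hTb N ω])
    · filter_upwards [h.lim] with ω hω
      have h1 : Tendsto (fun N => M (n + N) ω) atTop (𝓝 (Minf ω)) :=
        hω.comp (tendsto_add_atTop_nat n |>.congr fun N => by rw [add_comm])
      have h2 : Tendsto (fun N => T N ω) atTop
          (𝓝 (Complex.exp ((Minf ω - M n ω : ℝ) * Complex.I) *
            (Real.exp (-(q n ω * 0 / 2)) : ℝ))) := by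
        refine Tendsto.mul ?_ ?_
        · refine (Complex.continuous_exp.tendsto _).comp (Tendsto.mul_const _ ?_)
          exact (Complex.continuous_ofReal.tendsto _).comp (h1.sub_const _)
        · refine (Complex.continuous_ofReal.tendsto _).comp
            ((Real.continuous_exp.tendsto _).comp ?_)
          exact ((hρlim.const_mul (q n ω)).div_const 2).neg
      have h3 : Tendsto (fun N => T N ω) atTop (𝓝 (Tinf ω)) := by simpa [Tinf] using h2
      simpa using ((tendsto_const_nhds (x := Tinf ω)).sub h3).norm

end ScalarMartingale

end MartingaleCharFun

end NewtonMixture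

namespace NewtonMixture

/-! ### Inverse square roots of matrices -/

section InverseSquareRoot

variable {k : ℕ}

lemma isSymm_invSqrt (M : Matrix (Fin k) (Fin k) ℝ) : (invSqrt M)ᵀ = invSqrt M := by
  have h : IsSelfAdjoint (invSqrt M) := cfc_predicate _ _
  simpa [Matrix.star_eq_conjTranspose] using h.star_eq

lemma invSqrt_mul_mul_invSqrt {M : Matrix (Fin k) (Fin k) ℝ} (hM : M.PosDef) :
    invSqrt M * M * invSqrt M = 1 := by
  have hsa : IsSelfAdjoint M := hM.isHermitian
  have hc (g : ℝ → ℝ) : ContinuousOn g (spectrum ℝ M) := M.finite_real_spectrum.continuousOn g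
  have h1 : invSqrt M * M = cfc (fun t : ℝ => (√t)⁻¹ * t) M := by
    rw [cfc_mul _ _ M (hc _) (hc _), cfc_id' ℝ M]
    rfl
  rw [h1, invSqrt, ← cfc_mul _ _ M (hc _) (hc _), ← cfc_one ℝ M]
  refine cfc_congr fun t ht => ?_
  rw [hM.isHermitian.spectrum_real_eq_range_eigenvalues] at ht
  obtain ⟨i, rfl⟩ := ht
  have hpos := hM.eigenvalues_pos i
  have h2 := Real.sqrt_pos.2 hpos
  have h3 := Real.mul_self_sqrt hpos.le
  simp only [Pi.one_apply]
  field_simp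
  nlinarith

lemma invSqrt_mul_invSqrt {M : Matrix (Fin k) (Fin k) ℝ} (hM : M.PosDef) :
    invSqrt M * invSqrt M = M⁻¹ := by
  have h := invSqrt_mul_mul_invSqrt hM
  rw [mul_assoc] at h
  have h2 := mul_eq_one_comm.1 h
  rw [mul_assoc] at h2
  exact (Matrix.inv_eq_right_inv h2).symm

/-- Polynomials that converge pointwise to the inverse square root. -/
lemma exists_polynomial_tendsto_inv_sqrt :
    ∃ p : ℕ → Polynomial ℝ, ∀ t : ℝ, Tendsto (fun m => (p m).eval t) atTop (𝓝 (√t)⁻¹) := by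
  -- A continuous regularisation of `(√t)⁻¹`: the denominator stays positive, and the values are 0
  -- for `t ≤ 0`, in agreement with `(√t)⁻¹ = 0` there. The polynomial `p m` is within `1/(m+1)` of
  -- `g m` on `[-m, m]`.
  let g (m : ℕ) (t : ℝ) : ℝ := √t / (max t 0 + 1 / ((m : ℝ) + 1))
  have hpos (m : ℕ) (t : ℝ) : 0 < max t 0 + 1 / ((m : ℝ) + 1) := by positivity
  have hg (m : ℕ) : Continuous (g m) :=
    Real.continuous_sqrt.div (by fun_prop) fun t => (hpos m t).ne'
  have hp (m : ℕ) := exists_polynomial_near_of_continuousOn (-m) m (g m) (hg m).continuousOn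
    (1 / ((m : ℝ) + 1)) (by positivity)
  choose p hp using hp
  refine ⟨p, fun t => ?_⟩
  have hglim : Tendsto (fun m => g m t) atTop (𝓝 (√t)⁻¹) := by
    rcases le_or_gt t 0 with ht | ht
    · simp [g, Real.sqrt_eq_zero_of_nonpos ht]
    · have h1 : Tendsto (fun m => g m t) atTop (𝓝 (√t / (max t 0 + 0))) :=
        tendsto_const_nhds.div (tendsto_one_div_add_atTop_nhds_zero_nat.const_add _)
          (by rw [max_eq_left ht.le, add_zero]; exact ht.ne')
      rwa [add_zero, max_eq_left ht.le, Real.sqrt_div_self] at h1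
  have hdiff : Tendsto (fun m => (p m).eval t - g m t) atTop (𝓝 0) := by
    refine squeeze_zero_norm' ?_ tendsto_one_div_add_atTop_nhds_zero_nat
    obtain ⟨N, hN⟩ := exists_nat_ge |t|
    filter_upwards [eventually_ge_atTop N] with m hm
    have hm' : |t| ≤ m := hN.trans (by exact_mod_cast hm)
    exact (hp m t (abs_le.1 hm')).le
  simpa using hdiff.add hglim

/-- The inverse square root is not continuous at singular matrices, so measurability is obtained
from pointwise limits of polynomials in the matrix, whose entries are plainly measurable. -/
lemma measurable_invSqrt {β : Type*} [MeasurableSpace β] {M : β → Matrix (Fin k) (Fin k) ℝ}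
    (hM : ∀ i j, Measurable fun b => M b i j) (hsymm : ∀ b, (M b).IsHermitian) (i j : Fin k) :
    Measurable fun b => invSqrt (M b) i j := by
  obtain ⟨p, hp⟩ := exists_polynomial_tendsto_inv_sqrt
  have hpow (n : ℕ) : ∀ i j, Measurable fun b => (M b ^ n) i j := by
    induction n with
    | zero => intro i j; simp only [pow_zero]; exact measurable_const
    | succ n ih =>
      intro i j
      simp only [pow_succ, Matrix.mul_apply]
      exact Finset.measurable_sum _ fun l _ => (ih i l).mul (hM l j)
  refine measurable_of_tendsto_metrizable (f := fun m b => (Polynomial.aeval (M b) (p m)) i j)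
    (fun m => ?_) (tendsto_pi_nhds.2 fun b => ?_)
  · simp only [Polynomial.aeval_eq_sum_range, Matrix.sum_apply, Matrix.smul_apply,
      smul_eq_mul]
    exact Finset.measurable_sum _ fun l _ => (hpow l i j).const_mul _
  · have h1 (m : ℕ) : Polynomial.aeval (M b) (p m) = (hsymm b).cfc (p m).eval := by
      rw [← Matrix.IsHermitian.cfc_eq]
      exact (cfc_polynomial (p m) (M b) (hsymm b)).symm
    have h2 : invSqrt (M b) = (hsymm b).cfc fun t => (√t)⁻¹ := by
      rw [← Matrix.IsHermitian.cfc_eq]; rfl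
    simp_rw [h1, h2, Matrix.IsHermitian.cfc, Unitary.conjStarAlgAut_apply, Matrix.mul_apply,
      Matrix.diagonal_apply]
    refine tendsto_finsetSum _ fun l _ => Tendsto.mul_const _ (tendsto_finsetSum _ fun l' _ =>
      Tendsto.const_mul _ ?_)
    split_ifs
    · simpa using hp _
    · exact tendsto_const_nhds

-- Studentizing makes the Gaussian exponent free of the covariance: its quadratic form becomes the
-- squared length of `t`.
open Matrix in
lemma dotProduct_invSqrt_mulVec {M : Matrix (Fin k) (Fin k) ℝ} (hM : M.PosDef) (t : Fin k → ℝ) :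
    (invSqrt M *ᵥ t) ⬝ᵥ (M *ᵥ (invSqrt M *ᵥ t)) = t ⬝ᵥ t := by
  have h := invSqrt_mul_mul_invSqrt hM
  calc _ = (t ᵥ* invSqrt M) ⬝ᵥ (M *ᵥ (invSqrt M *ᵥ t)) := by
        rw [← Matrix.mulVec_transpose, isSymm_invSqrt]
    _ = t ⬝ᵥ ((invSqrt M * M * invSqrt M) *ᵥ t) := by
        rw [← Matrix.dotProduct_mulVec, Matrix.mulVec_mulVec, Matrix.mulVec_mulVec, mul_assoc]
    _ = t ⬝ᵥ t := by rw [h, Matrix.one_mulVec]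

open Matrix in
lemma dotProduct_invSqrt_self {M : Matrix (Fin k) (Fin k) ℝ} (hM : M.PosDef) (t : Fin k → ℝ) :
    (invSqrt M *ᵥ t) ⬝ᵥ (invSqrt M *ᵥ t) = t ⬝ᵥ (M⁻¹ *ᵥ t) := by
  calc _ = (t ᵥ* invSqrt M) ⬝ᵥ (invSqrt M *ᵥ t) := by
        rw [← Matrix.mulVec_transpose, isSymm_invSqrt]
    _ = _ := by rw [← Matrix.dotProduct_mulVec, Matrix.mulVec_mulVec, invSqrt_mul_invSqrt hM]

open Matrix in
/-- Inverse square roots of matrices that converge to a nonsingular one stay bounded. -/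
lemma exists_bound_invSqrt {C : ℕ → Matrix (Fin k) (Fin k) ℝ} {C' : Matrix (Fin k) (Fin k) ℝ}
    (hC : Tendsto C atTop (𝓝 C')) (hpsd : ∀ n, (C n).PosSemidef) (hdet : C'.det ≠ 0)
    (t : Fin k → ℝ) :
    (∀ᶠ n in atTop, (C n).PosDef) ∧
      ∃ B, ∀ᶠ n in atTop, ∑ i, |(invSqrt (C n) *ᵥ t) i| ≤ B := by
  have hdetlim : Tendsto (fun n => (C n).det) atTop (𝓝 C'.det) :=
    ((continuous_id.matrix_det).tendsto C').comp hC
  have hpd : ∀ᶠ n in atTop, (C n).PosDef := by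
    filter_upwards [hdetlim.eventually_ne hdet] with n hn
    exact (hpsd n).posDef_iff_isUnit.2 ((Matrix.isUnit_iff_isUnit_det _).2 hn.isUnit)
  refine ⟨hpd, ?_⟩
  have hadj : Tendsto (fun n => (C n).adjugate) atTop (𝓝 C'.adjugate) :=
    ((continuous_id.matrix_adjugate).tendsto C').comp hC
  have hinv : Tendsto (fun n => ((C n).det)⁻¹ • (C n).adjugate) atTop
      (𝓝 ((C'.det)⁻¹ • C'.adjugate)) := (hdetlim.inv₀ hdet).smul hadj
  have hquad : Tendsto (fun n => t ⬝ᵥ ((((C n).det)⁻¹ • (C n).adjugate) *ᵥ t)) atTop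
      (𝓝 (t ⬝ᵥ (((C'.det)⁻¹ • C'.adjugate) *ᵥ t))) := by
    have hcont : Continuous fun M : Matrix (Fin k) (Fin k) ℝ => t ⬝ᵥ (M *ᵥ t) :=
      continuous_const.dotProduct (continuous_id.matrix_mulVec continuous_const)
    exact (hcont.tendsto _).comp hinv
  -- From `|a| ≤ 1 + a²` and `|C_n^{-1/2} t|² = t·C_n⁻¹ t`, which converges because the inverse is
  -- the adjugate over a determinant bounded away from 0. The final `+ 1` is slack for the
  -- convergence.
  refine ⟨k + (t ⬝ᵥ (((C'.det)⁻¹ • C'.adjugate) *ᵥ t) + 1), ?_⟩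
  filter_upwards [hpd, hquad.eventually_le_const (lt_add_one _)] with n h1 h2
  have h3 : (C n)⁻¹ = ((C n).det)⁻¹ • (C n).adjugate := by
    rw [Matrix.inv_def, Ring.inverse_eq_inv']
  rw [← h3, ← dotProduct_invSqrt_self h1] at h2
  set u := invSqrt (C n) *ᵥ t
  calc ∑ i, |u i| ≤ ∑ i, (1 + u i * u i) := by
        refine Finset.sum_le_sum fun i _ => abs_le.2 ⟨?_, ?_⟩ <;>
          nlinarith [sq_nonneg (u i - 1), sq_nonneg (u i + 1)]
    _ = k + u ⬝ᵥ u := by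
        rw [Finset.sum_add_distrib]; simp [dotProduct]
    _ ≤ _ := by gcongr

end InverseSquareRoot

end NewtonMixture

namespace NewtonMixture

/-! ### The plug-in matrix as a covariance matrix -/

section Covariance

variable {𝕏 Θ : Type*} [MeasurableSpace 𝕏] [MeasurableSpace Θ] {μ : Measure 𝕏} [SigmaFinite μ]
  {f : 𝕏 → Θ → ℝ≥0} (hf : Measurable (Function.uncurry f))
  (hf1 : ∀ t : Θ, ∫⁻ x, (f x t : ℝ≥0∞) ∂μ = 1) {k : ℕ} {A : Fin k → Set Θ}
  (hA : ∀ i, MeasurableSet (A i))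

lemma probabilityMeasure_coe_mem_Icc (H : ProbabilityMeasure Θ) (B : Set Θ) :
    (H B : ℝ) ∈ Set.Icc (0 : ℝ) 1 :=
  ⟨NNReal.coe_nonneg _, by exact_mod_cast H.apply_le_one B⟩

lemma abs_sub_le_one_of_mem_Icc {a b : ℝ} (ha : a ∈ Set.Icc (0 : ℝ) 1)
    (hb : b ∈ Set.Icc (0 : ℝ) 1) : |a - b| ≤ 1 :=
  abs_le.2 ⟨by linarith [ha.1, hb.2], by linarith [ha.2, hb.1]⟩

include hf in
lemma measurable_posterior_real (H : ProbabilityMeasure Θ) {B : Set Θ} (hB : MeasurableSet B) :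
    Measurable fun x => (posterior f H x B : ℝ) :=
  (measurable_posterior_apply hf H hB).ennreal_toReal

include hf hf1 in
lemma integral_posterior_real (H : ProbabilityMeasure Θ) {B : Set Θ} (hB : MeasurableSet B) :
    ∫ x, (posterior f H x B : ℝ) ∂(mixtureLaw μ f H) = H B := by
  have h := lintegral_posterior_mixtureLaw hf hf1 H (measurable_one.indicator hB)
  simp only [lintegral_indicator_one hB] at h
  calc _ = ∫ x, ((posterior f H x : Measure Θ) B).toReal ∂(mixtureLaw μ f H) := rfl
    _ = _ := by
        rw [integral_toReal (measurable_posterior_apply hf H hB).aemeasurable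
          (ae_of_all _ fun x => measure_lt_top _ _), h]
        rfl

include hf hf1 hA in
lemma abs_plugInCov_le_one (H : ProbabilityMeasure Θ) (i j : Fin k) :
    |plugInCov μ f A H i j| ≤ 1 := by
  have := isProbabilityMeasure_mixtureLaw hf hf1 H
  have hp (x : 𝕏) : (posterior f H x (A i) : ℝ) * (posterior f H x (A j) : ℝ) ∈ Set.Icc (0 : ℝ) 1 :=
    have h1 := probabilityMeasure_coe_mem_Icc (posterior f H x) (A i)
    have h2 := probabilityMeasure_coe_mem_Icc (posterior f H x) (A j)
    ⟨mul_nonneg h1.1 h2.1, mul_le_one₀ h1.2 h2.1 h2.2⟩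
  have hm : Measurable fun x => (posterior f H x (A i) : ℝ) * (posterior f H x (A j) : ℝ) :=
    (measurable_posterior_real hf H (hA i)).mul (measurable_posterior_real hf H (hA j))
  have hint : Integrable (fun x => (posterior f H x (A i) : ℝ) * (posterior f H x (A j) : ℝ))
      (mixtureLaw μ f H) := Integrable.of_bound hm.aestronglyMeasurable 1 (ae_of_all _ fun x => by
        rw [Real.norm_of_nonneg (hp x).1]; exact (hp x).2)
  refine abs_sub_le_one_of_mem_Icc ⟨integral_nonneg fun x => (hp x).1, ?_⟩ ?_
  · refine (integral_mono hint (integrable_const 1) fun x => (hp x).2).trans ?_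
    simp
  · have h1 := probabilityMeasure_coe_mem_Icc H (A i)
    have h2 := probabilityMeasure_coe_mem_Icc H (A j)
    exact ⟨mul_nonneg h1.1 h2.1, mul_le_one₀ h1.2 h2.1 h2.2⟩

/-- The centred posterior masses, in the direction `u`. -/
noncomputable def centredPosterior (f : 𝕏 → Θ → ℝ≥0) (A : Fin k → Set Θ) (u : Fin k → ℝ)
    (H : ProbabilityMeasure Θ) (x : 𝕏) : ℝ :=
  ∑ i, u i * ((posterior f H x (A i) : ℝ) - (H (A i) : ℝ))

omit [MeasurableSpace 𝕏] in
lemma abs_centredPosterior_le (u : Fin k → ℝ) (H : ProbabilityMeasure Θ) (x : 𝕏) :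
    |centredPosterior f A u H x| ≤ ∑ i, |u i| := by
  refine (Finset.abs_sum_le_sum_abs _ _).trans (Finset.sum_le_sum fun i _ => ?_)
  rw [abs_mul]
  exact mul_le_of_le_one_right (abs_nonneg _) (abs_sub_le_one_of_mem_Icc
    (probabilityMeasure_coe_mem_Icc _ _) (probabilityMeasure_coe_mem_Icc _ _))

include hf hf1 hA in
lemma integral_centredPosterior (u : Fin k → ℝ) (H : ProbabilityMeasure Θ) :
    ∫ x, centredPosterior f A u H x ∂(mixtureLaw μ f H) = 0 := by
  have := isProbabilityMeasure_mixtureLaw hf hf1 H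
  have hp (i : Fin k) : Integrable (fun x => (posterior f H x (A i) : ℝ)) (mixtureLaw μ f H) :=
    Integrable.of_bound (measurable_posterior_real hf H (hA i)).aestronglyMeasurable 1
      (ae_of_all _ fun x => by
        rw [Real.norm_of_nonneg (probabilityMeasure_coe_mem_Icc _ _).1]
        exact (probabilityMeasure_coe_mem_Icc _ _).2)
  have hi (i : Fin k) : Integrable (fun x => u i * ((posterior f H x (A i) : ℝ) -
      (H (A i) : ℝ))) (mixtureLaw μ f H) := ((hp i).sub (integrable_const _)).const_mul _
  unfold centredPosterior
  rw [integral_finsetSum _ fun i _ => hi i]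
  refine Finset.sum_eq_zero fun i _ => ?_
  rw [integral_const_mul, integral_sub (hp i) (integrable_const _),
    integral_posterior_real hf hf1 H (hA i)]
  simp

-- Since posterior masses have mean `H(A_i)` under `F_H`, the plug-in matrix is their covariance
-- matrix there. This yields both positive semidefiniteness and the conditional variance of the
-- increments.
open Matrix in
include hf hf1 hA in
lemma integral_centredPosterior_sq (u : Fin k → ℝ) (H : ProbabilityMeasure Θ) :
    ∫ x, centredPosterior f A u H x ^ 2 ∂(mixtureLaw μ f H) =
      u ⬝ᵥ (plugInCov μ f A H *ᵥ u) := by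
  have := isProbabilityMeasure_mixtureLaw hf hf1 H
  have hm (i : Fin k) := measurable_posterior_real hf H (hA i)
  have hb (i : Fin k) (x : 𝕏) : ‖(posterior f H x (A i) : ℝ)‖ ≤ 1 := by
    rw [Real.norm_of_nonneg (probabilityMeasure_coe_mem_Icc _ _).1]
    exact (probabilityMeasure_coe_mem_Icc _ _).2
  have hp (i : Fin k) : Integrable (fun x => (posterior f H x (A i) : ℝ)) (mixtureLaw μ f H) :=
    Integrable.of_bound (hm i).aestronglyMeasurable 1 (ae_of_all _ (hb i))
  have hpp (i j : Fin k) : Integrable (fun x => (posterior f H x (A i) : ℝ) *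
      (posterior f H x (A j) : ℝ)) (mixtureLaw μ f H) :=
    (hp j).bdd_mul (hm i).aestronglyMeasurable (ae_of_all _ (hb i))
  have hexp (i j : Fin k) : (fun x => (u i * ((posterior f H x (A i) : ℝ) - (H (A i) : ℝ))) *
      (u j * ((posterior f H x (A j) : ℝ) - (H (A j) : ℝ)))) =
      fun x => u i * u j * ((posterior f H x (A i) : ℝ) * (posterior f H x (A j) : ℝ)) -
        u i * u j * (H (A j) : ℝ) * (posterior f H x (A i) : ℝ) -
        (u i * u j * (H (A i) : ℝ) * (posterior f H x (A j) : ℝ) -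
          u i * u j * (H (A i) : ℝ) * (H (A j) : ℝ)) := by
    funext x; ring
  have hI (i j : Fin k) : Integrable (fun x => u i * u j * ((posterior f H x (A i) : ℝ) *
      (posterior f H x (A j) : ℝ)) - u i * u j * (H (A j) : ℝ) * (posterior f H x (A i) : ℝ))
      (mixtureLaw μ f H) := ((hpp i j).const_mul (u i * u j)).sub
    ((hp i).const_mul (u i * u j * (H (A j) : ℝ)))
  have hJ (i j : Fin k) : Integrable (fun x => u i * u j * (H (A i) : ℝ) *
      (posterior f H x (A j) : ℝ) - u i * u j * (H (A i) : ℝ) * (H (A j) : ℝ))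
      (mixtureLaw μ f H) := ((hp j).const_mul (u i * u j * (H (A i) : ℝ))).sub
    (integrable_const (μ := mixtureLaw μ f H) (u i * u j * (H (A i) : ℝ) * (H (A j) : ℝ)))
  have hint (i j : Fin k) : Integrable (fun x => (u i * ((posterior f H x (A i) : ℝ) -
      (H (A i) : ℝ))) * (u j * ((posterior f H x (A j) : ℝ) - (H (A j) : ℝ))))
      (mixtureLaw μ f H) := by
    rw [hexp]; exact (hI i j).sub (hJ i j)
  unfold centredPosterior
  simp_rw [sq, Finset.sum_mul_sum]
  rw [integral_finsetSum _ fun i _ => integrable_finsetSum _ fun j _ => hint i j]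
  simp only [dotProduct, Matrix.mulVec, Finset.mul_sum]
  refine Finset.sum_congr rfl fun i _ => ?_
  rw [integral_finsetSum _ fun j _ => hint i j]
  refine Finset.sum_congr rfl fun j _ => ?_
  rw [hexp, integral_sub (hI i j) (hJ i j), integral_sub ((hpp i j).const_mul _)
    ((hp i).const_mul _), integral_sub ((hp j).const_mul _) (integrable_const _),
    integral_const_mul, integral_const_mul, integral_const_mul,
    integral_posterior_real hf hf1 H (hA i), integral_posterior_real hf hf1 H (hA j)]
  simp only [plugInCov, Matrix.of_apply, integral_const, probReal_univ, smul_eq_mul]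
  ring

omit [SigmaFinite μ] in
lemma isHermitian_plugInCov (H : ProbabilityMeasure Θ) : (plugInCov μ f A H).IsHermitian := by
  ext i j
  simp only [plugInCov, Matrix.conjTranspose_apply, Matrix.of_apply, star_trivial]
  congr 1
  · exact integral_congr_ae (ae_of_all _ fun x => mul_comm _ _)
  · exact mul_comm _ _

include hf hf1 hA in
lemma posSemidef_plugInCov (H : ProbabilityMeasure Θ) : (plugInCov μ f A H).PosSemidef := by
  refine Matrix.PosSemidef.of_dotProduct_mulVec_nonneg (isHermitian_plugInCov H) fun u => ?_
  rw [star_trivial, ← integral_centredPosterior_sq hf hf1 hA]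
  exact integral_nonneg fun x => sq_nonneg _

include hf hA in
lemma measurable_plugInCov {β : Type*} [MeasurableSpace β] {H : β → ProbabilityMeasure Θ}
    (hH : Measurable fun b => (H b : Measure Θ)) (i j : Fin k) :
    Measurable fun b => plugInCov μ f A (H b) i j := by
  have hpost (i : Fin k) : Measurable fun p : β × 𝕏 =>
      (posterior f (H p.1) p.2 : Measure Θ) (A i) :=
    (Measure.measurable_coe (hA i)).comp (measurable_posterior hf hH)
  have hd : Measurable fun p : β × 𝕏 => mixtureDensity f (H p.1) p.2 := by
    simpa [← mixtureDensity.eq_1] using measurable_mixtureDensity_kernel hf hH MeasurableSet.univ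
  have hHA (i : Fin k) : Measurable fun b => (H b (A i) : ℝ) :=
    ((Measure.measurable_coe (hA i)).comp hH).ennreal_toReal
  simp only [plugInCov, Matrix.of_apply]
  refine Measurable.sub ?_ ((hHA i).mul (hHA j))
  simp_rw [integral_posterior_mul_posterior hf _ (hA i) (hA j)]
  exact (hd.mul ((hpost i).mul (hpost j))).lintegral_prod_right'.ennreal_toReal

end Covariance

/-! ### Linear functionals of Newton's rule as scalar martingales -/

section ModelMartingale

variable {Ω 𝕏 Θ : Type*} [mΩ : MeasurableSpace Ω] [MeasurableSpace 𝕏] [MeasurableSpace Θ]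
  [Nonempty 𝕏] [StandardBorelSpace 𝕏]
  {P : Measure Ω} [IsProbabilityMeasure P] {μ : Measure 𝕏} [SigmaFinite μ]
  {f : 𝕏 → Θ → ℝ≥0} (hf : Measurable (Function.uncurry f))
  (hf1 : ∀ t : Θ, ∫⁻ x, (f x t : ℝ≥0∞) ∂μ = 1)
  {G₀ : ProbabilityMeasure Θ} {α : ℕ → Set.Ioo (0 : ℝ) 1} {X : ℕ → Ω → 𝕏} {θ : ℕ → Ω → Θ}
  (hX : ∀ n, Measurable (X n)) (hmodel : IsNewtonModel P μ f G₀ α X θ) {κ : Kernel Ω Θ}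
  {k : ℕ} {A : Fin k → Set Θ} (hA : ∀ i, MeasurableSet (A i))

-- The recursion reads `G_{n+1}(A) - G_n(A) = α_{n+1} (P_{G_n}(A | X_{n+1}) - G_n(A))`, and
-- `X_{n+1}` has predictive law `F_{G_n}`; so the conditional mean and variance are integrals
-- against that mixture.
include hf hf1 hmodel hA in
open Matrix in
lemma scalarMartingale_newtonRule (hκ : IsLimitKernel P f G₀ α X κ)
    (hα : Summable fun n => (α n : ℝ) ^ 2) (u : Fin k → ℝ) :
    ScalarMartingale P (obsFiltration hX) (fun n => (α n : ℝ)) (∑ i, |u i|)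
      (fun n ω => ∑ i, u i * (newtonRule f G₀ α (fun i => X i ω) n (A i) : ℝ))
      (fun n ω => centredPosterior f A u (newtonRule f G₀ α (fun i => X i ω) n) (X (n + 1) ω))
      (fun n ω => u ⬝ᵥ (plugInCov μ f A (newtonRule f G₀ α (fun i => X i ω) n) *ᵥ u))
      (fun ω => ∑ i, u i * (κ ω).real (A i)) := by
  have hrule (n : ℕ) := measurable_histRule hf G₀ α n
  have hruleA (n : ℕ) (i : Fin k) : Measurable fun y : Fin n → 𝕏 => (histRule f G₀ α n y (A i) : ℝ) :=
    ((Measure.measurable_coe (hA i)).comp (hrule n)).ennreal_toReal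
  have hF (n : ℕ) : Measurable fun q : (Fin n → 𝕏) × 𝕏 =>
      centredPosterior f A u (histRule f G₀ α n q.1) q.2 := by
    refine Finset.measurable_sum _ fun i _ => Measurable.const_mul (Measurable.sub ?_ ?_) _
    · exact ((Measure.measurable_coe (hA i)).comp
        (measurable_posterior hf (hrule n))).ennreal_toReal
    · exact (hruleA n i).comp measurable_fst
  have hd (n : ℕ) : Measurable fun ω =>
      centredPosterior f A u (newtonRule f G₀ α (fun i => X i ω) n) (X (n + 1) ω) := by
    have h := (hF n).comp ((hmodel.measurable_obs n).prodMk (hX (n + 1)))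
    simpa only [Function.comp_def, histRule_obs] using h
  have hL (n : ℕ) (ω : Ω) := abs_centredPosterior_le (f := f) (A := A) u
    (newtonRule f G₀ α (fun i => X i ω) n) (X (n + 1) ω)
  refine ⟨fun n => (α n).2.1.le, hα, fun n => ?_, hd, fun n => ?_, fun n ω => ?_, hL,
    fun n ω => ?_, fun n ω => ?_, fun n => ?_, fun n => ?_, ?_, ?_⟩
  · simp_rw [← histRule_obs]
    exact measurable_obsFiltration hX (g := fun y => ∑ i, u i * (histRule f G₀ α n y (A i) : ℝ))
      (Finset.measurable_sum _ fun i _ => (hruleA n i).const_mul _)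
  · simp_rw [← histRule_obs]
    refine measurable_obsFiltration hX
      (g := fun y => u ⬝ᵥ (plugInCov μ f A (histRule f G₀ α n y) *ᵥ u)) ?_
    simp only [dotProduct, Matrix.mulVec]
    exact Finset.measurable_sum _ fun i _ => (Finset.measurable_sum _ fun j _ =>
      (measurable_plugInCov hf hA (hrule n) i j).mul_const _).const_mul _
  · simp only [centredPosterior, Finset.mul_sum, ← Finset.sum_add_distrib]
    refine Finset.sum_congr rfl fun i _ => ?_
    rw [newtonRule, convexComb_real]
    ring
  · have := (posSemidef_plugInCov hf hf1 hA
      (newtonRule f G₀ α (fun i => X i ω) n)).dotProduct_mulVec_nonneg u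
    simpa using this
  · have := isProbabilityMeasure_mixtureLaw hf hf1 (newtonRule f G₀ α (fun i => X i ω) n)
    rw [← integral_centredPosterior_sq hf hf1 hA]
    have h2 (x : 𝕏) : centredPosterior f A u (newtonRule f G₀ α (fun i => X i ω) n) x ^ 2 ≤
        (∑ i, |u i|) ^ 2 := by
      rw [← sq_abs]
      exact pow_le_pow_left₀ (abs_nonneg _) (abs_centredPosterior_le u _ x) 2
    refine (integral_mono_of_nonneg (ae_of_all _ fun x => sq_nonneg _)
      (integrable_const ((∑ i, |u i|) ^ 2)) (ae_of_all _ h2)).trans ?_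
    simp
  · refine Filter.EventuallyEq.trans ?_ ((condExp_obs_next hf hf1 hmodel n
      (hF n).stronglyMeasurable ?_).trans (ae_of_all _ fun ω => ?_))
    · simp_rw [histRule_obs]; rfl
    · simp_rw [histRule_obs]
      exact Integrable.of_bound (hd n).aestronglyMeasurable (∑ i, |u i|) (ae_of_all _ (hL n))
    · simp only [histRule_obs]
      exact integral_centredPosterior hf hf1 hA u _
  · refine Filter.EventuallyEq.trans ?_ ((condExp_obs_next hf hf1 hmodel n
      ((hF n).pow_const 2).stronglyMeasurable ?_).trans (ae_of_all _ fun ω => ?_))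
    · simp_rw [histRule_obs]; rfl
    · simp_rw [histRule_obs]
      refine Integrable.of_bound ((hd n).pow_const 2).aestronglyMeasurable ((∑ i, |u i|) ^ 2)
        (ae_of_all _ fun ω => ?_)
      rw [Real.norm_eq_abs, abs_pow]
      exact pow_le_pow_left₀ (abs_nonneg _) (hL n ω) 2
    · simp only [histRule_obs]
      exact integral_centredPosterior_sq hf hf1 hA u _
  · exact Finset.measurable_sum _ fun i _ => (measurable_kernel_real κ (hA i)).const_mul _
  · filter_upwards [ae_all_iff.2 fun i => hκ.tendsto_real (A i) (hA i)] with ω hω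
    exact tendsto_finsetSum _ fun i _ => (hω i).const_mul _

end ModelMartingale

end NewtonMixture

namespace NewtonMixture

/-! ### Tail oscillations and conditional expectations along the diagonal -/

section TailOscillation

/-- The oscillation of a sequence from the index `n` on. -/
noncomputable def tailOsc (c : ℕ → ℝ) (n : ℕ) : ℝ :=
  ⨆ p : ℕ × ℕ, |c (n + p.1) - c (n + p.2)|

variable {c : ℕ → ℝ} {K : ℝ}

lemma bddAbove_tailOsc (hc : ∀ n, |c n| ≤ K) (n : ℕ) :
    BddAbove (Set.range fun p : ℕ × ℕ => |c (n + p.1) - c (n + p.2)|) := by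
  refine ⟨K + K, ?_⟩
  rintro _ ⟨p, rfl⟩
  exact (abs_sub _ _).trans (add_le_add (hc _) (hc _))

lemma tailOsc_nonneg (c : ℕ → ℝ) (n : ℕ) : 0 ≤ tailOsc c n :=
  Real.iSup_nonneg fun _ => abs_nonneg _

lemma tailOsc_le (hc : ∀ n, |c n| ≤ K) (n : ℕ) : tailOsc c n ≤ K + K :=
  ciSup_le fun _ => (abs_sub _ _).trans (add_le_add (hc _) (hc _))

lemma abs_sub_le_tailOsc (hc : ∀ n, |c n| ≤ K) (n j : ℕ) : |c (n + j) - c n| ≤ tailOsc c n :=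
  le_ciSup (bddAbove_tailOsc hc n) (j, 0)

lemma antitone_tailOsc (hc : ∀ n, |c n| ≤ K) : Antitone (tailOsc c) := by
  intro m n hmn
  refine ciSup_le fun p => ?_
  have h := le_ciSup (bddAbove_tailOsc hc m) (n - m + p.1, n - m + p.2)
  simpa only [tailOsc, ← add_assoc, Nat.add_sub_cancel' hmn] using h

lemma tendsto_tailOsc {l : ℝ} (hl : Tendsto c atTop (𝓝 l)) : Tendsto (tailOsc c) atTop (𝓝 0) := by
  rw [Metric.tendsto_atTop]
  intro ε hε
  obtain ⟨N, hN⟩ := Metric.cauchySeq_iff.1 hl.cauchySeq (ε / 2) (half_pos hε)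
  refine ⟨N, fun n hn => ?_⟩
  rw [Real.dist_eq, sub_zero, abs_of_nonneg (tailOsc_nonneg c n)]
  refine lt_of_le_of_lt (ciSup_le fun p => ?_) (half_lt_self hε)
  exact (hN (n + p.1) (by lia) (n + p.2) (by lia)).le

lemma measurable_tailOsc {Ω : Type*} {m : MeasurableSpace Ω} {c : ℕ → Ω → ℝ}
    (hc : ∀ n, Measurable (c n)) (n : ℕ) : Measurable fun ω => tailOsc (fun j => c j ω) n :=
  Measurable.iSup fun _ => ((hc _).sub (hc _)).norm

end TailOscillation

section DiagonalCondExp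

variable {Ω : Type*} {mΩ : MeasurableSpace Ω} {P : Measure Ω} [IsFiniteMeasure P]

/-- For `N ≤ n`, `E[V n | ℱ n] ≤ E[V N | ℱ n]`, and the right side tends to `V N` by Lévy's upward
theorem; then let `N → ∞`. -/
lemma ae_tendsto_condExp_of_antitone {ℱ : Filtration ℕ mΩ} {V : ℕ → Ω → ℝ} {K : ℝ}
    (hV : ∀ n, StronglyMeasurable[⨆ n, ℱ n] (V n)) (h0 : ∀ n ω, 0 ≤ V n ω)
    (hK : ∀ n ω, V n ω ≤ K) (hanti : ∀ ω, Antitone fun n => V n ω)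
    (hlim : ∀ᵐ ω ∂P, Tendsto (fun n => V n ω) atTop (𝓝 0)) :
    ∀ᵐ ω ∂P, Tendsto (fun n => P[V n | ℱ n] ω) atTop (𝓝 0) := by
  have hle : ⨆ n, ℱ n ≤ mΩ := iSup_le fun n => ℱ.le n
  have hint (n : ℕ) : Integrable (V n) P :=
    Integrable.of_bound ((hV n).mono hle).aestronglyMeasurable K (ae_of_all _ fun ω => by
      rw [Real.norm_of_nonneg (h0 n ω)]; exact hK n ω)
  have h1 : ∀ᵐ ω ∂P, ∀ N, Tendsto (fun n => P[V N | ℱ n] ω) atTop (𝓝 (V N ω)) :=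
    ae_all_iff.2 fun N => (hint N).tendsto_ae_condExp (hV N)
  have h2 : ∀ᵐ ω ∂P, ∀ N n, N ≤ n → P[V n | ℱ n] ω ≤ P[V N | ℱ n] ω :=
    ae_all_iff.2 fun N => ae_all_iff.2 fun n => by
      by_cases h : N ≤ n
      · filter_upwards [condExp_mono (m := ℱ n) (hint n) (hint N)
          (ae_of_all _ fun ω => hanti ω h)] with ω hω _ using hω
      · exact ae_of_all _ fun ω h' => absurd h' h
  have h3 : ∀ᵐ ω ∂P, ∀ n, 0 ≤ P[V n | ℱ n] ω :=
    ae_all_iff.2 fun n => condExp_nonneg (ae_of_all _ fun ω => h0 n ω)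
  filter_upwards [h1, h2, h3, hlim] with ω h1 h2 h3 hlim
  refine tendsto_order.2 ⟨fun a ha => .of_forall fun n => ha.trans_le (h3 n), fun a ha => ?_⟩
  obtain ⟨N, hN⟩ := ((tendsto_order.1 hlim).2 a ha).exists
  filter_upwards [(tendsto_order.1 (h1 N)).2 a hN, eventually_ge_atTop N] with n hn hNn
  exact (h2 N n hNn).trans_lt hn

end DiagonalCondExp

/-! ### Characteristic functions of regular conditional laws -/

section ConditionalCharFun

variable {Ω β : Type*} {mΩ : MeasurableSpace Ω} [mβ : MeasurableSpace β] {P : Measure Ω}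
  [IsProbabilityMeasure P] {k : ℕ} {O : Ω → β} (hO : Measurable O)
  {Z : Ω → EuclideanSpace ℝ (Fin k)} (hZ : Measurable Z)
include hO hZ

lemma condExp_cexp_inner_ae_eq_charFun (u : EuclideanSpace ℝ (Fin k)) :
    P[fun ω => Complex.exp ((inner ℝ (Z ω) u : ℝ) * Complex.I) | mβ.comap O] =ᵐ[P]
      fun ω => charFun (condDistrib Z O P (O ω)) u := by
  have hm : Measurable fun z : EuclideanSpace ℝ (Fin k) =>
      Complex.exp ((inner ℝ z u : ℝ) * Complex.I) := by fun_prop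
  simp only [charFun_apply]
  exact condExp_ae_eq_integral_condDistrib hO hZ.aemeasurable hm.stronglyMeasurable
    (Integrable.of_bound (hm.comp hZ).aestronglyMeasurable 1
      (ae_of_all _ fun ω => (Complex.norm_exp_ofReal_mul_I _).le))

/-- The characteristic function of the conditional law of a vector obtained from `Z` by a linear
map that depends on the conditioning variable only. -/
lemma ae_charFun_condDistrib_mulVec {Y : Ω → EuclideanSpace ℝ (Fin k)}
    {M : β → Matrix (Fin k) (Fin k) ℝ} (hM : ∀ i j, Measurable fun b => M b i j)
    (hY : ∀ᵐ ω ∂P, Y ω = WithLp.toLp 2 (M (O ω) *ᵥ (Z ω).ofLp)) :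
    ∀ᵐ ω ∂P, ∀ t : EuclideanSpace ℝ (Fin k), charFun (condDistrib Y O P (O ω)) t =
      charFun (condDistrib Z O P (O ω)) (WithLp.toLp 2 ((M (O ω))ᵀ *ᵥ t.ofLp)) := by
  let Y' (ω : Ω) : EuclideanSpace ℝ (Fin k) := WithLp.toLp 2 (M (O ω) *ᵥ (Z ω).ofLp)
  have hMZ : Measurable fun p : β × EuclideanSpace ℝ (Fin k) =>
      (WithLp.toLp 2 (M p.1 *ᵥ p.2.ofLp) : EuclideanSpace ℝ (Fin k)) := by
    refine (PiLp.continuous_toLp 2 _).measurable.comp (measurable_pi_lambda _ fun i => ?_)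
    simp only [Matrix.mulVec, dotProduct]
    refine Finset.measurable_sum _ fun j _ => ((hM i j).comp measurable_fst).mul ?_
    fun_prop
  have hY' : Measurable Y' := hMZ.comp (hO.prodMk hZ)
  rw [condDistrib_congr_left (Y' := Y') hY]
  have hinner (b : β) (z t : EuclideanSpace ℝ (Fin k)) :
      inner ℝ (WithLp.toLp 2 (M b *ᵥ z.ofLp) : EuclideanSpace ℝ (Fin k)) t =
        inner ℝ z (WithLp.toLp 2 ((M b)ᵀ *ᵥ t.ofLp)) := by
    rw [EuclideanSpace.inner_eq_star_dotProduct, EuclideanSpace.inner_eq_star_dotProduct]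
    simp only [star_trivial]
    rw [Matrix.dotProduct_mulVec, Matrix.mulVec_transpose]
  have hpt (t : EuclideanSpace ℝ (Fin k)) : ∀ᵐ ω ∂P, charFun (condDistrib Y' O P (O ω)) t =
      charFun (condDistrib Z O P (O ω)) (WithLp.toLp 2 ((M (O ω))ᵀ *ᵥ t.ofLp)) := by
    have hF : Measurable fun p : β × EuclideanSpace ℝ (Fin k) =>
        Complex.exp ((inner ℝ (WithLp.toLp 2 (M p.1 *ᵥ p.2.ofLp) :
          EuclideanSpace ℝ (Fin k)) t : ℝ) * Complex.I) := by
      have := hMZ.inner (𝕜 := ℝ) (measurable_const (a := t))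
      fun_prop
    have h1 := condExp_prod_ae_eq_integral_condDistrib (μ := P) hO hZ.aemeasurable
      hF.stronglyMeasurable (Integrable.of_bound (hF.comp (hO.prodMk hZ)).aestronglyMeasurable 1
        (ae_of_all _ fun ω => (Complex.norm_exp_ofReal_mul_I _).le))
    filter_upwards [h1, condExp_cexp_inner_ae_eq_charFun (P := P) hO hY' t] with ω h1 h2
    rw [← h2, h1, charFun_apply]
    simp only [hinner]
  -- The null set depends on `t`; a countable dense set of `t` and continuity of both sides remove
  -- the dependence.
  have hd := TopologicalSpace.denseRange_denseSeq (EuclideanSpace ℝ (Fin k))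
  filter_upwards [ae_all_iff.2 fun i => hpt (TopologicalSpace.denseSeq _ i)] with ω hω t
  have hcl : IsClosed {t : EuclideanSpace ℝ (Fin k) | charFun (condDistrib Y' O P (O ω)) t =
      charFun (condDistrib Z O P (O ω)) (WithLp.toLp 2 ((M (O ω))ᵀ *ᵥ t.ofLp))} := by
    refine isClosed_eq continuous_charFun (continuous_charFun.comp ?_)
    exact (PiLp.continuous_toLp 2 _).comp (Continuous.matrix_mulVec continuous_const (by fun_prop))
  exact hcl.closure_subset_iff.2 (Set.range_subset_iff.2 hω) (hd t)

end ConditionalCharFun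

end NewtonMixture

/-! ### Gaussian comparison for Newton's rule, uniformly over directions -/

namespace NewtonMixture

lemma abs_quadForm_sub_le {k : ℕ} (u : Fin k → ℝ) (C D : Matrix (Fin k) (Fin k) ℝ) :
    |u ⬝ᵥ (C *ᵥ u) - u ⬝ᵥ (D *ᵥ u)| ≤ (∑ i, |u i|) ^ 2 * ∑ i, ∑ j, |C i j - D i j| := by
  have hle (i : Fin k) : |u i| ≤ ∑ i, |u i| :=
    Finset.single_le_sum (f := fun i => |u i|) (fun _ _ => abs_nonneg _) (Finset.mem_univ i)
  have hL : 0 ≤ ∑ i, |u i| := Finset.sum_nonneg fun _ _ => abs_nonneg _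
  rw [← dotProduct_sub, ← Matrix.sub_mulVec]
  simp only [dotProduct, Matrix.mulVec, Finset.mul_sum, Matrix.sub_apply]
  refine (Finset.abs_sum_le_sum_abs _ _).trans (Finset.sum_le_sum fun i _ =>
    (Finset.abs_sum_le_sum_abs _ _).trans (Finset.sum_le_sum fun j _ => ?_))
  rw [abs_mul, abs_mul, mul_comm |C i j - D i j|, ← mul_assoc, sq]
  gcongr
  exacts [hle i, hle j]

section ModelBound

variable {Ω 𝕏 Θ : Type*} [mΩ : MeasurableSpace Ω] [MeasurableSpace 𝕏] [MeasurableSpace Θ]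
  {P : Measure Ω} [IsProbabilityMeasure P] {μ : Measure 𝕏} [SigmaFinite μ]
  {f : 𝕏 → Θ → ℝ≥0} (hf : Measurable (Function.uncurry f))
  (hf1 : ∀ t : Θ, ∫⁻ x, (f x t : ℝ≥0∞) ∂μ = 1)
  {G₀ : ProbabilityMeasure Θ} {α : ℕ → Set.Ioo (0 : ℝ) 1} {X : ℕ → Ω → 𝕏} {θ : ℕ → Ω → Θ}
  (hX : ∀ n, Measurable (X n)) (hmodel : IsNewtonModel P μ f G₀ α X θ) {κ : Kernel Ω Θ}
  {k : ℕ} {A : Fin k → Set Θ} (hA : ∀ i, MeasurableSet (A i))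

/-- The total oscillation of the entries of the matrices `C_m`, `m ≥ n`. -/
noncomputable def covOsc (μ : Measure 𝕏) (f : 𝕏 → Θ → ℝ≥0) (G₀ : ProbabilityMeasure Θ)
    (α : ℕ → Set.Ioo (0 : ℝ) 1) (X : ℕ → Ω → 𝕏) (A : Fin k → Set Θ) (n : ℕ) (ω : Ω) : ℝ :=
  ∑ i, ∑ j, tailOsc (fun m => plugInCov μ f A (newtonRule f G₀ α (fun l => X l ω) m) i j) n

/-- The vector of the fluctuations `κ(A_i) - G_n(A_i)`. -/
noncomputable def fluctuation (f : 𝕏 → Θ → ℝ≥0) (G₀ : ProbabilityMeasure Θ)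
    (α : ℕ → Set.Ioo (0 : ℝ) 1) (X : ℕ → Ω → 𝕏) (A : Fin k → Set Θ) (κ : Kernel Ω Θ) (n : ℕ)
    (ω : Ω) : EuclideanSpace ℝ (Fin k) :=
  WithLp.toLp 2 fun i => (κ ω).real (A i) - (newtonRule f G₀ α (fun l => X l ω) n (A i) : ℝ)

include hf hX hA in
lemma measurable_obsFiltration_plugInCov [Nonempty 𝕏] (n : ℕ) (i j : Fin k) :
    Measurable[obsFiltration hX n] fun ω =>
      plugInCov μ f A (newtonRule f G₀ α (fun l => X l ω) n) i j := by
  simp_rw [← histRule_obs]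
  exact measurable_obsFiltration hX (g := fun y => plugInCov μ f A (histRule f G₀ α n y) i j)
    (measurable_plugInCov hf hA (measurable_histRule hf G₀ α n) i j)

include hf hX hA in
lemma stronglyMeasurable_covOsc [Nonempty 𝕏] (n : ℕ) :
    StronglyMeasurable[⨆ n, obsFiltration hX n] (covOsc μ f G₀ α X A n) := by
  refine Measurable.stronglyMeasurable ?_
  refine Finset.measurable_sum _ fun i _ => Finset.measurable_sum _ fun j _ =>
    measurable_tailOsc (c := fun m ω =>
      plugInCov μ f A (newtonRule f G₀ α (fun l => X l ω) m) i j) (fun m => ?_) n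
  exact (measurable_obsFiltration_plugInCov hf hX hA m i j).mono
    (le_iSup (fun n => obsFiltration hX n) m) le_rfl

omit mΩ in
include hf hf1 hA in
lemma covOsc_mem_Icc (n : ℕ) (ω : Ω) :
    covOsc μ f G₀ α X A n ω ∈ Set.Icc 0 (∑ _i : Fin k, ∑ _j : Fin k, ((1 : ℝ) + 1)) :=
  ⟨Finset.sum_nonneg fun _ _ => Finset.sum_nonneg fun _ _ => tailOsc_nonneg _ _,
    Finset.sum_le_sum fun i _ => Finset.sum_le_sum fun j _ =>
      tailOsc_le (fun _ => abs_plugInCov_le_one hf hf1 hA _ i j) n⟩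

include hf hf1 hX hA in
lemma integrable_covOsc [Nonempty 𝕏] (n : ℕ) : Integrable (covOsc μ f G₀ α X A n) P :=
  Integrable.of_bound ((stronglyMeasurable_covOsc hf hX hA n).mono
    (iSup_le fun n => (obsFiltration hX).le n)).aestronglyMeasurable _ (ae_of_all _ fun ω => by
      rw [Real.norm_of_nonneg (covOsc_mem_Icc hf hf1 hA n ω).1]
      exact (covOsc_mem_Icc hf hf1 hA n ω).2)

include hf hf1 hA in
lemma ae_tendsto_condExp_covOsc [Nonempty 𝕏] (hκ : IsLimitKernel P f G₀ α X κ) :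
    ∀ᵐ ω ∂P, Tendsto (fun n => P[covOsc μ f G₀ α X A n | obsFiltration hX n] ω) atTop (𝓝 0) := by
  refine ae_tendsto_condExp_of_antitone (stronglyMeasurable_covOsc hf hX hA)
    (fun n ω => (covOsc_mem_Icc hf hf1 hA n ω).1) (fun n ω => (covOsc_mem_Icc hf hf1 hA n ω).2)
    (fun ω m n hmn => Finset.sum_le_sum fun i _ => Finset.sum_le_sum fun j _ =>
      antitone_tailOsc (fun _ => abs_plugInCov_le_one hf hf1 hA _ i j) hmn) ?_
  have := hκ.markov
  filter_upwards [hκ.ae_tendsto_plugInCov hf hf1 hX hA] with ω hω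
  have h (i j : Fin k) := tendsto_tailOsc (hω ⟨κ ω, inferInstance⟩ rfl i j)
  have h' := tendsto_finsetSum Finset.univ fun i _ =>
    tendsto_finsetSum Finset.univ fun j _ => h i j
  simpa [covOsc] using h'

omit mΩ in
include hf hf1 hA in
lemma abs_quadForm_plugInCov_sub_le (u : Fin k → ℝ) (n j : ℕ) (ω : Ω) :
    |u ⬝ᵥ (plugInCov μ f A (newtonRule f G₀ α (fun l => X l ω) (n + j)) *ᵥ u) -
        u ⬝ᵥ (plugInCov μ f A (newtonRule f G₀ α (fun l => X l ω) n) *ᵥ u)| ≤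
      (∑ i, |u i|) ^ 2 * covOsc μ f G₀ α X A n ω := by
  refine (abs_quadForm_sub_le _ _ _).trans (mul_le_mul_of_nonneg_left ?_ (sq_nonneg _))
  exact Finset.sum_le_sum fun i _ => Finset.sum_le_sum fun j' _ =>
    abs_sub_le_tailOsc (c := fun m => plugInCov μ f A (newtonRule f G₀ α (fun l => X l ω) m) i j')
      (fun _ => abs_plugInCov_le_one hf hf1 hA _ i j') n j

include hf hX hA in
lemma measurable_fluctuation [Nonempty 𝕏] (n : ℕ) :
    Measurable (fluctuation f G₀ α X A κ n) := by
  refine (PiLp.continuous_toLp 2 _).measurable.comp (measurable_pi_lambda _ fun i => ?_)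
  refine (measurable_kernel_real κ (hA i)).sub ?_
  exact ((Measure.measurable_coe (hA i)).comp
    ((measurable_newtonRule hf G₀ α n).comp (measurable_pi_lambda _ hX))).ennreal_toReal

include hf hf1 hA in
/-- The conditional characteristic functions of the fluctuations, compared with the Gaussian
ones, uniformly over all directions outside one null set. -/
lemma ae_norm_charFun_fluctuation_sub_le [Nonempty 𝕏] [StandardBorelSpace 𝕏]
    (hmodel : IsNewtonModel P μ f G₀ α X θ)
    (hκ : IsLimitKernel P f G₀ α X κ) (hα : Summable fun n => (α n : ℝ) ^ 2) {s : ℕ → ℝ}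
    (hs : ∀ n m, n < m → (α m : ℝ) ≤ s n) :
    ∀ᵐ ω ∂P, ∀ n, ∀ u : EuclideanSpace ℝ (Fin k),
      ‖charFun (condDistrib (fluctuation f G₀ α X A κ n) (obs X n) P (obs X n ω)) u -
        (Real.exp (-(u.ofLp ⬝ᵥ (plugInCov μ f A (newtonRule f G₀ α (fun l => X l ω) n) *ᵥ u.ofLp) *
          (∑' i, (α (n + 1 + i) : ℝ) ^ 2) / 2)) : ℝ)‖ ≤
      (∑' i, (α (n + 1 + i) : ℝ) ^ 2) * ((∑ i, |u i|) ^ 3 * s n * Real.exp ((∑ i, |u i|) * s n) +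
        (∑ i, |u i|) ^ 4 * s n ^ 2 * Real.exp ((∑ i, |u i|) ^ 2 * s n ^ 2) +
        (∑ i, |u i|) ^ 2 * P[covOsc μ f G₀ α X A n | obsFiltration hX n] ω / 2) := by
  refine ae_all_iff.2 fun n => ?_
  have hpt (u : EuclideanSpace ℝ (Fin k)) : ∀ᵐ ω ∂P,
      ‖charFun (condDistrib (fluctuation f G₀ α X A κ n) (obs X n) P (obs X n ω)) u -
        (Real.exp (-(u.ofLp ⬝ᵥ (plugInCov μ f A (newtonRule f G₀ α (fun l => X l ω) n) *ᵥ u.ofLp) *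
          (∑' i, (α (n + 1 + i) : ℝ) ^ 2) / 2)) : ℝ)‖ ≤
      (∑' i, (α (n + 1 + i) : ℝ) ^ 2) * ((∑ i, |u i|) ^ 3 * s n * Real.exp ((∑ i, |u i|) * s n) +
        (∑ i, |u i|) ^ 4 * s n ^ 2 * Real.exp ((∑ i, |u i|) ^ 2 * s n ^ 2) +
        (∑ i, |u i|) ^ 2 * P[covOsc μ f G₀ α X A n | obsFiltration hX n] ω / 2) := by
    have hint := integrable_covOsc (P := P) (G₀ := G₀) (α := α) hf hf1 hX hA n
    have h := (scalarMartingale_newtonRule hf hf1 hX hmodel hA hκ hα u.ofLp).norm_condExp_cexp_sub_le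
      n (hs n) (hint.const_mul ((∑ i, |u i|) ^ 2)) fun j ω =>
        abs_quadForm_plugInCov_sub_le hf hf1 hA u.ofLp n j ω
    have hc : P[fun ω => (∑ i, |u i|) ^ 2 * covOsc μ f G₀ α X A n ω | obsFiltration hX n] =ᵐ[P]
        fun ω => (∑ i, |u i|) ^ 2 * P[covOsc μ f G₀ α X A n | obsFiltration hX n] ω :=
      condExp_smul ((∑ i, |u i|) ^ 2) (covOsc μ f G₀ α X A n) _
    have hφ := condExp_cexp_inner_ae_eq_charFun (P := P) (hmodel.measurable_obs n)
      (measurable_fluctuation (κ := κ) (G₀ := G₀) (α := α) hf hX hA n) u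
    have hin (ω : Ω) : inner ℝ (fluctuation f G₀ α X A κ n ω) u = ∑ i, u i * (κ ω).real (A i) -
        ∑ i, u i * (newtonRule f G₀ α (fun l => X l ω) n (A i) : ℝ) := by
      rw [EuclideanSpace.inner_eq_star_dotProduct]
      simp only [star_trivial, dotProduct, fluctuation, mul_sub, Finset.sum_sub_distrib]
    simp only [hin] at hφ
    filter_upwards [h, hc, hφ] with ω h hc hφ
    rw [← hc, ← hφ]
    exact h
  -- Both sides are continuous in `u`, so one null set serves all directions. This is essential,
  -- because `u` will later depend on `ω` through `C_n`.
  have hd := TopologicalSpace.denseRange_denseSeq (EuclideanSpace ℝ (Fin k))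
  filter_upwards [ae_all_iff.2 fun i => hpt (TopologicalSpace.denseSeq _ i)] with ω hω u
  refine hd.induction_on u (isClosed_le ?_ ?_) hω
  · refine (continuous_charFun.sub (Complex.continuous_ofReal.comp ?_)).norm
    simp only [dotProduct, Matrix.mulVec]
    fun_prop
  · fun_prop

end ModelBound

end NewtonMixture

/-! ### Studentization and the conditional central limit theorem -/

namespace NewtonMixture

/-- The limit of characteristic functions that are compared with Gaussian ones along directions
growing like `√(r n)`. -/
lemma tendsto_charFun_of_norm_sub_le {k : ℕ} {r R s w : ℕ → ℝ} {b : ℕ → Fin k → ℝ}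
    {C : ℕ → Matrix (Fin k) (Fin k) ℝ} {φ : ℕ → ℂ} {K T : ℝ} (hr : ∀ᶠ n in atTop, 0 < r n)
    (hR : ∀ n, 0 ≤ R n) (hs0 : ∀ n, 0 ≤ s n) (hrR : Tendsto (fun n => r n * R n) atTop (𝓝 1))
    (hrs : Tendsto (fun n => √(r n) * s n) atTop (𝓝 0)) (hw : Tendsto w atTop (𝓝 0))
    (hb : ∀ᶠ n in atTop, ∑ i, |b n i| ≤ K) (hq : ∀ᶠ n in atTop, b n ⬝ᵥ (C n *ᵥ b n) = T)
    (hφ : ∀ n, ‖φ n - (Real.exp (-((√(r n) • b n) ⬝ᵥ (C n *ᵥ (√(r n) • b n)) * R n / 2)) : ℝ)‖ ≤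
      R n * ((∑ i, |(√(r n) • b n) i|) ^ 3 * s n * Real.exp ((∑ i, |(√(r n) • b n) i|) * s n) +
        (∑ i, |(√(r n) • b n) i|) ^ 4 * s n ^ 2 *
          Real.exp ((∑ i, |(√(r n) • b n) i|) ^ 2 * s n ^ 2) +
        (∑ i, |(√(r n) • b n) i|) ^ 2 * w n / 2)) :
    Tendsto φ atTop (𝓝 (Real.exp (-(T / 2)) : ℝ)) := by
  have hmain : Tendsto (fun n => ((Real.exp (-(r n * R n * T / 2)) : ℝ) : ℂ)) atTop
      (𝓝 (Real.exp (-(T / 2)) : ℝ)) := by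
    refine (Complex.continuous_ofReal.tendsto _).comp ((Real.continuous_exp.tendsto _).comp ?_)
    simpa using ((hrR.mul_const T).div_const 2).neg
  have herr : Tendsto (fun n => r n * R n * (K ^ 3 * (√(r n) * s n) *
      Real.exp (K * (√(r n) * s n)) + K ^ 4 * (√(r n) * s n) ^ 2 *
        Real.exp (K ^ 2 * (√(r n) * s n) ^ 2) + K ^ 2 * |w n| / 2)) atTop (𝓝 0) := by
    have hg : Continuous fun p : ℝ × ℝ × ℝ => p.1 * (K ^ 3 * p.2.1 * Real.exp (K * p.2.1) +
        K ^ 4 * p.2.1 ^ 2 * Real.exp (K ^ 2 * p.2.1 ^ 2) + K ^ 2 * |p.2.2| / 2) := by fun_prop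
    have h := (hg.tendsto (1, 0, 0)).comp (hrR.prodMk_nhds (hrs.prodMk_nhds hw))
    simpa [Function.comp_def] using h
  have hdiff : Tendsto (fun n => φ n - (Real.exp (-(r n * R n * T / 2)) : ℝ)) atTop (𝓝 0) := by
    refine squeeze_zero_norm' ?_ herr
    filter_upwards [hr, hb, hq] with n hr hb hq
    have hsq : √(r n) ^ 2 = r n := Real.sq_sqrt hr.le
    set l := ∑ i, |b n i| with hl
    have hl0 : 0 ≤ l := Finset.sum_nonneg fun _ _ => abs_nonneg _
    have hL : ∑ i, |(√(r n) • b n) i| = √(r n) * l := by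
      simp only [Pi.smul_apply, smul_eq_mul, abs_mul, abs_of_nonneg (Real.sqrt_nonneg _), hl,
        Finset.mul_sum]
    have hQ : (√(r n) • b n) ⬝ᵥ (C n *ᵥ (√(r n) • b n)) * R n / 2 = r n * R n * T / 2 := by
      rw [Matrix.mulVec_smul, smul_dotProduct, dotProduct_smul, hq, smul_eq_mul, smul_eq_mul,
        ← mul_assoc, ← sq, hsq]
      ring
    have h := hφ n
    rw [hL, hQ] at h
    refine h.trans ?_
    set ρ := √(r n) * s n with hρ
    have hρ0 : 0 ≤ ρ := mul_nonneg (Real.sqrt_nonneg _) (hs0 n)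
    -- Every error term splits off a factor `r n`, which is paired with `R n`; what is left depends
    -- on `n` only through the bounded `l`, the null sequence `√(r n) * s n` and `w n`.
    have h1 : √(r n) * l * s n = l * ρ := by rw [hρ]; ring
    have h2 : (√(r n) * l) ^ 2 * s n ^ 2 = l ^ 2 * ρ ^ 2 := by rw [hρ]; ring
    have h3 : (√(r n) * l) ^ 3 * s n = r n * (l ^ 3 * ρ) := by
      rw [hρ]; nth_rewrite 2 [← hsq]; ring
    have h4 : (√(r n) * l) ^ 4 * s n ^ 2 = r n * (l ^ 4 * ρ ^ 2) := by
      rw [hρ]; nth_rewrite 2 [← hsq]; ring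
    have h5 : (√(r n) * l) ^ 2 * w n = r n * (l ^ 2 * w n) := by
      nth_rewrite 2 [← hsq]; ring
    rw [h1, h2, h3, h4, h5]
    have h6 : R n * (r n * (l ^ 3 * ρ) * Real.exp (l * ρ) + r n * (l ^ 4 * ρ ^ 2) *
        Real.exp (l ^ 2 * ρ ^ 2) + r n * (l ^ 2 * w n) / 2) = r n * R n * (l ^ 3 * ρ *
        Real.exp (l * ρ) + l ^ 4 * ρ ^ 2 * Real.exp (l ^ 2 * ρ ^ 2) + l ^ 2 * w n / 2) := by ring
    rw [h6]
    have hK : 0 ≤ K := hl0.trans hb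
    have hRn := hR n
    have hwn : l ^ 2 * w n ≤ l ^ 2 * |w n| := by gcongr; exact le_abs_self _
    calc _ ≤ r n * R n * (l ^ 3 * ρ * Real.exp (l * ρ) + l ^ 4 * ρ ^ 2 *
          Real.exp (l ^ 2 * ρ ^ 2) + l ^ 2 * |w n| / 2) := by gcongr
      _ ≤ _ := by gcongr
  simpa using hdiff.add hmain

section CLT

variable {Ω 𝕏 Θ : Type*} [mΩ : MeasurableSpace Ω] [MeasurableSpace 𝕏] [StandardBorelSpace 𝕏]
  [Nonempty 𝕏] [TopologicalSpace Θ] [MeasurableSpace Θ] [OpensMeasurableSpace Θ]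
  {P : Measure Ω} [IsProbabilityMeasure P] {μ : Measure 𝕏} [SigmaFinite μ]
  {f : 𝕏 → Θ → ℝ≥0} (hf : Measurable (Function.uncurry f))
  (hf1 : ∀ t : Θ, ∫⁻ x, (f x t : ℝ≥0∞) ∂μ = 1)
  {G₀ : ProbabilityMeasure Θ} {α : ℕ → Set.Ioo (0 : ℝ) 1} {X : ℕ → Ω → 𝕏} {θ : ℕ → Ω → Θ}
  (hmodel : IsNewtonModel P μ f G₀ α X θ) {κ : Kernel Ω Θ} (hκ : IsLimitKernel P f G₀ α X κ)
  (hlim : ∀ᵐ ω ∂P, (limitMixing f G₀ α (fun i => X i ω) : Measure Θ) = κ ω)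
  {k : ℕ} {A : Fin k → Set Θ} (hA : ∀ i, MeasurableSet (A i))

-- `C_n` is a function of `X_{1:n}`, so under the conditional law the studentizing matrix acts as a
-- constant and moves to the argument of the characteristic function; it is symmetric, so no
-- transpose appears.
omit [StandardBorelSpace 𝕏] in
include hf hmodel hlim hA in
lemma ae_charFun_condLaw_studentized (r : ℕ → ℝ) :
    ∀ᵐ ω ∂P, ∀ n, ∀ t : EuclideanSpace ℝ (Fin k),
      charFun (condLaw P X (studentized μ f G₀ α r X A n) n ω : Measure _) t =
        charFun (condDistrib (fluctuation f G₀ α X A κ n) (obs X n) P (obs X n ω))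
          (WithLp.toLp 2 (√(r n) •
            (invSqrt (plugInCov μ f A (newtonRule f G₀ α (fun i => X i ω) n)) *ᵥ t.ofLp))) := by
  refine ae_all_iff.2 fun n => ?_
  have hM (i j : Fin k) : Measurable fun y : Fin n → 𝕏 =>
      (√(r n) • invSqrt (plugInCov μ f A (histRule f G₀ α n y))) i j :=
    (measurable_invSqrt (measurable_plugInCov hf hA (measurable_histRule hf G₀ α n))
      (fun y => isHermitian_plugInCov _) i j).const_mul _
  have hY : ∀ᵐ ω ∂P, studentized μ f G₀ α r X A n ω = WithLp.toLp 2
      ((√(r n) • invSqrt (plugInCov μ f A (histRule f G₀ α n (obs X n ω)))) *ᵥ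
        (fluctuation f G₀ α X A κ n ω).ofLp) := by
    filter_upwards [hlim] with ω hω
    have h (i : Fin k) : (limitMixing f G₀ α (fun j => X j ω) (A i) : ℝ) = (κ ω).real (A i) := by
      rw [← hω]; rfl
    simp only [studentized, fluctuation, h, histRule_obs, Matrix.smul_mulVec]
  filter_upwards [ae_charFun_condDistrib_mulVec (P := P) (hmodel.measurable_obs n)
    (measurable_fluctuation (κ := κ) (G₀ := G₀) (α := α) hf hmodel.measurable_X hA n) hM hY]
    with ω hω t
  have h := hω t
  simp only [histRule_obs, Matrix.transpose_smul, isSymm_invSqrt, Matrix.smul_mulVec] at h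
  exact h

include hf hf1 hmodel hκ hlim hA in
theorem ae_tendsto_condLaw_studentized (hα : Summable fun n => (α n : ℝ) ^ 2) {r : ℕ → ℝ}
    (hr_pos : ∀ n, 1 ≤ n → 0 < r n)
    (hr_equiv : r ~[atTop] fun n => (∑' j, (α (n + 1 + j) : ℝ) ^ 2)⁻¹)
    (hr_sup : Tendsto (fun n => √(r n) * ⨆ k : Set.Ici n, (α k : ℝ)) atTop (𝓝 0)) :
    ∀ᵐ ω ∂P, (limitCov μ f A (limitMixing f G₀ α (fun i => X i ω))).det ≠ 0 →
      Tendsto (fun n => condLaw P X (studentized μ f G₀ α r X A n) n ω) atTop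
        (𝓝 (stdNormal k)) := by
  have hX := hmodel.measurable_X
  have hRpos (n : ℕ) : 0 < ∑' j, (α (n + 1 + j) : ℝ) ^ 2 := by
    have hsum : Summable fun j => (α (n + 1 + j) : ℝ) ^ 2 := by
      simpa only [add_comm] using (summable_nat_add_iff (n + 1)).2 hα
    exact hsum.tsum_pos (fun j => sq_nonneg _) 0 (pow_pos (α _).2.1 2)
  have hrR : Tendsto (fun n => r n * ∑' j, (α (n + 1 + j) : ℝ) ^ 2) atTop (𝓝 1) := by
    have h := (isEquivalent_iff_tendsto_one (.of_forall fun n => (inv_pos.2 (hRpos n)).ne')).1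
      hr_equiv
    simpa [Pi.div_def] using h
  have hbdd (n : ℕ) : BddAbove (Set.range fun k : Set.Ici n => (α k : ℝ)) :=
    ⟨1, by rintro _ ⟨m, rfl⟩; exact (α m).2.2.le⟩
  have hs (n m : ℕ) (h : n < m) : (α m : ℝ) ≤ ⨆ k : Set.Ici n, (α k : ℝ) :=
    le_ciSup (hbdd n) ⟨m, h.le⟩
  filter_upwards [hlim, hκ.ae_tendsto_plugInCov hf hf1 hX hA,
    ae_tendsto_condExp_covOsc hf hf1 hX hA hκ,
    ae_norm_charFun_fluctuation_sub_le hf hf1 hX hA hmodel hκ hα hs,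
    ae_charFun_condLaw_studentized hf hmodel hlim hA r] with ω hG hC hw hφ hstud hdet
  rw [limitCov_eq_plugInCov hf] at hdet
  have hC' : Tendsto (fun n => plugInCov μ f A (newtonRule f G₀ α (fun i => X i ω) n)) atTop
      (𝓝 (plugInCov μ f A (limitMixing f G₀ α (fun i => X i ω)))) :=
    tendsto_pi_nhds.2 fun i => tendsto_pi_nhds.2 fun j => hC _ hG i j
  refine ProbabilityMeasure.tendsto_iff_tendsto_charFun.2 fun t => ?_
  obtain ⟨hpd, K, hK⟩ := exists_bound_invSqrt hC' (fun n => posSemidef_plugInCov hf hf1 hA _) hdet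
    t.ofLp
  have hT : charFun (stdNormal k : Measure (EuclideanSpace ℝ (Fin k))) t =
      (Real.exp (-(t.ofLp ⬝ᵥ t.ofLp / 2)) : ℝ) := by
    rw [show (stdNormal k : Measure (EuclideanSpace ℝ (Fin k))) =
      stdGaussian (EuclideanSpace ℝ (Fin k)) from rfl, charFun_stdGaussian]
    have hn : ‖t‖ ^ 2 = t.ofLp ⬝ᵥ t.ofLp := by
      rw [EuclideanSpace.real_norm_sq_eq]
      simp only [dotProduct, sq]
    rw [← hn]
    push_cast
    rw [neg_div]
  rw [hT]
  simp only [hstud]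
  -- The direction is `b n = C_n^{-1/2} t`, whose quadratic form equals `t·t` as soon as `C_n` is
  -- positive definite. Positivity of `r` is used from index 1 on, since `r 0` is arbitrary.
  refine tendsto_charFun_of_norm_sub_le (eventually_atTop.2 ⟨1, hr_pos⟩) (fun n => (hRpos n).le)
    (fun n => (α (n + 1)).2.1.le.trans (hs n _ n.lt_succ_self)) hrR hr_sup hw hK ?_
    fun n => hφ n _
  filter_upwards [hpd] with n hn using dotProduct_invSqrt_mulVec hn _

end CLT

end NewtonMixture

open NewtonMixture in
theorem mainTheorem8
    {Ω 𝕏 Θ : Type*} [MeasurableSpace Ω]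
    [MeasurableSpace 𝕏] [StandardBorelSpace 𝕏]
    [TopologicalSpace Θ] [TopologicalSpace.MetrizableSpace Θ] [SecondCountableTopology Θ]
    [MeasurableSpace Θ] [BorelSpace Θ] [StandardBorelSpace Θ]
    (P : Measure Ω) [IsProbabilityMeasure P]
    (μ : Measure 𝕏) [SigmaFinite μ]
    (f : 𝕏 → Θ → ℝ≥0) (hf_meas : Measurable (Function.uncurry f))
    (hf_density : ∀ t : Θ, ∫⁻ x, (f x t : ℝ≥0∞) ∂μ = 1)
    (G₀ : ProbabilityMeasure Θ)
    (α : ℕ → Set.Ioo (0 : ℝ) 1)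
    (X : ℕ → Ω → 𝕏) (θ : ℕ → Ω → Θ)
    (hmodel : IsNewtonModel P μ f G₀ α X θ)
    (hα : ¬ Summable (fun n => (α n : ℝ))) (hα_sq : Summable (fun n => (α n : ℝ) ^ 2))
    (r : ℕ → ℝ) (hr_pos : ∀ n, 1 ≤ n → 0 < r n)
    (hr_mono : MonotoneOn r (Set.Ici 1) ∨ AntitoneOn r (Set.Ici 1))
    (hr_equiv : r ~[atTop] fun n => (∑' j, (α (n + 1 + j) : ℝ) ^ 2)⁻¹)
    (hr_sup : Tendsto (fun n => √(r n) * ⨆ k : Set.Ici n, (α k : ℝ)) atTop (𝓝 0))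
    (hr_sum : Summable (fun k => r k ^ 2 * (α (k + 1) : ℝ) ^ 4)) :
    (∀ᵐ ω ∂P, Tendsto (fun n => newtonRule f G₀ α (fun i => X i ω) n) atTop
      (𝓝 (limitMixing f G₀ α (fun i => X i ω)))) ∧
    ∀ k : ℕ, 1 ≤ k → ∀ A : Fin k → Set Θ, (∀ i, MeasurableSet (A i)) →
      ∀ᵐ ω ∂P, (limitCov μ f A (limitMixing f G₀ α (fun i => X i ω))).det ≠ 0 →
        Tendsto (fun n => condLaw P X (studentized μ f G₀ α r X A n) n ω) atTop
          (𝓝 (stdNormal k)) := by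
  obtain ⟨ω₀⟩ := nonempty_of_isProbabilityMeasure P
  have : Nonempty 𝕏 := ⟨X 0 ω₀⟩
  obtain ⟨κ, hκ, hconv, hlim⟩ := exists_isLimitKernel hf_meas hf_density hmodel
  exact ⟨hconv, fun k _ A hA => ae_tendsto_condLaw_studentized hf_meas hf_density hmodel hκ hlim hA
    hα_sq hr_pos hr_equiv hr_sup⟩
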